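/- **Setting.** Let $\mathcal G=(V,E)$ be a connected planar graph embedded in $\mathbb R^2$, with straight edges that intersect only at common end-points, locally finite (every bounded region contains finitely many vertices, and all degrees are finite), with $0\in V$, and invariant under the translations by two non-collinear vectors, under the rotation by some angle $\theta\in(0,\pi)$ around $0$, and under the orthogonal reflection in the vertical axis $\{(0,y):y\in\mathbb R\}$. Fix $q\ge 1$. For a finite set $E_G\subset E$, let $G$ be the graph with edge set $E_G$ whose vertex set $V_G$ is the set of end-points of $E_G$. A boundary condition $\xi$ on $G$ is a partition of $V_G$ (vertices in the same class are wired), and for $p\in(0,1)$ and $\eta\in\{0,1\}^{E_G}$, $$\phi^{\xi}_{p,q,G}(\eta)=\frac{p^{o(\eta)}(1-p)^{c(\eta)}q^{k(\eta^\xi)}}{Z^\xi(p,q,G)},$$ where $o(\eta)$ and $c(\eta)$ are the numbers of open and closed edges, $k(\eta^\xi)$ is the number of clusters after wired vertices are identified, and $Z^\xi(p,q,G)$ normalizes. The free boundary condition $\xi=0$ has no wiring. An infinite-volume random-cluster measure with edge-weight $p$ (and cluster-weight $q$) is a probability measure $\phi_p$ on $\{0,1\}^{E}$ such that, for every such finite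 $G$ and every $\xi$, conditionally on the event that $\xi$ is the partition of $V_G$ according to connection by open paths using no edge of $E_G$, the configuration on $E_G$ has law $\phi^\xi_{p,q,G}$ (whenever this event has positive probability). Let $\phi^0_p$ be the limit of $\phi^0_{p,q,G}$ as $G$ increases to $\mathcal G$, write $\{0\leftrightarrow\infty\}$ for the event that the open cluster of $0$ is infinite, and let $$p_c=\inf\{p\in(0,1):\phi^0_p(0\leftrightarrow\infty)>0\}\qquad(\inf\emptyset=1).$$ The dual lattice $\mathcal G^*$ has one vertex placed in each face of $\mathcal G$, and each $e\in E$ has a dual edge $e^*$ joining the faces on the two sides of $e$; $e^*$ is dual-open if $e$ is closed. Write $u\overset{*}{\longleftrightarrow}v$ if the dual vertices $u,v$ are joined by a path of dual-open edges. **Proposition.** Let $p\in(0,1)$ and let $\phi_p$ be any infinite-volume random-cluster measure on $\mathcal G$ with edge-weight $p$ and cluster-weight $q$. Suppose that there exists $c>0$ such that, for all vertices $u,v$ of $\mathcal G^*$, $$\phi_p(u\overset{*}{\longleftrightarrow}v)\le \exp(-c|u-v|).$$ Then $\phi_p(0\leftrightarrow\infty)>0$ and $p\ge p_c$. -/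

import Mathlib

open MeasureTheory Set Filter Topology

/-- The map `f` of the plane `ℝ² = ℂ` restricts to an automorphism of the graph `G`, whose vertices
are points of the plane. (Edges are drawn as straight segments, so for an affine map `f` this says
that `f` is an automorphism of the embedded graph.) -/
def IsEmbeddedAut {V : Set ℂ} (G : SimpleGraph V) (f : ℂ → ℂ) : Prop :=
  ∃ φ : G ≃g G, ∀ x : V, ((φ x : V) : ℂ) = f x

/-- The closed straight segment along which an edge is drawn. -/
def edgeSegment {V : Set ℂ} : Sym2 V → Set ℂ :=
  Sym2.lift ⟨fun x y => segment ℝ (x : ℂ) (y : ℂ), fun x y => segment_symm ℝ (x : ℂ) (y : ℂ)⟩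

/-- A connected, locally finite, doubly periodic planar graph, embedded in the plane `ℝ² = ℂ` with
straight edges, one of whose vertices is the origin, and which is invariant under a rotation of
angle `θ ∈ (0, π)` around the origin and under the reflection in the vertical axis. -/
structure PlanarLattice where
  /-- the set of vertices -/
  V : Set ℂ
  /-- the adjacency relation -/
  graph : SimpleGraph V
  zero_mem : (0 : ℂ) ∈ V
  connected : graph.Connected
  /-- a bounded region contains finitely many vertices -/
  finite_vertices : ∀ r : ℝ, (V ∩ Metric.closedBall (0 : ℂ) r).Finite
  /-- a vertex has finitely many neighbours -/
  finite_neighbors : ∀ x : V, (graph.neighborSet x).Finite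
  /-- two distinct edges can meet only at a common end-point -/
  planar : ∀ e ∈ graph.edgeSet, ∀ f ∈ graph.edgeSet, e ≠ f →
    ∀ z ∈ edgeSegment e ∩ edgeSegment f, ∃ x : V, (x : ℂ) = z ∧ x ∈ e ∧ x ∈ f
  periodic : ∃ u v : ℂ, LinearIndependent ℝ ![u, v] ∧
    IsEmbeddedAut graph (fun z => z + u) ∧ IsEmbeddedAut graph (fun z => z + v)
  rotation : ∃ θ ∈ Ioo (0 : ℝ) Real.pi,
    IsEmbeddedAut graph (fun z => Complex.exp (θ * Complex.I) * z)
  reflection : IsEmbeddedAut graph (fun z => -(starRingEnd ℂ) z)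

namespace PlanarLattice

variable (L : PlanarLattice)

/-- The origin, as a vertex of the lattice. -/
def origin : L.V := ⟨0, L.zero_mem⟩

/-- The edges of the lattice. -/
abbrev Edge : Type := L.graph.edgeSet

/-- Configurations on the whole lattice: the edge `e` is open if `ω e = true`, and closed
otherwise. The space carries the product σ-algebra. -/
abbrev Config : Type := L.Edge → Bool

/-- The graph on the vertices of the lattice whose edges are those in `S`. -/
def subgraphOf (S : Set L.Edge) : SimpleGraph L.V :=
  SimpleGraph.fromEdgeSet ((fun e : L.Edge => (e : Sym2 L.V)) '' S)

/-! ### Finite-volume random-cluster measures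

A finite subgraph is given by its finite set of edges `E`; its vertices are the end-points of the
edges in `E`. -/

/-- The vertex set of the finite subgraph with edge set `E`. -/
def verts (E : Finset L.Edge) : Set L.V := {x | ∃ e ∈ E, x ∈ (e : Sym2 L.V)}

/-- A boundary condition on the finite subgraph with edge set `E`, written as a partition (an
equivalence relation) of all its vertices; the vertices that are wired to no other vertex, in
particular those that have no edge outside `E`, form classes of size one. -/
abbrev BoundaryCondition (E : Finset L.Edge) : Type := Setoid (L.verts E)

variable {L}

/-- Two vertices of the finite subgraph are related if an open path of `η` joins them. -/
def openSetoid (E : Finset L.Edge) (η : E → Bool) : Setoid (L.verts E) :=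
  (L.subgraphOf {e | ∃ h : e ∈ E, η ⟨e, h⟩ = true}).reachableSetoid.comap Subtype.val

/-- The number of open edges of `η`. -/
def numOpen (E : Finset L.Edge) (η : E → Bool) : ℕ := (Finset.univ.filter fun e => η e = true).card

/-- The number of closed edges of `η`. -/
def numClosed (E : Finset L.Edge) (η : E → Bool) : ℕ :=
  (Finset.univ.filter fun e => η e = false).card

/-- The number of clusters of `η`, after the vertices in a same class of the boundary condition `ξ`
have been identified. -/
noncomputable def numClusters (E : Finset L.Edge) (ξ : L.BoundaryCondition E) (η : E → Bool) : ℕ :=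
  Nat.card (Quotient (openSetoid E η ⊔ ξ))

/-- The weight `p ^ o(η) * (1 - p) ^ c(η) * q ^ k(η ^ ξ)`. -/
noncomputable def fvWeight (p q : ℝ) (E : Finset L.Edge) (ξ : L.BoundaryCondition E)
    (η : E → Bool) : ℝ :=
  p ^ numOpen E η * (1 - p) ^ numClosed E η * q ^ numClusters E ξ η

/-- The probability of `η` under the random-cluster measure on the finite subgraph with edge set
`E`, with edge-weight `p`, cluster-weight `q` and boundary condition `ξ`. -/
noncomputable def fvProb (p q : ℝ) (E : Finset L.Edge) (ξ : L.BoundaryCondition E)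
    (η : E → Bool) : ℝ :=
  fvWeight p q E ξ η / ∑ η' : E → Bool, fvWeight p q E ξ η'

/-- The probability of an event under the finite-volume random-cluster measure. -/
noncomputable def fvEventProb (p q : ℝ) (E : Finset L.Edge) (ξ : L.BoundaryCondition E)
    (A : Set (E → Bool)) : ℝ :=
  ∑ η : E → Bool, A.indicator (fvProb p q E ξ) η

/-! ### Infinite-volume measures -/

/-- The boundary condition induced by `ω` on the finite subgraph with edge set `E`: two vertices are
wired if they are joined by a path of open edges of `ω` outside `E`. -/
def inducedBC (E : Finset L.Edge) (ω : L.Config) : L.BoundaryCondition E :=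
  (L.subgraphOf {e | e ∉ E ∧ ω e = true}).reachableSetoid.comap Subtype.val

/-- `φ` is an infinite-volume random-cluster measure with edge-weight `p` and cluster-weight `q`:
for every finite subgraph and every boundary condition `ξ`, conditionally on inducing `ξ`, the
restriction of the configuration to the subgraph has the finite-volume law with boundary condition
`ξ`. (The condition is void when `ξ` is induced with probability zero.) -/
structure IsRandomClusterMeasure (p q : ℝ) (φ : Measure L.Config) : Prop where
  isProbabilityMeasure : IsProbabilityMeasure φ
  conditional : ∀ (E : Finset L.Edge) (ξ : L.BoundaryCondition E) (η : E → Bool),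
    φ.real {ω | E.restrict ω = η ∧ inducedBC E ω = ξ} =
      fvProb p q E ξ η * φ.real {ω | inducedBC E ω = ξ}

/-- `φ` is the infinite-volume measure with free boundary conditions: the limit, as the finite
subgraph `E` increases to the whole lattice, of the finite-volume measures on `E` with free boundary
conditions (no wiring, `⊥`). The probability of every event `{ω = ζ on F}`, `F` finite,
converges. -/
structure IsFreeMeasure (p q : ℝ) (φ : Measure L.Config) : Prop where
  isProbabilityMeasure : IsProbabilityMeasure φ
  tendsto : ∀ (F : Finset L.Edge) (ζ : F → Bool),
    Tendsto
      (fun E : Finset L.Edge => fvEventProb p q E ⊥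
        {η | ∀ (e : L.Edge) (hE : e ∈ E) (hF : e ∈ F), η ⟨e, hE⟩ = ζ ⟨e, hF⟩})
      atTop (𝓝 (φ.real {ω | F.restrict ω = ζ}))

/-- The event `x ↔ ∞`: the open cluster of `x` is infinite. -/
def ConnectedToInfinity (ω : L.Config) (x : L.V) : Prop :=
  {y : L.V | (L.subgraphOf {e | ω e = true}).Reachable x y}.Infinite

variable (L) in
/-- The critical point: the infimum, in `[0, 1]`, of the set of those `p ∈ (0, 1)` for which the
origin is in an infinite cluster with positive probability under the infinite-volume measure with
free boundary conditions. (The element `1` makes the infimum of the empty set equal to `1`.) -/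
noncomputable def criticalPoint (q : ℝ) : ℝ :=
  sInf (insert 1 {p : ℝ | p ∈ Ioo (0 : ℝ) 1 ∧ ∃ φ : Measure L.Config,
    IsFreeMeasure p q φ ∧ 0 < φ {ω | ConnectedToInfinity ω L.origin}})

/-! ### Planar duality -/

variable (L) in
/-- The points of the plane that are on the drawing of the lattice. -/
def drawing : Set ℂ := L.V ∪ ⋃ e ∈ L.graph.edgeSet, edgeSegment e

variable (L) in
/-- The faces of the lattice, i.e. the connected components of the complement of the drawing. They
are the vertices of the dual lattice. -/
def Face : Type := {F : Set ℂ // ∃ z ∈ L.drawingᶜ, F = connectedComponentIn L.drawingᶜ z}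

/-- The dual edge `e*` joins the faces `F` and `F'`: the edge `e` lies on the boundary of both.
(Loops of the dual lattice play no role for dual connections, so `F = F'` need not be excluded.) -/
def DualJoins (e : L.Edge) (F F' : L.Face) : Prop :=
  edgeSegment (e : Sym2 L.V) ⊆ frontier F.1 ∧ edgeSegment (e : Sym2 L.V) ⊆ frontier F'.1

/-- The faces `F` and `F'` are dual-connected in `ω`: there is a path from `F` to `F'` in the dual
lattice whose edges `e*` are all dual-open, i.e. the edges `e` are closed in `ω`. -/
def DualConnected (ω : L.Config) : L.Face → L.Face → Prop :=
  Relation.ReflTransGen fun F F' => ∃ e : L.Edge, ω e = false ∧ DualJoins e F F'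

variable (L) in
/-- A choice of the position in the plane of each vertex of the dual lattice: the vertex is placed
in the corresponding face. -/
structure DualPlacement where
  pos : L.Face → ℂ
  pos_mem : ∀ F : L.Face, pos F ∈ F.1

end PlanarLattice

/-!
If the cluster of `x` is finite, then its boundary consists of closed edges, and two infinite paths
from `x` in opposite directions both cross it, at edges whose adjacent faces are dual-connected.
Opening all edges of a long segment of these paths forces the crossings to be far apart, so
exponential decay makes a finite cluster unlikely. As opening finitely many edges costs at most a
constant factor, every translate of the origin percolates under `φ` with probability at least some
`δ > 0`.

Let `p < p'`. On a large box, the logarithms of the partition functions with wired and with free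
boundary condition differ by a boundary term, so at some `s` between `p` and `p'` their derivatives,
and with them the densities of open edges, almost agree. By monotonicity the free measure at `p'`
then gives increasing local events at least the average of the probabilities that `φ` gives to their
translates. Hence it percolates too, and `p_c ≤ p'`.
-/

/-! ### The number of classes of an equivalence relation -/

section Setoid

variable {W : Type*}

/-- The space of real functions that are constant on the classes of `s`. Its dimension is the number
of classes, and it turns suprema of equivalence relations into intersections. -/
def invariantFunctions (s : Setoid W) : Submodule ℝ (W → ℝ) where
  carrier := {f | s ≤ Setoid.ker f}
  add_mem' {f g} hf hg x y h := congrArg₂ (· + ·) (hf h : f x = f y) (hg h : g x = g y)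
  zero_mem' _ _ _ := rfl
  smul_mem' c f hf x y h := congrArg (c * ·) (hf h : f x = f y)

theorem mem_invariantFunctions {s : Setoid W} {f : W → ℝ} :
    f ∈ invariantFunctions s ↔ s ≤ Setoid.ker f := Iff.rfl

theorem invariantFunctions_sup (s t : Setoid W) :
    invariantFunctions (s ⊔ t) = invariantFunctions s ⊓ invariantFunctions t := by
  ext f
  simp only [Submodule.mem_inf, mem_invariantFunctions, sup_le_iff]

theorem invariantFunctions_antitone : Antitone (invariantFunctions (W := W)) :=
  fun _ _ h _ hf => h.trans hf

/-- The functions constant on the classes of `s`, seen as functions on the quotient. -/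
def invariantFunctionsEquiv (s : Setoid W) : (Quotient s → ℝ) ≃ₗ[ℝ] invariantFunctions s where
  toFun g := ⟨fun x => g (Quotient.mk s x), fun _ _ h => congrArg g (Quotient.sound h)⟩
  invFun f := Quotient.lift f.1 fun _ _ h => f.2 h
  map_add' _ _ := rfl
  map_smul' _ _ := rfl
  left_inv _ := funext fun x => Quotient.inductionOn x fun _ => rfl
  right_inv _ := rfl

theorem finrank_invariantFunctions [Finite W] (s : Setoid W) :
    Module.finrank ℝ (invariantFunctions s) = Nat.card (Quotient s) := by
  have := Fintype.ofFinite (Quotient s)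
  rw [← (invariantFunctionsEquiv s).finrank_eq, Module.finrank_fintype_fun_eq_card,
    Nat.card_eq_fintype_card]

theorem card_quotient_add_card_quotient_sup_le [Finite W] {s t : Setoid W} (h : s ≤ t)
    (u : Setoid W) :
    Nat.card (Quotient t) + Nat.card (Quotient (s ⊔ u)) ≤
      Nat.card (Quotient s) + Nat.card (Quotient (t ⊔ u)) := by
  simp only [← finrank_invariantFunctions]
  rw [invariantFunctions_sup s, invariantFunctions_sup t]
  have dim_formula := Submodule.finrank_sup_add_finrank_inf_eq (invariantFunctions t)
    (invariantFunctions s ⊓ invariantFunctions u)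
  rw [← inf_assoc, inf_eq_left.2 (invariantFunctions_antitone h)] at dim_formula
  have sup_le : Module.finrank ℝ ↥(invariantFunctions t ⊔
      (invariantFunctions s ⊓ invariantFunctions u)) ≤ Module.finrank ℝ (invariantFunctions s) :=
    Submodule.finrank_mono (sup_le (invariantFunctions_antitone h) inf_le_left)
  omega

theorem card_quotient_le_of_le [Finite W] {s t : Setoid W} (h : s ≤ t) :
    Nat.card (Quotient t) ≤ Nat.card (Quotient s) := by
  simp only [← finrank_invariantFunctions]
  exact Submodule.finrank_mono (invariantFunctions_antitone h)

/-- The equivalence relation that wires the points of `D` together: `D` is a class, and all other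
classes are singletons. -/
abbrev wiring (D : Set W) : Setoid W where
  r x y := x = y ∨ (x ∈ D ∧ y ∈ D)
  iseqv :=
    { refl := fun _ => Or.inl rfl
      symm := fun h => h.imp Eq.symm And.symm
      trans := by
        rintro x y z (rfl | hxy) (rfl | hyz)
        exacts [Or.inl rfl, Or.inr hyz, Or.inr hxy, Or.inr ⟨hxy.1, hyz.2⟩] }

theorem card_le_card_quotient_add_ncard [Finite W] {w : Setoid W} {D : Set W}
    (hw : w ≤ wiring D) : Nat.card W ≤ Nat.card (Quotient w) + D.ncard := by
  have hcompl : Dᶜ.ncard ≤ Nat.card (Quotient w) := by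
    rw [← Nat.card_coe_set_eq]
    refine Nat.card_le_card_of_injective (fun x : ↥Dᶜ => Quotient.mk w x.1) fun x y hxy => ?_
    rcases hw (Quotient.exact hxy) with h | h
    · exact Subtype.ext h
    · exact absurd h.1 x.2
  have := Set.ncard_add_ncard_compl D
  omega

theorem card_quotient_le_card_quotient_sup_add_ncard [Finite W] (s : Setoid W) {w : Setoid W}
    {D : Set W} (hw : w ≤ wiring D) :
    Nat.card (Quotient s) ≤ Nat.card (Quotient (s ⊔ w)) + D.ncard := by
  have hsup := card_quotient_add_card_quotient_sup_le (bot_le : ⊥ ≤ s) w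
  rw [bot_sup_eq] at hsup
  have hbot : Nat.card (Quotient (⊥ : Setoid W)) ≤ Nat.card W :=
    Nat.card_le_card_of_surjective _ Quotient.mk_surjective
  have := card_le_card_quotient_add_ncard hw
  omega

theorem card_quotient_eq_card_quotient_comap_add {W' : Type*} [Finite W'] {f : W → W'}
    (hf : Function.Injective f) {s : Setoid W'} (hs : s ≤ wiring (range f)) :
    Nat.card (Quotient s) = Nat.card (Quotient (s.comap f)) + (range f)ᶜ.ncard := by
  have : Finite W := Finite.of_injective f hf
  have eq_of_notMem {x y : W'} (h : s x y) (hx : x ∉ range f) : x = y :=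
    (hs h).resolve_right fun h' => hx h'.1
  let onClasses : Quotient (s.comap f) ⊕ ↥(range f)ᶜ → Quotient s :=
    Sum.elim (Quotient.lift (fun x => Quotient.mk s (f x)) fun _ _ h => Quotient.sound h)
      fun x => Quotient.mk s x.1
  have hinj : Function.Injective onClasses := by
    rintro (a | a) (b | b) h
    · induction a, b using Quotient.inductionOn₂ with | _ a b
      exact congrArg Sum.inl (Quotient.sound (Quotient.exact (s := s) h))
    · induction a using Quotient.inductionOn with | _ a
      exact absurd ⟨a, (eq_of_notMem (s.symm (Quotient.exact (s := s) h)) b.2).symm⟩ b.2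
    · induction b using Quotient.inductionOn with | _ b
      exact absurd ⟨b, (eq_of_notMem (Quotient.exact (s := s) h) a.2).symm⟩ a.2
    · exact congrArg Sum.inr (Subtype.ext (eq_of_notMem (Quotient.exact (s := s) h) a.2))
  have hsurj : Function.Surjective onClasses := by
    rintro ⟨x⟩
    by_cases hx : x ∈ range f
    · obtain ⟨a, rfl⟩ := hx
      exact ⟨Sum.inl (Quotient.mk _ a), rfl⟩
    · exact ⟨Sum.inr ⟨x, hx⟩, rfl⟩
  rw [← Nat.card_coe_set_eq, ← Nat.card_sum, Nat.card_congr (Equiv.ofBijective _ ⟨hinj, hsurj⟩)]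

end Setoid

instance {W : Type*} [Finite W] : Finite (Setoid W) :=
  Finite.of_injective (fun s : Setoid W => (fun x y => s x y : W → W → Prop)) fun _ _ h =>
    Setoid.ext fun x y => iff_of_eq (congrFun (congrFun h x) y)

instance {W : Type*} [Countable W] : Countable (Sym2 W) := Quot.mk_surjective.countable

theorem monotone_indicator_one {α : Type*} [Preorder α] {A : Set α} (hA : IsUpperSet A) :
    Monotone (A.indicator (1 : α → ℝ)) := by
  classical
  intro a b h
  by_cases ha : a ∈ A
  · rw [indicator_of_mem ha, indicator_of_mem (hA h ha), Pi.one_apply, Pi.one_apply]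
  · rw [indicator_of_notMem ha]
    exact indicator_nonneg (fun _ _ => zero_le_one) _

namespace PlanarLattice

variable {L : PlanarLattice} {p q : ℝ}

/-! ### Finite-volume weights -/

theorem verts_eq (E : Finset L.Edge) [DecidableEq L.V] :
    L.verts E = E.biUnion fun e => (e : Sym2 L.V).toFinset := by
  ext x
  simp [verts]

theorem finite_verts (E : Finset L.Edge) : (L.verts E).Finite := by
  classical
  exact verts_eq E ▸ Finset.finite_toSet _

instance (E : Finset L.Edge) : Finite (L.verts E) := (finite_verts E).to_subtype

theorem verts_mono {E E' : Finset L.Edge} (h : E ⊆ E') : L.verts E ⊆ L.verts E' :=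
  fun _ ⟨e, he, hx⟩ => ⟨e, h he, hx⟩

theorem ncard_verts_le (E : Finset L.Edge) : (L.verts E).ncard ≤ 2 * E.card := by
  classical
  rw [verts_eq, Set.ncard_coe_finset, mul_comm]
  refine Finset.card_biUnion_le_card_mul _ _ _ fun e _ => ?_
  rw [Sym2.card_toFinset]
  split_ifs <;> omega

theorem subgraphOf_adj {S : Set L.Edge} {x y : L.V} :
    (L.subgraphOf S).Adj x y ↔ ∃ e ∈ S, (e : Sym2 L.V) = s(x, y) := by
  simp only [subgraphOf, SimpleGraph.fromEdgeSet_adj, mem_image]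
  refine and_iff_left_of_imp ?_
  rintro ⟨e, -, he⟩
  exact (L.graph.mem_edgeSet.1 (he ▸ e.2)).ne

theorem subgraphOf_mono {S T : Set L.Edge} (h : S ⊆ T) : L.subgraphOf S ≤ L.subgraphOf T :=
  SimpleGraph.fromEdgeSet_mono (image_mono h)

theorem openSetoid_le_iff {E : Finset L.Edge} {η : E → Bool} {r : Setoid (L.verts E)} :
    openSetoid E η ≤ r ↔ ∀ e (he : e ∈ E), η ⟨e, he⟩ = true →
      ∀ x y : L.verts E, (e : Sym2 L.V) = s(x.1, y.1) → r x y := by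
  refine ⟨fun h e he ho x y hxy =>
    h (SimpleGraph.Adj.reachable (subgraphOf_adj.2 ⟨e, ⟨he, ho⟩, hxy⟩)), fun h => ?_⟩
  rintro ⟨x, hx⟩ ⟨y, hy⟩ hxy
  obtain ⟨walk⟩ : (L.subgraphOf {e | ∃ h : e ∈ E, η ⟨e, h⟩ = true}).Reachable x y := hxy
  induction walk with
  | nil => exact r.refl _
  | cons hadj _ ih =>
    obtain ⟨e, ⟨he, ho⟩, hxz⟩ := subgraphOf_adj.1 hadj
    have hz : _ ∈ L.verts E := ⟨e, he, hxz ▸ Sym2.mem_mk_right _ _⟩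
    exact r.trans (h e he ho ⟨_, hx⟩ ⟨_, hz⟩ hxz) (ih hz hy)

theorem openSetoid_le_wiring {E F : Finset L.Edge} {η : E → Bool}
    (hη : ∀ e : E, η e = true → e.1 ∈ F) : openSetoid E η ≤ wiring {x | x.1 ∈ L.verts F} :=
  openSetoid_le_iff.2 fun e he ho _ _ hxy =>
    have heF : e ∈ F := hη ⟨e, he⟩ ho
    Or.inr ⟨⟨e, heF, hxy ▸ Sym2.mem_mk_left _ _⟩, ⟨e, heF, hxy ▸ Sym2.mem_mk_right _ _⟩⟩

theorem openSetoid_mono (E : Finset L.Edge) : Monotone (openSetoid E) := fun _ _ h =>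
  openSetoid_le_iff.2 fun e he ho => openSetoid_le_iff.1 le_rfl e he (h ⟨e, he⟩ ho)

theorem openSetoid_sup {E : Finset L.Edge} (a b : E → Bool) :
    openSetoid E (a ⊔ b) = openSetoid E a ⊔ openSetoid E b := by
  refine le_antisymm (openSetoid_le_iff.2 fun e he ho x y hxy => ?_)
    (sup_le (openSetoid_mono E le_sup_left) (openSetoid_mono E le_sup_right))
  have hab : a ⟨e, he⟩ = true ∨ b ⟨e, he⟩ = true := by simpa using ho
  rcases hab with ho | ho
  · exact (le_sup_left : openSetoid E a ≤ _) (openSetoid_le_iff.1 le_rfl e he ho x y hxy)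
  · exact (le_sup_right : openSetoid E b ≤ _) (openSetoid_le_iff.1 le_rfl e he ho x y hxy)

theorem numClusters_add_le {E : Finset L.Edge} {ξ ξ' : L.BoundaryCondition E} (hξ : ξ ≤ ξ')
    (a b : E → Bool) : numClusters E ξ a + numClusters E ξ' b ≤
      numClusters E ξ (a ⊓ b) + numClusters E ξ' (a ⊔ b) := by
  have h := card_quotient_add_card_quotient_sup_le (s := openSetoid E (a ⊓ b) ⊔ ξ)
    (t := openSetoid E b ⊔ ξ') (sup_le_sup (openSetoid_mono E inf_le_right) hξ) (openSetoid E a)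
  rw [sup_right_comm, sup_eq_right.2 (openSetoid_mono E (inf_le_left : a ⊓ b ≤ a)),
    sup_right_comm, ← openSetoid_sup, sup_comm b] at h
  unfold numClusters
  omega

theorem numOpen_add_numClosed {E : Finset L.Edge} (η : E → Bool) :
    numOpen E η + numClosed E η = E.card := by
  simpa [numOpen, numClosed] using
    Finset.card_filter_add_card_filter_not (s := (Finset.univ : Finset E)) fun e => η e = true

/-- The weight of a single edge in state `b`. -/
def edgeWeight (p : ℝ) (b : Bool) : ℝ := if b = true then p else 1 - p

theorem edgeWeight_pos (hp : p ∈ Ioo (0 : ℝ) 1) (b : Bool) : 0 < edgeWeight p b := by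
  rcases b <;> simp [edgeWeight, hp.1, hp.2]

theorem edgeWeight_mul_le {p' : ℝ} (h : p ≤ p') (a b : Bool) :
    edgeWeight p a * edgeWeight p' b ≤ edgeWeight p (a ⊓ b) * edgeWeight p' (a ⊔ b) := by
  rcases a <;> rcases b <;> simp [edgeWeight]
  linarith

theorem fvWeight_eq (p q : ℝ) (E : Finset L.Edge) (ξ : L.BoundaryCondition E) (η : E → Bool) :
    fvWeight p q E ξ η = (∏ e, edgeWeight p (η e)) * q ^ numClusters E ξ η := by
  simp only [fvWeight, edgeWeight, Finset.prod_ite, Finset.prod_const, numOpen, numClosed,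
    Bool.not_eq_true]

theorem fvWeight_pos (hp : p ∈ Ioo (0 : ℝ) 1) (hq : 1 ≤ q) (E : Finset L.Edge)
    (ξ : L.BoundaryCondition E) (η : E → Bool) : 0 < fvWeight p q E ξ η := by
  rw [fvWeight_eq]
  exact mul_pos (Finset.prod_pos fun _ _ => edgeWeight_pos hp _)
    (pow_pos (zero_lt_one.trans_le hq) _)

theorem fvWeight_mul_le {p' : ℝ} (hp : p ∈ Ioo (0 : ℝ) 1) (hp' : p' ∈ Ioo (0 : ℝ) 1)
    (hpp : p ≤ p') (hq : 1 ≤ q) {E : Finset L.Edge} {ξ ξ' : L.BoundaryCondition E} (hξ : ξ ≤ ξ')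
    (a b : E → Bool) : fvWeight p q E ξ a * fvWeight p' q E ξ' b ≤
      fvWeight p q E ξ (a ⊓ b) * fvWeight p' q E ξ' (a ⊔ b) := by
  simp only [fvWeight_eq, mul_mul_mul_comm _ (q ^ _), ← Finset.prod_mul_distrib, ← pow_add]
  have hpos (a b : Bool) : 0 ≤ edgeWeight p a * edgeWeight p' b :=
    (mul_pos (edgeWeight_pos hp a) (edgeWeight_pos hp' b)).le
  have hprod : ∏ e, edgeWeight p (a e) * edgeWeight p' (b e) ≤
      ∏ e, edgeWeight p ((a ⊓ b) e) * edgeWeight p' ((a ⊔ b) e) :=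
    Finset.prod_le_prod (fun _ _ => hpos _ _) fun _ _ => edgeWeight_mul_le hpp _ _
  have hpow : q ^ (numClusters E ξ a + numClusters E ξ' b) ≤
      q ^ (numClusters E ξ (a ⊓ b) + numClusters E ξ' (a ⊔ b)) :=
    pow_le_pow_right₀ hq (numClusters_add_le hξ a b)
  exact mul_le_mul hprod hpow (pow_nonneg (zero_le_one.trans hq) _)
    (Finset.prod_nonneg fun _ _ => hpos _ _)

theorem fvWeight_le_of_numClusters_le (hp : p ∈ Ioo (0 : ℝ) 1) (hq : 1 ≤ q) {E : Finset L.Edge}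
    {ξ ξ' : L.BoundaryCondition E} {η : E → Bool} {n : ℕ}
    (h : numClusters E ξ η ≤ n + numClusters E ξ' η) :
    fvWeight p q E ξ η ≤ q ^ n * fvWeight p q E ξ' η := by
  rw [fvWeight_eq, fvWeight_eq, mul_left_comm, ← pow_add]
  exact mul_le_mul_of_nonneg_left (pow_le_pow_right₀ hq h)
    (Finset.prod_nonneg fun _ _ => (edgeWeight_pos hp _).le)

theorem fvWeight_bot_le (hp : p ∈ Ioo (0 : ℝ) 1) (hq : 1 ≤ q) {E : Finset L.Edge}
    {ξ : L.BoundaryCondition E} {D : Set (L.verts E)} (hD : ξ ≤ wiring D) (η : E → Bool) :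
    fvWeight p q E ⊥ η ≤ q ^ D.ncard * fvWeight p q E ξ η := by
  refine fvWeight_le_of_numClusters_le hp hq ?_
  unfold numClusters
  rw [sup_bot_eq, add_comm]
  exact card_quotient_le_card_quotient_sup_add_ncard _ hD

theorem fvWeight_antitone (hp : p ∈ Ioo (0 : ℝ) 1) (hq : 1 ≤ q) {E : Finset L.Edge}
    (η : E → Bool) : Antitone fun ξ => fvWeight p q E ξ η := fun ξ ξ' hξ => by
  have hcard : numClusters E ξ' η ≤ 0 + numClusters E ξ η := by
    rw [zero_add]
    exact card_quotient_le_of_le (sup_le_sup le_rfl hξ)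
  simpa using fvWeight_le_of_numClusters_le hp hq hcard

open Classical in
/-- The configuration on `E` in which precisely the edges in `F` are open. -/
noncomputable def openOn (E F : Finset L.Edge) : E → Bool := fun e => decide (e.1 ∈ F)

theorem numClusters_le_sup_openOn (E F : Finset L.Edge) (ξ : L.BoundaryCondition E)
    (η : E → Bool) : numClusters E ξ η ≤ numClusters E ξ (η ⊔ openOn E F) + 2 * F.card := by
  have hD : {x : L.verts E | x.1 ∈ L.verts F}.ncard ≤ 2 * F.card :=
    (Set.ncard_le_ncard_of_injOn Subtype.val (fun _ hx => hx) Subtype.val_injective.injOn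
      (finite_verts F)).trans (ncard_verts_le F)
  have hcard := card_quotient_le_card_quotient_sup_add_ncard (openSetoid E η ⊔ ξ)
    (openSetoid_le_wiring (η := openOn E F) fun e he => by simpa [openOn] using he)
  rw [sup_right_comm, ← openSetoid_sup] at hcard
  exact hcard.trans (Nat.add_le_add_left hD _)

theorem pow_card_mul_prod_edgeWeight_le (hp : p ∈ Ioo (0 : ℝ) 1) (E F : Finset L.Edge)
    (η : E → Bool) :
    p ^ F.card * ∏ e, edgeWeight p (η e) ≤ ∏ e, edgeWeight p ((η ⊔ openOn E F) e) := by
  classical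
  have hF : p ^ F.card ≤ ∏ e : E, if e.1 ∈ F then p else 1 := by
    rw [Finset.prod_ite, Finset.prod_const, Finset.prod_const_one, mul_one]
    refine pow_le_pow_of_le_one hp.1.le hp.2.le ?_
    exact Finset.card_le_card_of_injOn (fun e => e.1) (fun e he => by simpa using he)
      Subtype.val_injective.injOn
  have hpos (e : E) : 0 ≤ if e.1 ∈ F then p else 1 := by split_ifs <;> linarith [hp.1]
  calc p ^ F.card * ∏ e, edgeWeight p (η e)
      ≤ (∏ e : E, if e.1 ∈ F then p else 1) * ∏ e, edgeWeight p (η e) :=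
        mul_le_mul_of_nonneg_right hF (Finset.prod_nonneg fun _ _ => (edgeWeight_pos hp _).le)
    _ = ∏ e : E, (if e.1 ∈ F then p else 1) * edgeWeight p (η e) := Finset.prod_mul_distrib.symm
    _ ≤ ∏ e, edgeWeight p ((η ⊔ openOn E F) e) := by
        refine Finset.prod_le_prod
          (fun e _ => mul_nonneg (hpos e) (edgeWeight_pos hp _).le) fun e _ => ?_
        by_cases he : e.1 ∈ F
        · have hle : edgeWeight p (η e) ≤ 1 := by
            rcases η e <;> simp [edgeWeight, hp.1.le, hp.2.le]
          simpa [openOn, he, edgeWeight] using mul_le_mul_of_nonneg_left hle hp.1.le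
        · simp [openOn, he]

theorem fvWeight_le_sup_openOn (hp : p ∈ Ioo (0 : ℝ) 1) (hq : 1 ≤ q)
    (E F : Finset L.Edge) (ξ : L.BoundaryCondition E) (η : E → Bool) :
    p ^ F.card * fvWeight p q E ξ η ≤ q ^ (2 * F.card) * fvWeight p q E ξ (η ⊔ openOn E F) := by
  have hpow : q ^ numClusters E ξ η ≤ q ^ (2 * F.card + numClusters E ξ (η ⊔ openOn E F)) :=
    pow_le_pow_right₀ hq ((numClusters_le_sup_openOn E F ξ η).trans_eq (add_comm _ _))
  rw [fvWeight_eq, fvWeight_eq, ← mul_assoc, mul_left_comm, ← pow_add]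
  exact mul_le_mul (pow_card_mul_prod_edgeWeight_le hp E F η) hpow
    (pow_nonneg (zero_le_one.trans hq) _) (Finset.prod_nonneg fun _ _ => (edgeWeight_pos hp _).le)

/-! ### Finite-volume measures and the FKG inequality -/

/-- The constant `Z` normalizing the random-cluster weights. -/
noncomputable def partitionFunction (p q : ℝ) (E : Finset L.Edge) (ξ : L.BoundaryCondition E) : ℝ :=
  ∑ η : E → Bool, fvWeight p q E ξ η

theorem partitionFunction_pos (hp : p ∈ Ioo (0 : ℝ) 1) (hq : 1 ≤ q) (E : Finset L.Edge)
    (ξ : L.BoundaryCondition E) : 0 < partitionFunction p q E ξ :=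
  Finset.sum_pos (fun η _ => fvWeight_pos hp hq E ξ η) Finset.univ_nonempty

theorem fvProb_eq (p q : ℝ) (E : Finset L.Edge) (ξ : L.BoundaryCondition E) (η : E → Bool) :
    fvProb p q E ξ η = fvWeight p q E ξ η / partitionFunction p q E ξ := rfl

theorem fvProb_nonneg (hp : p ∈ Ioo (0 : ℝ) 1) (hq : 1 ≤ q) (E : Finset L.Edge)
    (ξ : L.BoundaryCondition E) (η : E → Bool) : 0 ≤ fvProb p q E ξ η :=
  (div_pos (fvWeight_pos hp hq E ξ η) (partitionFunction_pos hp hq E ξ)).le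

theorem sum_fvProb (hp : p ∈ Ioo (0 : ℝ) 1) (hq : 1 ≤ q) (E : Finset L.Edge)
    (ξ : L.BoundaryCondition E) : ∑ η, fvProb p q E ξ η = 1 := by
  simp only [fvProb_eq, ← Finset.sum_div]
  exact div_self (partitionFunction_pos hp hq E ξ).ne'

open Classical in
/-- The configuration on the whole lattice that agrees with `η` on `E` and is closed outside. -/
noncomputable def extend (E : Finset L.Edge) (η : E → Bool) : L.Config :=
  fun e => if h : e ∈ E then η ⟨e, h⟩ else false

theorem extend_apply_mem {E : Finset L.Edge} (η : E → Bool) {e : L.Edge} (h : e ∈ E) :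
    extend E η e = η ⟨e, h⟩ := dif_pos h

theorem extend_apply_notMem {E : Finset L.Edge} (η : E → Bool) {e : L.Edge} (h : e ∉ E) :
    extend E η e = false := dif_neg h

theorem restrict_extend {E : Finset L.Edge} (η : E → Bool) : E.restrict (extend E η) = η :=
  funext fun e => extend_apply_mem η e.2

theorem extend_mono (E : Finset L.Edge) : Monotone (extend E) := fun a b h e => by
  by_cases he : e ∈ E
  · simpa only [extend_apply_mem _ he] using h ⟨e, he⟩
  · simp only [extend_apply_notMem _ he, le_refl]

/-- The mean of a function of the configuration under the finite-volume measure on `E`, the edges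
outside `E` being closed. -/
noncomputable def fvMean (p q : ℝ) (E : Finset L.Edge) (ξ : L.BoundaryCondition E)
    (f : L.Config → ℝ) : ℝ := ∑ η : E → Bool, f (extend E η) * fvProb p q E ξ η

theorem fvMean_eq (p q : ℝ) (E : Finset L.Edge) (ξ : L.BoundaryCondition E) (f : L.Config → ℝ) :
    fvMean p q E ξ f =
      (∑ η, f (extend E η) * fvWeight p q E ξ η) / partitionFunction p q E ξ := by
  simp only [fvMean, fvProb_eq, Finset.sum_div, mul_div_assoc]

theorem sum_mul_div_le_sum_mul_div_of_holley {α : Type*} [DistribLattice α] [OrderBot α]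
    [Fintype α] {f g μ : α → ℝ} (hf : 0 ≤ f) (hg : 0 ≤ g) (hμ : Monotone μ)
    (hf_sum : 0 < ∑ a, f a) (hg_sum : 0 < ∑ a, g a)
    (h : ∀ a b, f a * g b ≤ f (a ⊓ b) * g (a ⊔ b)) :
    (∑ a, μ a * f a) / ∑ a, f a ≤ (∑ a, μ a * g a) / ∑ a, g a := by
  classical
  -- Subtracting a constant from `μ` makes it nonnegative, as Holley's inequality requires.
  have mean_le := holley (μ := fun a => μ a - μ ⊥) (f := fun a => f a / ∑ a, f a)
    (g := fun a => g a / ∑ a, g a) (fun a => sub_nonneg.2 (hμ bot_le))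
    (fun a => div_nonneg (hf a) hf_sum.le) (fun a => div_nonneg (hg a) hg_sum.le)
    (fun a b hab => sub_le_sub_right (hμ hab) _)
    (by simp only [← Finset.sum_div, div_self hf_sum.ne', div_self hg_sum.ne'])
    fun a b => by
      simp only [div_mul_div_comm]
      exact div_le_div_of_nonneg_right (h a b) (mul_pos hf_sum hg_sum).le
  simp only [sub_mul, Finset.sum_sub_distrib, ← Finset.mul_sum, ← Finset.sum_div, ← mul_div_assoc]
    at mean_le
  rw [sub_div, sub_div, mul_div_cancel_right₀ _ hf_sum.ne', mul_div_cancel_right₀ _ hg_sum.ne']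
    at mean_le
  linarith

theorem fvMean_mono {p' : ℝ} (hp : p ∈ Ioo (0 : ℝ) 1) (hp' : p' ∈ Ioo (0 : ℝ) 1)
    (hpp : p ≤ p') (hq : 1 ≤ q) {E : Finset L.Edge} {ξ ξ' : L.BoundaryCondition E} (hξ : ξ ≤ ξ')
    {f : L.Config → ℝ} (hf : Monotone f) : fvMean p q E ξ f ≤ fvMean p' q E ξ' f := by
  rw [fvMean_eq, fvMean_eq]
  exact sum_mul_div_le_sum_mul_div_of_holley (fun η => (fvWeight_pos hp hq E ξ η).le)
    (fun η => (fvWeight_pos hp' hq E ξ' η).le) (hf.comp (extend_mono E))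
    (partitionFunction_pos hp hq E ξ) (partitionFunction_pos hp' hq E ξ')
    (fvWeight_mul_le hp hp' hpp hq hξ)

/-! ### Free boundary conditions and monotonicity in the volume -/

/-- All the edges outside `E` are closed in `η`. -/
def ClosedOff (E : Finset L.Edge) {E' : Finset L.Edge} (η : E' → Bool) : Prop :=
  ∀ e : E', e.1 ∉ E → η e = false

theorem ClosedOff.anti {E E' : Finset L.Edge} {η η' : E' → Bool} (hη : ClosedOff E η)
    (h : η' ≤ η) : ClosedOff E η' :=
  fun e he => Bool.eq_false_of_le_false (hη e he ▸ h e)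

theorem closedOff_restrict_extend {E E' : Finset L.Edge} (η : E → Bool) :
    ClosedOff E (E'.restrict (extend E η)) :=
  fun _ he => extend_apply_notMem η he

theorem ClosedOff.extend_restrict₂ {E E' : Finset L.Edge} (h : E ⊆ E') {η : E' → Bool}
    (hη : ClosedOff E η) : extend E (Finset.restrict₂ (π := fun _ => Bool) h η) = extend E' η := by
  funext e
  by_cases he : e ∈ E
  · rw [extend_apply_mem _ he, extend_apply_mem _ (h he), Finset.restrict₂]
  · rw [extend_apply_notMem _ he]
    by_cases he' : e ∈ E'
    · rw [extend_apply_mem _ he', hη ⟨e, he'⟩ he]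
    · rw [extend_apply_notMem _ he']

theorem ClosedOff.openSetoid_restrict₂ {E E' : Finset L.Edge} (h : E ⊆ E') {η : E' → Bool}
    (hη : ClosedOff E η) : openSetoid E (Finset.restrict₂ (π := fun _ => Bool) h η) =
      (openSetoid E' η).comap (Set.inclusion (verts_mono h)) := by
  have hopen : {e | ∃ he : e ∈ E, Finset.restrict₂ (π := fun _ => Bool) h η ⟨e, he⟩ = true} =
      {e | ∃ he : e ∈ E', η ⟨e, he⟩ = true} := by
    ext e
    refine ⟨fun ⟨he, ho⟩ => ⟨h he, ho⟩, fun ⟨he, ho⟩ => ⟨?_, ho⟩⟩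
    by_contra heE
    exact Bool.false_ne_true ((hη ⟨e, he⟩ heE).symm.trans ho)
  unfold openSetoid
  rw [hopen]
  rfl

theorem ClosedOff.numClusters_restrict₂ {E E' : Finset L.Edge} (h : E ⊆ E') {η : E' → Bool}
    (hη : ClosedOff E η) : numClusters E' ⊥ η =
      numClusters E ⊥ (Finset.restrict₂ (π := fun _ => Bool) h η) +
        (range (Set.inclusion (verts_mono h)))ᶜ.ncard := by
  unfold numClusters
  rw [sup_bot_eq, sup_bot_eq, hη.openSetoid_restrict₂ h]
  refine card_quotient_eq_card_quotient_comap_add (Set.inclusion_injective _) ?_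
  rw [Set.range_inclusion]
  refine openSetoid_le_wiring fun e he => ?_
  by_contra heE
  exact Bool.false_ne_true ((hη e heE).symm.trans he)

theorem ClosedOff.prod_edgeWeight_restrict₂ {E E' : Finset L.Edge} (h : E ⊆ E') {η : E' → Bool}
    (hη : ClosedOff E η) (p : ℝ) : ∏ e, edgeWeight p (η e) =
      (∏ e, edgeWeight p (Finset.restrict₂ (π := fun _ => Bool) h η e)) *
        (1 - p) ^ (E'.card - E.card) := by
  classical
  have hprod (F : Finset L.Edge) (ζ : F → Bool) :
      ∏ e, edgeWeight p (ζ e) = ∏ e ∈ F, edgeWeight p (extend F ζ e) := by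
    rw [← Finset.prod_coe_sort F]
    exact Finset.prod_congr rfl fun e _ => by rw [extend_apply_mem ζ e.2]
  rw [hprod, hprod, hη.extend_restrict₂ h, ← Finset.prod_sdiff h, mul_comm,
    ← Finset.card_sdiff_of_subset h, ← Finset.prod_const]
  congr 1
  refine Finset.prod_congr rfl fun e he => ?_
  rw [Finset.mem_sdiff] at he
  rw [extend_apply_mem _ he.1, hη ⟨e, he.1⟩ he.2]
  simp [edgeWeight]

theorem exists_fvWeight_bot_eq_mul_restrict₂ (hp : p < 1) (hq : 0 < q) {E E' : Finset L.Edge}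
    (h : E ⊆ E') : ∃ c : ℝ, 0 < c ∧ ∀ η : E' → Bool, ClosedOff E η →
      fvWeight p q E' ⊥ η = c * fvWeight p q E ⊥ (Finset.restrict₂ (π := fun _ => Bool) h η) := by
  refine ⟨(1 - p) ^ (E'.card - E.card) * q ^ (range (Set.inclusion (verts_mono h)))ᶜ.ncard,
    mul_pos (pow_pos (sub_pos.2 hp) _) (pow_pos hq _), fun η hη => ?_⟩
  rw [fvWeight_eq, fvWeight_eq, hη.numClusters_restrict₂ h, hη.prod_edgeWeight_restrict₂ h, pow_add]
  ring

open Classical in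
theorem sum_closedOff_eq {E E' : Finset L.Edge} (h : E ⊆ E') (f : L.Config → ℝ)
    (g : (E → Bool) → ℝ) :
    ∑ η : E' → Bool with ClosedOff E η,
        f (extend E' η) * g (Finset.restrict₂ (π := fun _ => Bool) h η) =
      ∑ η, f (extend E η) * g η := by
  refine Finset.sum_bij' (fun η _ => Finset.restrict₂ (π := fun _ => Bool) h η)
    (fun η _ => E'.restrict (extend E η)) (fun _ _ => Finset.mem_univ _)
    (fun η _ => Finset.mem_filter.2 ⟨Finset.mem_univ _, closedOff_restrict_extend η⟩)
    (fun η hη => ?_) (fun η _ => restrict_extend η) fun η hη => ?_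
  · rw [ClosedOff.extend_restrict₂ h (Finset.mem_filter.1 hη).2, restrict_extend]
  · rw [ClosedOff.extend_restrict₂ h (Finset.mem_filter.1 hη).2]

open Classical in
theorem fvMean_bot_eq_sum_closedOff_div (hp : p < 1) (hq : 0 < q) {E E' : Finset L.Edge}
    (h : E ⊆ E') (f : L.Config → ℝ) : fvMean p q E ⊥ f =
      (∑ η : E' → Bool with ClosedOff E η, f (extend E' η) * fvWeight p q E' ⊥ η) /
        ∑ η : E' → Bool with ClosedOff E η, fvWeight p q E' ⊥ η := by
  obtain ⟨c, hc, hweight⟩ := exists_fvWeight_bot_eq_mul_restrict₂ hp hq h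
  have hsum (f : L.Config → ℝ) :
      ∑ η : E' → Bool with ClosedOff E η, f (extend E' η) * fvWeight p q E' ⊥ η =
        c * ∑ η, f (extend E η) * fvWeight p q E ⊥ η := by
    rw [← sum_closedOff_eq h, Finset.mul_sum]
    refine Finset.sum_congr rfl fun η hη => ?_
    rw [hweight η (Finset.mem_filter.1 hη).2, mul_left_comm]
  have hnormalize := hsum fun _ => 1
  simp only [one_mul] at hnormalize
  rw [hsum, hnormalize, mul_div_mul_left _ _ hc.ne', fvMean_eq, partitionFunction]

theorem fvMean_bot_mono (hp : p ∈ Ioo (0 : ℝ) 1) (hq : 1 ≤ q)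
    {E E' : Finset L.Edge} (h : E ⊆ E') {f : L.Config → ℝ} (hf : Monotone f) :
    fvMean p q E ⊥ f ≤ fvMean p q E' ⊥ f := by
  classical
  rw [fvMean_bot_eq_sum_closedOff_div hp.2 (zero_lt_one.trans_le hq) h, fvMean_eq]
  simp only [Finset.sum_filter, ← mul_ite_zero]
  refine sum_mul_div_le_sum_mul_div_of_holley (fun η => ?_)
    (fun η => (fvWeight_pos hp hq E' ⊥ η).le) (hf.comp (extend_mono E')) ?_
    (partitionFunction_pos hp hq E' ⊥) fun a b => ?_
  · exact ite_nonneg (fvWeight_pos hp hq E' ⊥ η).le le_rfl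
  · rw [← Finset.sum_filter]
    exact Finset.sum_pos (fun η _ => fvWeight_pos hp hq E' ⊥ η)
      ⟨⊥, Finset.mem_filter.2 ⟨Finset.mem_univ _, fun _ _ => rfl⟩⟩
  · by_cases ha : ClosedOff E a
    · rw [if_pos ha, if_pos (ha.anti inf_le_left)]
      exact fvWeight_mul_le hp hp le_rfl hq le_rfl a b
    · rw [if_neg ha, zero_mul]
      exact mul_nonneg (ite_nonneg (fvWeight_pos hp hq E' ⊥ _).le le_rfl)
        (fvWeight_pos hp hq E' ⊥ _).le

/-! ### Local events and connection events -/

instance : Countable L.V := by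
  have hcover : L.V = ⋃ n : ℕ, L.V ∩ Metric.closedBall (0 : ℂ) n := by
    rw [← inter_iUnion, Metric.iUnion_closedBall_nat, inter_univ]
  refine Set.Countable.to_subtype ?_
  rw [hcover]
  exact Set.countable_iUnion fun n => (L.finite_vertices n).countable

instance : Countable L.Edge := inferInstanceAs (Countable {e // e ∈ L.graph.edgeSet})

instance : TopologicalSpace.MetrizableSpace L.Config :=
  TopologicalSpace.metrizableSpace_of_t3_secondCountable _

/-- The event `A` depends only on the state of the edges in `E`. -/
def IsLocal (E : Finset L.Edge) (A : Set L.Config) : Prop :=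
  ∀ ω ω' : L.Config, (∀ e ∈ E, ω e = ω' e) → ω ∈ A → ω' ∈ A

theorem setOf_agree_mem_nhds (E : Finset L.Edge) (ω : L.Config) :
    {ω' : L.Config | ∀ e ∈ E, ω' e = ω e} ∈ 𝓝 ω :=
  (E.eventually_all).2 fun e _ =>
    ((continuous_apply e).tendsto ω).eventually_mem ((isOpen_discrete {ω e}).mem_nhds rfl)

theorem IsLocal.mono {E E' : Finset L.Edge} (h : E ⊆ E') {A : Set L.Config} (hA : IsLocal E A) :
    IsLocal E' A := fun ω ω' hω => hA ω ω' fun e he => hω e (h he)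

theorem IsLocal.compl {E : Finset L.Edge} {A : Set L.Config} (hA : IsLocal E A) :
    IsLocal E Aᶜ := fun ω ω' h hω hω' => hω (hA ω' ω (fun e he => (h e he).symm) hω')

theorem IsLocal.isOpen {E : Finset L.Edge} {A : Set L.Config} (hA : IsLocal E A) : IsOpen A :=
  isOpen_iff_mem_nhds.2 fun ω hω => Filter.mem_of_superset (setOf_agree_mem_nhds E ω)
    fun ω' hω' => hA ω ω' (fun e he => (hω' e he).symm) hω

theorem IsLocal.measurableSet {E : Finset L.Edge} {A : Set L.Config} (hA : IsLocal E A) :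
    MeasurableSet A := hA.isOpen.measurableSet

theorem IsLocal.extend_restrict_mem_iff {E : Finset L.Edge} {A : Set L.Config} (hA : IsLocal E A)
    (ω : L.Config) : extend E (E.restrict ω) ∈ A ↔ ω ∈ A :=
  ⟨hA _ _ fun _ he => extend_apply_mem (E.restrict ω) he,
    hA _ _ fun _ he => (extend_apply_mem (E.restrict ω) he).symm⟩

theorem isLocal_restrict_eq (E : Finset L.Edge) (η : E → Bool) :
    IsLocal E {ω : L.Config | E.restrict ω = η} :=
  fun _ _ h hω => funext fun e => (h e.1 e.2).symm.trans (congrFun hω e)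

theorem exists_finset_of_reachable {S : Set L.Edge} {x y : L.V}
    (h : (L.subgraphOf S).Reachable x y) :
    ∃ F : Finset L.Edge, (F : Set L.Edge) ⊆ S ∧ (L.subgraphOf F).Reachable x y := by
  classical
  obtain ⟨w⟩ := h
  induction w with
  | nil => exact ⟨∅, by simp, SimpleGraph.Reachable.refl _⟩
  | cons hadj _ ih =>
    obtain ⟨F, hFS, hreach⟩ := ih
    obtain ⟨e, he, hxy⟩ := subgraphOf_adj.1 hadj
    refine ⟨insert e F, ?_, ?_⟩
    · rw [Finset.coe_insert]
      exact insert_subset he hFS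
    · have hfirst : (L.subgraphOf (insert e F : Finset L.Edge)).Adj _ _ :=
        subgraphOf_adj.2 ⟨e, Finset.mem_insert_self e F, hxy⟩
      exact hfirst.reachable.trans
        (hreach.mono (subgraphOf_mono (Finset.coe_subset.2 (Finset.subset_insert e F))))

theorem isOpen_reachable (T : Set L.Edge) (x y : L.V) :
    IsOpen {ω : L.Config | (L.subgraphOf {e | e ∈ T ∧ ω e = true}).Reachable x y} := by
  rw [isOpen_iff_mem_nhds]
  intro ω hω
  obtain ⟨F, hF, hreach⟩ := exists_finset_of_reachable hω
  exact Filter.mem_of_superset (setOf_agree_mem_nhds F ω) fun ω' hω' =>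
    hreach.mono (subgraphOf_mono fun e he => ⟨(hF he).1, (hω' e he).trans (hF he).2⟩)

theorem measurableSet_reachable (x y : L.V) :
    MeasurableSet {ω : L.Config | (L.subgraphOf {e | ω e = true}).Reachable x y} := by
  simpa only [mem_univ, true_and] using (isOpen_reachable univ x y).measurableSet

theorem measurableSet_connectedToInfinity (x : L.V) :
    MeasurableSet {ω : L.Config | ConnectedToInfinity ω x} := by
  have hforall : {ω : L.Config | ConnectedToInfinity ω x} = ⋂ s : Finset L.V, ⋃ y : {y // y ∉ s},
      {ω | (L.subgraphOf {e | ω e = true}).Reachable x y} := by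
    ext ω
    simp only [ConnectedToInfinity, mem_ofPred_eq, mem_iInter, mem_iUnion]
    constructor
    · intro h s
      obtain ⟨y, hy, hys⟩ := h.exists_notMem_finset s
      exact ⟨⟨y, hys⟩, hy⟩
    · intro h hfin
      obtain ⟨y, hy⟩ := h hfin.toFinset
      exact y.2 (hfin.mem_toFinset.2 hy)
  rw [hforall]
  exact MeasurableSet.iInter fun s => MeasurableSet.iUnion fun y => measurableSet_reachable _ _

theorem measurableSet_inducedBC_eq (E : Finset L.Edge) (ξ : L.BoundaryCondition E) :
    MeasurableSet {ω : L.Config | inducedBC E ω = ξ} := by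
  have hforall : {ω : L.Config | inducedBC E ω = ξ} = ⋂ x : L.verts E, ⋂ y : L.verts E,
      {ω | (L.subgraphOf {e | e ∉ E ∧ ω e = true}).Reachable x.1 y.1 ↔ ξ x y} := by
    ext ω
    simp only [mem_ofPred_eq, mem_iInter]
    exact ⟨fun h x y => h ▸ Iff.rfl, fun h => Setoid.ext h⟩
  rw [hforall]
  refine MeasurableSet.iInter fun x => MeasurableSet.iInter fun y => ?_
  have hreach : MeasurableSet
      {ω : L.Config | (L.subgraphOf {e | e ∉ E ∧ ω e = true}).Reachable x.1 y.1} :=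
    (isOpen_reachable {e | e ∉ E} x.1 y.1).measurableSet
  by_cases hxy : ξ x y
  · simpa only [hxy, iff_true] using hreach
  · simpa only [hxy, iff_false] using! hreach.compl

/-! ### Domination by the wired boundary condition -/

/-- The vertices of a finite subgraph that have an edge outside. -/
def boundary (E : Finset L.Edge) : Set (L.verts E) :=
  {x | ∃ e : L.Edge, e ∉ E ∧ x.1 ∈ (e : Sym2 L.V)}

/-- The boundary condition that wires all boundary vertices. -/
abbrev wired (E : Finset L.Edge) : L.BoundaryCondition E := wiring (boundary E)

theorem inducedBC_le_wired (E : Finset L.Edge) (ω : L.Config) : inducedBC E ω ≤ wired E := by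
  have eq_or_mem_boundary {x y : L.verts E}
      (h : (L.subgraphOf {e | e ∉ E ∧ ω e = true}).Reachable x.1 y.1) : x = y ∨ x ∈ boundary E := by
    refine or_iff_not_imp_left.2 fun hxy => ?_
    obtain ⟨z, hadj⟩ :=
      SimpleGraph.mem_support_of_reachable (fun h => hxy (Subtype.ext h)) h
    obtain ⟨e, he, hxz⟩ := subgraphOf_adj.1 hadj
    exact ⟨e, he.1, hxz ▸ Sym2.mem_mk_left _ _⟩
  intro x y h
  rcases eq_or_mem_boundary h with hxy | hx
  · exact Or.inl hxy
  · rcases eq_or_mem_boundary h.symm with hxy | hy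
    · exact Or.inl hxy.symm
    · exact Or.inr ⟨hx, hy⟩

namespace IsRandomClusterMeasure

variable {φ : Measure L.Config}

theorem real_eq_sum (hφ : IsRandomClusterMeasure p q φ) {E : Finset L.Edge}
    {A : Set L.Config} (hA : IsLocal E A) [Fintype (L.BoundaryCondition E)] :
    φ.real A = ∑ ξ, φ.real {ω | inducedBC E ω = ξ} * fvMean p q E ξ (A.indicator 1) := by
  classical
  have := hφ.isProbabilityMeasure
  set f : L.Config → (E → Bool) × L.BoundaryCondition E :=
    fun ω => (E.restrict ω, inducedBC E ω) with hf
  set s : Finset ((E → Bool) × L.BoundaryCondition E) := {z | extend E z.1 ∈ A} with hs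
  have hpreimage : f ⁻¹' s = A := by
    ext ω
    simp [hf, hs, hA.extend_restrict_mem_iff]
  have hfiber (z) : f ⁻¹' {z} = {ω | E.restrict ω = z.1 ∧ inducedBC E ω = z.2} := by
    ext ω
    simp [hf, Prod.ext_iff]
  have hmeas (z) : MeasurableSet (f ⁻¹' {z}) := by
    rw [hfiber]
    exact (isLocal_restrict_eq E z.1).measurableSet.inter (measurableSet_inducedBC_eq E z.2)
  calc φ.real A = ∑ z ∈ s, fvProb p q E z.2 z.1 * φ.real {ω | inducedBC E ω = z.2} := by
        rw [← hpreimage, ← sum_measureReal_preimage_singleton s fun z _ => hmeas z]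
        exact Finset.sum_congr rfl fun z _ => by rw [hfiber, hφ.conditional]
    _ = _ := by
        rw [hs, Finset.sum_filter, Fintype.sum_prod_type_right]
        refine Finset.sum_congr rfl fun ξ _ => ?_
        rw [fvMean, Finset.mul_sum]
        refine Finset.sum_congr rfl fun η _ => ?_
        rw [Set.indicator_apply]
        split_ifs <;> simp [mul_comm]

theorem sum_inducedBC (hφ : IsRandomClusterMeasure p q φ)
    (hp : p ∈ Ioo (0 : ℝ) 1) (hq : 1 ≤ q) (E : Finset L.Edge)
    [Fintype (L.BoundaryCondition E)] : ∑ ξ, φ.real {ω | inducedBC E ω = ξ} = 1 := by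
  have := hφ.isProbabilityMeasure
  have htotal := hφ.real_eq_sum (E := E) (A := univ) fun _ _ _ _ => mem_univ _
  simpa only [probReal_univ, fvMean, indicator_univ, Pi.one_apply, one_mul, sum_fvProb hp hq,
    mul_one] using htotal.symm

theorem real_le_fvMean_wired (hφ : IsRandomClusterMeasure p q φ)
    (hp : p ∈ Ioo (0 : ℝ) 1) (hq : 1 ≤ q) {E : Finset L.Edge} {A : Set L.Config}
    (hA : IsLocal E A) (hup : IsUpperSet A) :
    φ.real A ≤ fvMean p q E (wired E) (A.indicator 1) := by
  have := Fintype.ofFinite (L.BoundaryCondition E)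
  rw [hφ.real_eq_sum hA, ← one_mul (fvMean p q E (wired E) _), ← hφ.sum_inducedBC hp hq E,
    Finset.sum_mul]
  refine Finset.sum_le_sum fun ξ _ => ?_
  by_cases hξ : ∃ ω, inducedBC E ω = ξ
  · obtain ⟨ω, rfl⟩ := hξ
    exact mul_le_mul_of_nonneg_left (fvMean_mono hp hp le_rfl hq (inducedBC_le_wired E ω)
      (monotone_indicator_one hup)) measureReal_nonneg
  · have hempty : {ω | inducedBC E ω = ξ} = ∅ := eq_empty_of_forall_notMem fun ω h => hξ ⟨ω, h⟩
    rw [hempty, measureReal_empty, zero_mul, zero_mul]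

end IsRandomClusterMeasure

/-! ### Finite energy -/

open Classical in
/-- Opening all edges of a finite set. -/
noncomputable def openAll (F : Finset L.Edge) (ω : L.Config) : L.Config :=
  fun e => ω e || decide (e ∈ F)

theorem openAll_apply_mem {F : Finset L.Edge} {e : L.Edge} (h : e ∈ F) (ω : L.Config) :
    openAll F ω e = true := by simp [openAll, h]

theorem openAll_apply_notMem {F : Finset L.Edge} {e : L.Edge} (h : e ∉ F) (ω : L.Config) :
    openAll F ω e = ω e := by simp [openAll, h]

theorem continuous_openAll (F : Finset L.Edge) : Continuous (openAll (L := L) F) := by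
  refine continuous_pi fun e => ?_
  by_cases h : e ∈ F
  · simpa only [openAll_apply_mem h] using continuous_const
  · simpa only [openAll_apply_notMem h] using continuous_apply e

theorem IsLocal.preimage_openAll {E : Finset L.Edge} {A : Set L.Config} (hA : IsLocal E A)
    (F : Finset L.Edge) : IsLocal E (openAll F ⁻¹' A) :=
  fun _ _ h => hA _ _ fun e he => by rw [openAll, openAll, h e he]

theorem extend_sup_openOn {E F : Finset L.Edge} (h : F ⊆ E) (η : E → Bool) :
    extend E (η ⊔ openOn E F) = openAll F (extend E η) := by
  funext e
  by_cases he : e ∈ E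
  · simp [extend_apply_mem _ he, openAll, openOn]
  · rw [extend_apply_notMem _ he, openAll_apply_notMem fun heF => he (h heF),
      extend_apply_notMem _ he]

theorem card_sup_openOn_fiber_le (E F : Finset L.Edge) (η' : E → Bool) :
    (Finset.univ.filter fun η : E → Bool => η ⊔ openOn E F = η').card ≤ 2 ^ F.card := by
  classical
  have hcard : (2 : ℕ) ^ F.card = (Finset.univ : Finset (F → Bool)).card := by simp
  rw [hcard]
  -- `η` is determined outside `F` by `η'`.
  refine Finset.card_le_card_of_injOn (fun η => F.restrict (extend E η))
    (fun _ _ => Finset.mem_univ _) fun η hη ξ hξ hηξ => ?_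
  have hsup : η ⊔ openOn E F = ξ ⊔ openOn E F := by
    rw [(Finset.mem_filter.1 hη).2, (Finset.mem_filter.1 hξ).2]
  funext e
  by_cases he : e.1 ∈ F
  · simpa [extend_apply_mem _ e.2] using congrFun hηξ ⟨e.1, he⟩
  · simpa [openOn, he] using congrFun hsup e

theorem sum_comp_sup_openOn_le (E F : Finset L.Edge) {g : (E → Bool) → ℝ} (hg : 0 ≤ g) :
    ∑ η, g (η ⊔ openOn E F) ≤ 2 ^ F.card * ∑ η, g η := by
  classical
  rw [Finset.sum_comp g fun η : E → Bool => η ⊔ openOn E F, Finset.mul_sum]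
  refine (Finset.sum_le_sum_of_subset_of_nonneg (Finset.subset_univ _)
    fun η _ _ => nsmul_nonneg (hg η) _).trans (Finset.sum_le_sum fun η _ => ?_)
  rw [nsmul_eq_mul]
  exact mul_le_mul_of_nonneg_right (mod_cast card_sup_openOn_fiber_le E F η) (hg η)

/-- The constant in the finite-energy property: each of `n` edges costs a factor `1 / p` when it is
opened and `q ^ 2` because of the clusters it merges, and its former state is lost, whence `2`. -/
noncomputable def openingCost (p q : ℝ) (n : ℕ) : ℝ := q ^ (2 * n) / p ^ n * 2 ^ n

theorem openingCost_pos (hp : 0 < p) (hq : 0 < q) (n : ℕ) : 0 < openingCost p q n := by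
  unfold openingCost
  positivity

theorem fvMean_openAll_le (hp : p ∈ Ioo (0 : ℝ) 1) (hq : 1 ≤ q) {E F : Finset L.Edge}
    (h : F ⊆ E) (ξ : L.BoundaryCondition E) {f : L.Config → ℝ} (hf : 0 ≤ f) :
    fvMean p q E ξ (f ∘ openAll F) ≤ openingCost p q F.card * fvMean p q E ξ f := by
  have hp0 : 0 < p := hp.1
  set C : ℝ := q ^ (2 * F.card) / p ^ F.card with hC
  have hC_nonneg : 0 ≤ C := by positivity
  have hprob (η : E → Bool) : fvProb p q E ξ η ≤ C * fvProb p q E ξ (η ⊔ openOn E F) := by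
    rw [fvProb_eq, fvProb_eq, ← mul_div_assoc]
    refine div_le_div_of_nonneg_right ?_ (partitionFunction_pos hp hq E ξ).le
    rw [hC, div_mul_eq_mul_div, le_div_iff₀ (by positivity), mul_comm]
    exact fvWeight_le_sup_openOn hp hq E F ξ η
  set g : (E → Bool) → ℝ := fun η => f (extend E η) * fvProb p q E ξ η with hg
  calc fvMean p q E ξ (f ∘ openAll F) ≤ ∑ η, C * g (η ⊔ openOn E F) := by
        refine Finset.sum_le_sum fun η _ => ?_
        rw [Function.comp_apply, ← extend_sup_openOn h, hg, mul_left_comm]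
        exact mul_le_mul_of_nonneg_left (hprob η) (hf _)
    _ = C * ∑ η, g (η ⊔ openOn E F) := by rw [Finset.mul_sum]
    _ ≤ C * (2 ^ F.card * ∑ η, g η) := mul_le_mul_of_nonneg_left
        (sum_comp_sup_openOn_le E F fun η => mul_nonneg (hf _) (fvProb_nonneg hp hq E ξ η))
        hC_nonneg
    _ = openingCost p q F.card * fvMean p q E ξ f := (mul_assoc _ _ _).symm

theorem exists_monotone_isLocal_iUnion_eq {U : Set L.Config} (hU : IsOpen U) :
    ∃ B : Finset L.Edge → Set L.Config, Monotone B ∧ (∀ E, IsLocal E (B E)) ∧ ⋃ E, B E = U := by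
  refine ⟨fun E => {ω | ∀ ω' : L.Config, (∀ e ∈ E, ω e = ω' e) → ω' ∈ U},
    fun E E' h ω hω ω' hagree => hω ω' fun e he => hagree e (h he),
    fun E ω ω' h hω ω'' hagree => hω ω'' fun e he => (h e he).trans (hagree e he), ?_⟩
  refine Subset.antisymm (iUnion_subset fun E ω hω => hω ω fun _ _ => rfl) fun ω hω => ?_
  obtain ⟨E, u, hu, hsub⟩ := isOpen_pi_iff.1 hU ω hω
  exact mem_iUnion.2 ⟨E, fun ω' h => hsub fun e he => h e he ▸ (hu e he).2⟩

namespace IsRandomClusterMeasure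

variable {φ : Measure L.Config}

theorem preimage_openAll_le_of_isLocal (hφ : IsRandomClusterMeasure p q φ)
    (hp : p ∈ Ioo (0 : ℝ) 1) (hq : 1 ≤ q) {E F : Finset L.Edge} (h : F ⊆ E) {A : Set L.Config}
    (hA : IsLocal E A) :
    φ (openAll F ⁻¹' A) ≤ ENNReal.ofReal (openingCost p q F.card) * φ A := by
  have := hφ.isProbabilityMeasure
  have := Fintype.ofFinite (L.BoundaryCondition E)
  have hC := (openingCost_pos hp.1 (zero_lt_one.trans_le hq) F.card).le
  have hreal : φ.real (openAll F ⁻¹' A) ≤ openingCost p q F.card * φ.real A := by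
    rw [hφ.real_eq_sum (hA.preimage_openAll F), hφ.real_eq_sum hA, Finset.mul_sum]
    refine Finset.sum_le_sum fun ξ _ => ?_
    rw [mul_left_comm]
    exact mul_le_mul_of_nonneg_left (fvMean_openAll_le hp hq h ξ (f := A.indicator 1)
      (indicator_nonneg fun _ _ => zero_le_one)) measureReal_nonneg
  rw [← ofReal_measureReal (μ := φ) (s := A), ← ofReal_measureReal (μ := φ),
    ← ENNReal.ofReal_mul hC]
  exact ENNReal.ofReal_le_ofReal hreal

theorem preimage_openAll_le_of_isOpen (hφ : IsRandomClusterMeasure p q φ)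
    (hp : p ∈ Ioo (0 : ℝ) 1) (hq : 1 ≤ q) (F : Finset L.Edge) {U : Set L.Config} (hU : IsOpen U) :
    φ (openAll F ⁻¹' U) ≤ ENNReal.ofReal (openingCost p q F.card) * φ U := by
  classical
  obtain ⟨B, hB_mono, hB_local, rfl⟩ := exists_monotone_isLocal_iUnion_eq hU
  have hdirected : Directed (· ⊆ ·) fun E => openAll F ⁻¹' B E :=
    Monotone.directed_le fun E E' h => preimage_mono (hB_mono h)
  rw [preimage_iUnion, hdirected.measure_iUnion]
  refine iSup_le fun E => (hφ.preimage_openAll_le_of_isLocal hp hq Finset.subset_union_left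
    ((hB_local E).mono Finset.subset_union_right)).trans ?_
  gcongr
  exact subset_iUnion B E

theorem preimage_openAll_le (hφ : IsRandomClusterMeasure p q φ)
    (hp : p ∈ Ioo (0 : ℝ) 1) (hq : 1 ≤ q) (F : Finset L.Edge) (A : Set L.Config) :
    φ (openAll F ⁻¹' A) ≤ ENNReal.ofReal (openingCost p q F.card) * φ A := by
  have := hφ.isProbabilityMeasure
  have hcost : ENNReal.ofReal (openingCost p q F.card) ≠ 0 := by
    rw [ne_eq, ENNReal.ofReal_eq_zero, not_le]
    exact openingCost_pos hp.1 (zero_lt_one.trans_le hq) _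
  rw [A.measure_eq_iInf_isOpen φ]
  simp only [ENNReal.mul_iInf_of_ne hcost ENNReal.ofReal_ne_top]
  exact le_iInf fun U => le_iInf fun hAU => le_iInf fun hU =>
    (measure_mono (preimage_mono hAU)).trans (hφ.preimage_openAll_le_of_isOpen hp hq F hU)

end IsRandomClusterMeasure

/-! ### Existence of the free measure -/

theorem fvMean_sub (E : Finset L.Edge) (ξ : L.BoundaryCondition E) (f g : L.Config → ℝ) :
    fvMean p q E ξ (f - g) = fvMean p q E ξ f - fvMean p q E ξ g := by
  simp only [fvMean, Pi.sub_apply, sub_mul, Finset.sum_sub_distrib]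

theorem fvMean_sum {ι : Type*} (s : Finset ι) (E : Finset L.Edge) (ξ : L.BoundaryCondition E)
    (f : ι → L.Config → ℝ) :
    fvMean p q E ξ (fun ω => ∑ i ∈ s, f i ω) = ∑ i ∈ s, fvMean p q E ξ (f i) := by
  simp only [fvMean, Finset.sum_mul]
  rw [Finset.sum_comm]

theorem fvMean_indicator_nonneg (hp : p ∈ Ioo (0 : ℝ) 1) (hq : 1 ≤ q) (E : Finset L.Edge)
    (ξ : L.BoundaryCondition E) (A : Set L.Config) : 0 ≤ fvMean p q E ξ (A.indicator 1) :=
  Finset.sum_nonneg fun η _ => mul_nonneg (indicator_nonneg (fun _ _ => zero_le_one) _)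
    (fvProb_nonneg hp hq E ξ η)

theorem fvMean_indicator_le_one (hp : p ∈ Ioo (0 : ℝ) 1) (hq : 1 ≤ q) (E : Finset L.Edge)
    (ξ : L.BoundaryCondition E) (A : Set L.Config) : fvMean p q E ξ (A.indicator 1) ≤ 1 := by
  rw [← sum_fvProb hp hq E ξ]
  refine Finset.sum_le_sum fun η _ => mul_le_of_le_one_left (fvProb_nonneg hp hq E ξ η) ?_
  exact indicator_le_self' (fun _ _ => zero_le_one) _

/-- A finite-volume measure, as a measure on the configurations of the whole lattice. -/
noncomputable def fvMeasure (p q : ℝ) (E : Finset L.Edge) (ξ : L.BoundaryCondition E) :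
    Measure L.Config :=
  ∑ η : E → Bool, ENNReal.ofReal (fvProb p q E ξ η) • Measure.dirac (extend E η)

theorem fvMeasure_apply (hp : p ∈ Ioo (0 : ℝ) 1) (hq : 1 ≤ q) (E : Finset L.Edge)
    (ξ : L.BoundaryCondition E) {A : Set L.Config} (hA : MeasurableSet A) :
    fvMeasure p q E ξ A = ENNReal.ofReal (fvMean p q E ξ (A.indicator 1)) := by
  classical
  have hnonneg (ω : L.Config) : 0 ≤ A.indicator (1 : L.Config → ℝ) ω :=
    indicator_nonneg (fun _ _ => zero_le_one) ω
  rw [fvMean, ENNReal.ofReal_sum_of_nonneg fun η _ => mul_nonneg (hnonneg _)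
    (fvProb_nonneg hp hq E ξ η)]
  simp only [fvMeasure, Measure.coe_finsetSum, Finset.sum_apply, Measure.smul_apply,
    Measure.dirac_apply' _ hA, smul_eq_mul]
  refine Finset.sum_congr rfl fun η _ => ?_
  by_cases h : extend E η ∈ A <;> simp [h]

theorem isProbabilityMeasure_fvMeasure (hp : p ∈ Ioo (0 : ℝ) 1) (hq : 1 ≤ q) (E : Finset L.Edge)
    (ξ : L.BoundaryCondition E) : IsProbabilityMeasure (fvMeasure p q E ξ) := by
  refine ⟨?_⟩
  rw [fvMeasure_apply hp hq E ξ MeasurableSet.univ]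
  simp [fvMean, sum_fvProb hp hq]

theorem fvEventProb_eq_fvMean {E F : Finset L.Edge} (h : F ⊆ E) (ξ : L.BoundaryCondition E)
    (ζ : F → Bool) : fvEventProb p q E ξ
      {η | ∀ (e : L.Edge) (hE : e ∈ E) (hF : e ∈ F), η ⟨e, hE⟩ = ζ ⟨e, hF⟩} =
      fvMean p q E ξ ({ω | F.restrict ω = ζ}.indicator 1) := by
  classical
  refine Finset.sum_congr rfl fun η _ => ?_
  have hagree : (∀ (e : L.Edge) (hE : e ∈ E) (hF : e ∈ F), η ⟨e, hE⟩ = ζ ⟨e, hF⟩) ↔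
      F.restrict (extend E η) = ζ :=
    ⟨fun H => funext fun e => (extend_apply_mem _ (h e.2)).trans (H e.1 (h e.2) e.2),
      fun H e hE he => (extend_apply_mem η hE).symm.trans (congrFun H ⟨e, he⟩)⟩
  simp only [indicator_apply, mem_ofPred_eq, hagree, Pi.one_apply, ite_mul, one_mul, zero_mul]

theorem tendsto_fvMean_bot_of_isUpperSet (hp : p ∈ Ioo (0 : ℝ) 1) (hq : 1 ≤ q)
    {A : Set L.Config} (hA : IsUpperSet A) :
    ∃ l, Tendsto (fun E : Finset L.Edge => fvMean p q E ⊥ (A.indicator 1)) atTop (𝓝 l) :=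
  ⟨_, tendsto_atTop_ciSup (fun _ _ h => fvMean_bot_mono hp hq h (monotone_indicator_one hA))
    ⟨1, forall_mem_range.2 fun E => fvMean_indicator_le_one hp hq E ⊥ A⟩⟩

theorem tendsto_fvMean_bot_restrict_eq (hp : p ∈ Ioo (0 : ℝ) 1) (hq : 1 ≤ q) (F : Finset L.Edge)
    (ζ : F → Bool) : ∃ l, Tendsto (fun E : Finset L.Edge =>
      fvMean p q E ⊥ ({ω | F.restrict ω = ζ}.indicator 1)) atTop (𝓝 l) := by
  have hmono : Monotone (F.restrict : L.Config → F → Bool) := fun _ _ h e => h e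
  -- The event is a difference of two increasing events.
  have hdiff : {ω : L.Config | F.restrict ω = ζ}.indicator (1 : L.Config → ℝ) =
      (F.restrict ⁻¹' Ici ζ).indicator 1 - (F.restrict ⁻¹' Ioi ζ).indicator 1 := by
    rw [← indicator_sdiff (preimage_mono Ioi_subset_Ici_self)]
    congr 1
    exact ext fun ω => eq_comm.trans eq_iff_le_not_lt
  obtain ⟨l, hl⟩ := tendsto_fvMean_bot_of_isUpperSet hp hq ((isUpperSet_Ici ζ).preimage hmono)
  obtain ⟨m, hm⟩ := tendsto_fvMean_bot_of_isUpperSet hp hq ((isUpperSet_Ioi ζ).preimage hmono)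
  refine ⟨l - m, (hl.sub hm).congr fun E => ?_⟩
  rw [hdiff, fvMean_sub]

theorem exists_isFreeMeasure (hp : p ∈ Ioo (0 : ℝ) 1) (hq : 1 ≤ q) :
    ∃ φ : Measure L.Config, IsFreeMeasure p q φ := by
  classical
  set μ : Finset L.Edge → ProbabilityMeasure L.Config :=
    fun E => ⟨fvMeasure p q E ⊥, isProbabilityMeasure_fvMeasure hp hq E ⊥⟩ with hμ
  set U : Ultrafilter (Finset L.Edge) := Ultrafilter.of atTop
  obtain ⟨ν, -, hν⟩ := isCompact_univ.ultrafilter_le_nhds (U.map μ) (by simp)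
  refine ⟨ν, ν.2, fun F ζ => ?_⟩
  have hlocal := isLocal_restrict_eq F ζ
  have hfrontier : (ν : Measure L.Config) (frontier {ω : L.Config | F.restrict ω = ζ}) = 0 := by
    have hclopen : IsClopen {ω : L.Config | F.restrict ω = ζ} :=
      ⟨isOpen_compl_iff.1 hlocal.compl.isOpen, hlocal.isOpen⟩
    rw [hclopen.frontier_eq, measure_empty]
  have hlimit : Tendsto (fun E => fvMean p q E ⊥ ({ω | F.restrict ω = ζ}.indicator 1)) U
      (𝓝 ((ν : Measure L.Config).real {ω | F.restrict ω = ζ})) := by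
    refine ((ENNReal.tendsto_toReal (measure_ne_top _ _)).comp
      (ProbabilityMeasure.tendsto_measure_of_null_frontier_of_tendsto' hν hfrontier)).congr
        fun E => ?_
    simp only [Function.comp_apply, hμ, ProbabilityMeasure.coe_mk]
    rw [fvMeasure_apply hp hq E ⊥ hlocal.measurableSet,
      ENNReal.toReal_ofReal (fvMean_indicator_nonneg hp hq E ⊥ _)]
  obtain ⟨l, hl⟩ := tendsto_fvMean_bot_restrict_eq hp hq F ζ
  rw [tendsto_nhds_unique hlimit (hl.mono_left (Ultrafilter.of_le _))]
  refine hl.congr' ?_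
  filter_upwards [eventually_ge_atTop F] with E hE
  exact (fvEventProb_eq_fvMean hE ⊥ ζ).symm

namespace IsFreeMeasure

variable {φ : Measure L.Config}

theorem tendsto_fvMean (hφ : IsFreeMeasure p q φ) {F : Finset L.Edge} {A : Set L.Config}
    (hA : IsLocal F A) :
    Tendsto (fun E : Finset L.Edge => fvMean p q E ⊥ (A.indicator 1)) atTop (𝓝 (φ.real A)) := by
  classical
  have := hφ.isProbabilityMeasure
  set s : Finset (F → Bool) := {ζ | extend F ζ ∈ A} with hs
  have hmem (ω : L.Config) : F.restrict ω ∈ s ↔ ω ∈ A := by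
    simp [hs, hA.extend_restrict_mem_iff]
  have hmeasure : φ.real A = ∑ ζ ∈ s, φ.real {ω | F.restrict ω = ζ} := by
    have hpreimage : A = F.restrict ⁻¹' s := Set.ext fun ω => (hmem ω).symm
    conv_lhs => rw [hpreimage]
    rw [← sum_measureReal_preimage_singleton s fun ζ _ => (isLocal_restrict_eq F ζ).measurableSet]
    rfl
  have hindicator : A.indicator (1 : L.Config → ℝ) =
      fun ω => ∑ ζ ∈ s, ({ω | F.restrict ω = ζ} : Set L.Config).indicator 1 ω := by
    funext ω
    simp only [indicator_apply, mem_ofPred_eq, Pi.one_apply, Finset.sum_ite_eq, hmem]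
  rw [hmeasure, hindicator]
  simp only [fvMean_sum]
  refine tendsto_finsetSum s fun ζ _ => (hφ.tendsto F ζ).congr' ?_
  filter_upwards [eventually_ge_atTop F] with E hE
  exact fvEventProb_eq_fvMean hE ⊥ ζ

theorem fvMean_le (hφ : IsFreeMeasure p q φ) (hp : p ∈ Ioo (0 : ℝ) 1) (hq : 1 ≤ q)
    {F : Finset L.Edge} {A : Set L.Config} (hA : IsLocal F A) (hup : IsUpperSet A)
    (E : Finset L.Edge) : fvMean p q E ⊥ (A.indicator 1) ≤ φ.real A := by
  refine ge_of_tendsto (hφ.tendsto_fvMean hA) ?_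
  filter_upwards [eventually_ge_atTop E] with E' hE'
  exact fvMean_bot_mono hp hq hE' (monotone_indicator_one hup)

end IsFreeMeasure

/-! ### Automorphisms -/

theorem subgraphOf_reachable_image (σ : L.graph ≃g L.graph) {S : Set L.Edge} {x y : L.V}
    (h : (L.subgraphOf S).Reachable x y) :
    (L.subgraphOf (σ.mapEdgeSet '' S)).Reachable (σ x) (σ y) := by
  obtain ⟨w⟩ := h
  induction w with
  | nil => exact SimpleGraph.Reachable.refl _
  | cons hadj _ ih =>
    obtain ⟨e, he, hxy⟩ := subgraphOf_adj.1 hadj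
    refine SimpleGraph.Reachable.trans (SimpleGraph.Adj.reachable ?_) ih
    refine subgraphOf_adj.2 ⟨σ.mapEdgeSet e, mem_image_of_mem _ he, ?_⟩
    change Sym2.map σ (e : Sym2 L.V) = _
    rw [hxy]
    rfl

theorem subgraphOf_reachable_image_iff (σ : L.graph ≃g L.graph) {S : Set L.Edge} {x y : L.V} :
    (L.subgraphOf (σ.mapEdgeSet '' S)).Reachable (σ x) (σ y) ↔ (L.subgraphOf S).Reachable x y := by
  refine ⟨fun h => ?_, subgraphOf_reachable_image σ⟩
  have hback := subgraphOf_reachable_image σ.symm h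
  rw [σ.symm_apply_apply, σ.symm_apply_apply] at hback
  convert hback using 2
  exact (σ.mapEdgeSet.symm_image_image S).symm

/-- The configuration seen through an automorphism of the lattice. -/
def pull (σ : L.graph ≃g L.graph) (ω : L.Config) : L.Config := fun e => ω (σ.mapEdgeSet e)

theorem pull_mono (σ : L.graph ≃g L.graph) : Monotone (pull σ) := fun _ _ h _ => h _

theorem reachable_pull_iff (σ : L.graph ≃g L.graph) {ω : L.Config} {x y : L.V} :
    (L.subgraphOf {e | pull σ ω e = true}).Reachable x y ↔
      (L.subgraphOf {e | ω e = true}).Reachable (σ x) (σ y) := by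
  rw [← subgraphOf_reachable_image_iff σ]
  have himage : σ.mapEdgeSet '' {e | pull σ ω e = true} = {e | ω e = true} :=
    σ.mapEdgeSet.surjective.image_preimage {e | ω e = true}
  rw [himage]

/-- The image of a finite set of edges under an automorphism. -/
def shift (σ : L.graph ≃g L.graph) (E : Finset L.Edge) : Finset L.Edge :=
  E.map σ.mapEdgeSet.toEmbedding

theorem mem_shift {σ : L.graph ≃g L.graph} {E : Finset L.Edge} {e : L.Edge} :
    e ∈ shift σ E ↔ ∃ f ∈ E, σ.mapEdgeSet f = e := Finset.mem_map

theorem mapEdgeSet_mem_shift {σ : L.graph ≃g L.graph} {E : Finset L.Edge} {e : L.Edge} :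
    σ.mapEdgeSet e ∈ shift σ E ↔ e ∈ E :=
  Finset.mem_map' σ.mapEdgeSet.toEmbedding

/-- The bijection between a finite set of edges and its image. -/
noncomputable def shiftEquiv (σ : L.graph ≃g L.graph) (E : Finset L.Edge) : E ≃ shift σ E :=
  σ.mapEdgeSet.subtypeEquiv fun _ => mapEdgeSet_mem_shift.symm

theorem mem_mapEdgeSet_iff (σ : L.graph ≃g L.graph) (e : L.Edge) (x : L.V) :
    σ x ∈ (σ.mapEdgeSet e : Sym2 L.V) ↔ x ∈ (e : Sym2 L.V) := by
  change σ x ∈ Sym2.map σ (e : Sym2 L.V) ↔ _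
  rw [Sym2.mem_map]
  exact ⟨fun ⟨_, hy, hxy⟩ => σ.injective hxy ▸ hy, fun h => ⟨x, h, rfl⟩⟩

theorem mem_verts_shift {σ : L.graph ≃g L.graph} {E : Finset L.Edge} {x : L.V} :
    σ x ∈ L.verts (shift σ E) ↔ x ∈ L.verts E := by
  constructor
  · rintro ⟨e, he, hx⟩
    obtain ⟨f, hf, rfl⟩ := mem_shift.1 he
    exact ⟨f, hf, (mem_mapEdgeSet_iff σ f x).1 hx⟩
  · rintro ⟨e, he, hx⟩
    exact ⟨_, mapEdgeSet_mem_shift.2 he, (mem_mapEdgeSet_iff σ e x).2 hx⟩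

theorem numClusters_shift (σ : L.graph ≃g L.graph) (E : Finset L.Edge) (η : shift σ E → Bool) :
    numClusters (shift σ E) ⊥ η = numClusters E ⊥ (η ∘ shiftEquiv σ E) := by
  unfold numClusters
  rw [sup_bot_eq, sup_bot_eq]
  symm
  refine Nat.card_congr (Quotient.congr
    (σ.toEquiv.subtypeEquiv fun x => mem_verts_shift.symm) fun x y => ?_)
  have hset : {e | ∃ h : e ∈ shift σ E, η ⟨e, h⟩ = true} =
      σ.mapEdgeSet '' {e | ∃ h : e ∈ E, (η ∘ shiftEquiv σ E) ⟨e, h⟩ = true} := by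
    ext e
    constructor
    · rintro ⟨he, ho⟩
      obtain ⟨f, hf, rfl⟩ := mem_shift.1 he
      exact ⟨f, ⟨hf, ho⟩, rfl⟩
    · rintro ⟨f, ⟨hf, ho⟩, rfl⟩
      exact ⟨mapEdgeSet_mem_shift.2 hf, ho⟩
  change (L.subgraphOf _).Reachable x.1 y.1 ↔ (L.subgraphOf _).Reachable (σ x.1) (σ y.1)
  rw [hset, subgraphOf_reachable_image_iff]

theorem fvWeight_shift (σ : L.graph ≃g L.graph) (E : Finset L.Edge) (η : shift σ E → Bool) :
    fvWeight p q (shift σ E) ⊥ η = fvWeight p q E ⊥ (η ∘ shiftEquiv σ E) := by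
  rw [fvWeight_eq, fvWeight_eq, numClusters_shift]
  congr 1
  exact (Fintype.prod_equiv (shiftEquiv σ E) _ _ fun e => rfl).symm

theorem fvMean_shift (σ : L.graph ≃g L.graph) (E : Finset L.Edge) (f : L.Config → ℝ) :
    fvMean p q (shift σ E) ⊥ (f ∘ pull σ) = fvMean p q E ⊥ f := by
  have hsum (g : (E → Bool) → ℝ) :
      ∑ η : shift σ E → Bool, g (η ∘ shiftEquiv σ E) = ∑ η, g η :=
    Fintype.sum_equiv (Equiv.arrowCongr (shiftEquiv σ E).symm (Equiv.refl Bool)) _ _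
      fun η => rfl
  have hZ : partitionFunction p q (shift σ E) ⊥ = partitionFunction p q E ⊥ := by
    unfold partitionFunction
    rw [← hsum]
    exact Finset.sum_congr rfl fun η _ => fvWeight_shift σ E η
  unfold fvMean
  rw [← hsum]
  refine Finset.sum_congr rfl fun η _ => ?_
  rw [fvProb_eq, fvProb_eq, hZ, fvWeight_shift, Function.comp_apply]
  congr 2
  funext e
  by_cases he : e ∈ E
  · rw [extend_apply_mem _ he]
    exact extend_apply_mem _ (mapEdgeSet_mem_shift.2 he)
  · rw [extend_apply_notMem _ he]
    exact extend_apply_notMem _ fun h => he (mapEdgeSet_mem_shift.1 h)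

theorem IsLocal.preimage_pull {F : Finset L.Edge} {A : Set L.Config} (hA : IsLocal F A)
    (σ : L.graph ≃g L.graph) : IsLocal (shift σ F) (pull σ ⁻¹' A) :=
  fun _ _ h => hA _ _ fun _ he => h _ (mapEdgeSet_mem_shift.2 he)

/-! ### Periods -/

/-- The translation by `w` is an automorphism of the lattice. -/
def IsPeriod (L : PlanarLattice) (w : ℂ) : Prop := IsEmbeddedAut L.graph fun z => z + w

theorem IsPeriod.zero : L.IsPeriod 0 := ⟨SimpleGraph.Iso.refl, fun x => by simp⟩

theorem IsPeriod.add {w z : ℂ} (hw : L.IsPeriod w) (hz : L.IsPeriod z) : L.IsPeriod (w + z) := by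
  obtain ⟨σ, hσ⟩ := hw
  obtain ⟨τ, hτ⟩ := hz
  refine ⟨σ.trans τ, fun x => ?_⟩
  change (τ (σ x) : ℂ) = _
  rw [hτ, hσ]
  exact add_assoc _ _ _

theorem IsPeriod.neg {w : ℂ} (hw : L.IsPeriod w) : L.IsPeriod (-w) := by
  obtain ⟨σ, hσ⟩ := hw
  refine ⟨σ.symm, fun x => ?_⟩
  have hx : ((σ (σ.symm x) : L.V) : ℂ) = σ.symm x + w := hσ (σ.symm x)
  rw [σ.apply_symm_apply] at hx
  change ((σ.symm x : L.V) : ℂ) = x + -w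
  rw [hx]
  ring

theorem IsPeriod.nsmul {w : ℂ} (hw : L.IsPeriod w) (n : ℕ) : L.IsPeriod (n • w) := by
  induction n with
  | zero => simpa using IsPeriod.zero
  | succ n ih => rw [succ_nsmul]; exact ih.add hw

theorem IsPeriod.zsmul {w : ℂ} (hw : L.IsPeriod w) (n : ℤ) : L.IsPeriod (n • w) := by
  cases n with
  | ofNat n => simpa using hw.nsmul n
  | negSucc n => rw [negSucc_zsmul]; exact (hw.nsmul (n + 1)).neg

theorem IsPeriod.lattice {u v : ℂ} (hu : L.IsPeriod u) (hv : L.IsPeriod v) (m n : ℤ) :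
    L.IsPeriod (m • u + n • v) := (hu.zsmul m).add (hv.zsmul n)

/-- The automorphism given by a period. -/
noncomputable def IsPeriod.iso {w : ℂ} (hw : L.IsPeriod w) : L.graph ≃g L.graph := hw.choose

theorem IsPeriod.coe_iso {w : ℂ} (hw : L.IsPeriod w) (x : L.V) : (hw.iso x : ℂ) = x + w :=
  hw.choose_spec x

theorem IsPeriod.edgeSegment {w : ℂ} (hw : L.IsPeriod w) (e : L.Edge) :
    edgeSegment (hw.iso.mapEdgeSet e : Sym2 L.V) =
      (fun z => z + w) '' edgeSegment (e : Sym2 L.V) := by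
  obtain ⟨e, he⟩ := e
  change _root_.edgeSegment (Sym2.map hw.iso e) = _ '' _root_.edgeSegment e
  induction e using Sym2.ind with | _ x y => ?_
  change segment ℝ (hw.iso x : ℂ) (hw.iso y) = _ '' segment ℝ (x : ℂ) y
  rw [hw.coe_iso, hw.coe_iso]
  simp only [add_comm _ w]
  exact (segment_translate_image ℝ w (x : ℂ) y).symm

theorem IsPeriod.mapEdgeSet_inj {w z : ℂ} (hw : L.IsPeriod w) (hz : L.IsPeriod z) {e : L.Edge}
    (h : hw.iso.mapEdgeSet e = hz.iso.mapEdgeSet e) : w = z := by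
  obtain ⟨e, he⟩ := e
  replace h : Sym2.map hw.iso e = Sym2.map hz.iso e := congrArg Subtype.val h
  clear he
  induction e using Sym2.ind with | _ x y => ?_
  simp only [Sym2.map_mk, Sym2.eq_iff, Subtype.ext_iff, hw.coe_iso, hz.coe_iso] at h
  rcases h with ⟨hx, -⟩ | ⟨hx, hy⟩
  · exact add_left_cancel hx
  · linear_combination (hx + hy) / 2

theorem exists_coordinates {u v : ℂ} (h : LinearIndependent ℝ ![u, v]) :
    ∃ a b : ℂ →L[ℝ] ℝ, (∀ z, z = a z • u + b z • v) ∧ a u = 1 ∧ a v = 0 ∧ b u = 0 ∧ b v = 1 := by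
  set B := basisOfLinearIndependentOfCardEqFinrank h (by simp [Complex.finrank_real_complex])
    with hB
  have hBu : B 0 = u := by simp [hB]
  have hBv : B 1 = v := by simp [hB]
  refine ⟨LinearMap.toContinuousLinearMap (B.coord 0), LinearMap.toContinuousLinearMap (B.coord 1),
    fun z => ?_, ?_, ?_, ?_, ?_⟩
  · conv_lhs => rw [← B.sum_repr z, Fin.sum_univ_two, hBu, hBv]
    rfl
  · simp [← hBu]
  · simp [← hBv]
  · simp [← hBu]
  · simp [← hBv]

theorem exists_lattice_near {u v : ℂ} (h : LinearIndependent ℝ ![u, v]) (z : ℂ) :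
    ∃ m n : ℤ, ‖z - (m • u + n • v)‖ ≤ ‖u‖ + ‖v‖ := by
  obtain ⟨a, b, hab, -⟩ := exists_coordinates h
  refine ⟨⌊a z⌋, ⌊b z⌋, ?_⟩
  have hfract : z - (⌊a z⌋ • u + ⌊b z⌋ • v) = Int.fract (a z) • u + Int.fract (b z) • v := by
    nth_rewrite 1 [hab z]
    rw [← Int.cast_smul_eq_zsmul ℝ, ← Int.cast_smul_eq_zsmul ℝ, Int.fract, Int.fract, sub_smul,
      sub_smul]
    abel_nf
  rw [hfract]
  refine (norm_add_le _ _).trans (add_le_add ?_ ?_) <;>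
  · rw [norm_smul, Real.norm_eq_abs, abs_of_nonneg (Int.fract_nonneg _)]
    exact mul_le_of_le_one_left (norm_nonneg _) (Int.fract_lt_one _).le

theorem exists_vertex_near {u v : ℂ} (h : LinearIndependent ℝ ![u, v]) (hu : L.IsPeriod u)
    (hv : L.IsPeriod v) (x : L.V) :
    ∃ (w : L.V) (m n : ℤ), ‖(w : ℂ)‖ ≤ ‖u‖ + ‖v‖ ∧ (hu.lattice hv m n).iso w = x := by
  obtain ⟨m, n, hmn⟩ := exists_lattice_near h (x : ℂ)
  have hsub := (hu.lattice hv m n).neg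
  refine ⟨hsub.iso x, m, n, ?_, ?_⟩
  · rw [hsub.coe_iso, ← sub_eq_add_neg]; exact hmn
  · apply Subtype.ext
    rw [(hu.lattice hv m n).coe_iso, hsub.coe_iso]
    ring

theorem finite_vertices_norm_le (L : PlanarLattice) (r : ℝ) : {x : L.V | ‖(x : ℂ)‖ ≤ r}.Finite := by
  refine Set.Finite.of_finite_image (f := fun x : L.V => (x : ℂ)) ?_ Subtype.val_injective.injOn
  refine (L.finite_vertices r).subset ?_
  rintro _ ⟨x, hx, rfl⟩
  exact ⟨x.2, by simpa using hx⟩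

theorem finite_edges_at (x : L.V) : {e : L.Edge | x ∈ (e : Sym2 L.V)}.Finite := by
  refine Set.Finite.of_finite_image (f := fun e : L.Edge => (e : Sym2 L.V)) ?_
    Subtype.val_injective.injOn
  refine ((L.finite_neighbors x).image fun y => s(x, y)).subset ?_
  rintro _ ⟨⟨e, he⟩, hx, rfl⟩
  obtain ⟨y, rfl⟩ := Sym2.mem_iff_exists.1 hx
  exact ⟨y, he, rfl⟩

theorem finite_edges_of_finite {s : Set L.V} (hs : s.Finite) :
    {e : L.Edge | ∃ x ∈ s, x ∈ (e : Sym2 L.V)}.Finite := by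
  refine (hs.biUnion fun x _ => finite_edges_at x).subset ?_
  rintro e ⟨x, hx, hxe⟩
  exact mem_biUnion hx hxe

/-! ### Boxes -/

/-- The translations defining `box`: the pairs of integers in `[0, N)²`. -/
noncomputable def boxIndices (N : ℕ) : Finset (ℤ × ℤ) :=
  Finset.Ico 0 (N : ℤ) ×ˢ Finset.Ico 0 (N : ℤ)

/-- The union of the translates of a finite set of edges by the vectors `m • u + n • v`, for
`(m, n)` in `[0, N)²`. -/
noncomputable def box {u v : ℂ} (hu : L.IsPeriod u) (hv : L.IsPeriod v) (F : Finset L.Edge)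
    (N : ℕ) : Finset L.Edge := by
  classical
  exact (boxIndices N).biUnion fun m => shift (hu.lattice hv m.1 m.2).iso F

/-- The indices of the square `[0, N)²` at distance less than `M` from its sides. -/
noncomputable def boxLayer (M N : ℕ) : Finset (ℤ × ℤ) :=
  boxIndices N \ (Finset.Ico (M : ℤ) (N - M) ×ˢ Finset.Ico (M : ℤ) (N - M))

theorem card_boxLayer_le (M N : ℕ) : (boxLayer M N).card ≤ 4 * M * N := by
  rw [boxLayer, boxIndices, Finset.card_sdiff_of_subset (Finset.product_subset_product
    (Finset.Ico_subset_Ico (by omega) (by omega)) (Finset.Ico_subset_Ico (by omega) (by omega)))]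
  simp only [Finset.card_product, Int.card_Ico, sub_zero, Int.toNat_natCast, tsub_le_iff_right]
  obtain hMN | hMN := le_total (2 * M) N
  · obtain ⟨k, rfl⟩ := exists_add_of_le hMN
    have hk : (((2 * M + k : ℕ) : ℤ) - M - M).toNat = k := by omega
    rw [hk]
    nlinarith
  · nlinarith

section Box

variable {u v : ℂ} {hu : L.IsPeriod u} {hv : L.IsPeriod v} {F : Finset L.Edge} {N : ℕ}

theorem mem_box {e : L.Edge} :
    e ∈ box hu hv F N ↔ ∃ m ∈ boxIndices N, e ∈ shift (hu.lattice hv m.1 m.2).iso F := by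
  simp only [box, Finset.mem_biUnion]

theorem mem_box_of_iso_mem {w : L.V} (hw : ∀ e : L.Edge, w ∈ (e : Sym2 L.V) → e ∈ F)
    {m : ℤ × ℤ} (hm : m ∈ boxIndices N) {e : L.Edge}
    (he : (hu.lattice hv m.1 m.2).iso w ∈ (e : Sym2 L.V)) : e ∈ box hu hv F N := by
  obtain ⟨f, rfl⟩ := (hu.lattice hv m.1 m.2).iso.mapEdgeSet.surjective e
  exact mem_box.2 ⟨m, hm, mapEdgeSet_mem_shift.2 (hw f ((mem_mapEdgeSet_iff _ f w).1 he))⟩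

theorem IsPeriod.iso_lattice_iso_lattice (hu : L.IsPeriod u) (hv : L.IsPeriod v) (m n a b : ℤ)
    (w : L.V) : (hu.lattice hv m n).iso ((hu.lattice hv a b).iso w) =
      (hu.lattice hv (m + a) (n + b)).iso w := by
  apply Subtype.ext
  simp only [IsPeriod.coe_iso, add_smul]
  ring

/-- A vertex of the box is a boundary vertex only if its translate into the fundamental domain
leaves the square of indices. -/
theorem exists_boundary_box_subset (h : LinearIndependent ℝ ![u, v]) (hu : L.IsPeriod u)
    (hv : L.IsPeriod v) (hF : ∀ w : L.V, ‖(w : ℂ)‖ ≤ ‖u‖ + ‖v‖ →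
      ∀ e : L.Edge, w ∈ (e : Sym2 L.V) → e ∈ F) :
    ∃ M : ℕ, ∀ N, Subtype.val '' boundary (box hu hv F N) ⊆
      image2 (fun (m : ℤ × ℤ) (z : L.V) => (hu.lattice hv m.1 m.2).iso z)
        (boxLayer M N) (L.verts F) := by
  choose w a b hw hab using exists_vertex_near h hu hv
  obtain ⟨M, hM⟩ : ∃ M : ℕ, ∀ z ∈ L.verts F, (a z).natAbs ≤ M ∧ (b z).natAbs ≤ M := by
    obtain ⟨M, hM⟩ := ((finite_verts F).image fun z => max (a z).natAbs (b z).natAbs).bddAbove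
    exact ⟨M, fun z hz => max_le_iff.1 (hM (mem_image_of_mem _ hz))⟩
  refine ⟨M, fun N => ?_⟩
  rintro _ ⟨⟨x, e, he, hxe⟩, ⟨f, hf, hxf⟩, rfl⟩
  obtain ⟨m, hm, he⟩ := mem_box.1 he
  obtain ⟨z, rfl⟩ := (hu.lattice hv m.1 m.2).iso.surjective x
  have hz : z ∈ L.verts F := mem_verts_shift.1 ⟨e, he, hxe⟩
  refine ⟨m, ?_, z, hz, rfl⟩
  by_contra hinner
  simp only [boxLayer, boxIndices, Finset.mem_coe, Finset.mem_sdiff, Finset.mem_product,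
    Finset.mem_Ico] at hinner hm
  have hbound := hM z hz
  refine hf (mem_box_of_iso_mem (hu := hu) (hv := hv) (m := (m.1 + a z, m.2 + b z))
    (hF (w z) (hw z)) ?_ ?_)
  · simp only [boxIndices, Finset.mem_product, Finset.mem_Ico]
    omega
  · rwa [← IsPeriod.iso_lattice_iso_lattice hu hv, hab]

end Box

theorem exists_box_boundary_le {u v : ℂ} (h : LinearIndependent ℝ ![u, v]) (hu : L.IsPeriod u)
    (hv : L.IsPeriod v) (F₀ : Finset L.Edge) : ∃ F : Finset L.Edge, F₀ ⊆ F ∧ ∃ C : ℕ, ∀ N : ℕ,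
      (boundary (box hu hv F N)).ncard ≤ C * N := by
  classical
  have hnear := finite_edges_of_finite (finite_vertices_norm_le L (‖u‖ + ‖v‖))
  set F : Finset L.Edge := F₀ ∪ hnear.toFinset
  obtain ⟨M, hM⟩ := exists_boundary_box_subset (F := F) h hu hv fun w hw e he =>
    Finset.mem_union_right _ (hnear.mem_toFinset.2 ⟨w, hw, he⟩)
  refine ⟨F, Finset.subset_union_left, 4 * M * (L.verts F).ncard, fun N => ?_⟩
  have hfin := (boxLayer M N).finite_toSet.prod (finite_verts F)
  calc (boundary (box hu hv F N)).ncard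
      = (Subtype.val '' boundary (box hu hv F N)).ncard :=
        (Set.ncard_image_of_injective _ Subtype.val_injective).symm
    _ ≤ ((fun m : (ℤ × ℤ) × L.V => (hu.lattice hv m.1.1 m.1.2).iso m.2) ''
          ((boxLayer M N : Set (ℤ × ℤ)) ×ˢ L.verts F)).ncard := by
        refine Set.ncard_le_ncard ?_ (hfin.image _)
        exact (hM N).trans_eq (Set.image_prod
          (fun (m : ℤ × ℤ) (z : L.V) => (hu.lattice hv m.1 m.2).iso z)).symm
    _ ≤ ((boxLayer M N : Set (ℤ × ℤ)) ×ˢ L.verts F).ncard := Set.ncard_image_le hfin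
    _ = (boxLayer M N).card * (L.verts F).ncard := by rw [Set.ncard_prod, Set.ncard_coe_finset]
    _ ≤ 4 * M * N * (L.verts F).ncard := Nat.mul_le_mul_right _ (card_boxLayer_le M N)
    _ = 4 * M * (L.verts F).ncard * N := by ring

/-! ### The density of open edges and the normalizing constants -/

/-- The indicator function of the event that an edge is open. -/
noncomputable def edgeIndicator (e : L.Edge) : L.Config → ℝ :=
  ({ω | ω e = true} : Set L.Config).indicator 1

theorem isUpperSet_edge_open (e : L.Edge) : IsUpperSet {ω : L.Config | ω e = true} :=
  fun _ _ h hω => Bool.eq_true_of_true_le (Eq.ge hω |>.trans (h e))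

theorem monotone_edgeIndicator (e : L.Edge) : Monotone (edgeIndicator e) :=
  monotone_indicator_one (isUpperSet_edge_open e)

theorem sum_edgeIndicator_extend (E : Finset L.Edge) (η : E → Bool) :
    ∑ e ∈ E, edgeIndicator e (extend E η) = numOpen E η := by
  classical
  rw [← Finset.sum_coe_sort E, numOpen, Finset.card_filter]
  push_cast
  refine Finset.sum_congr rfl fun e _ => ?_
  rw [edgeIndicator, indicator_apply]
  simp only [mem_ofPred_eq, extend_apply_mem _ e.2, Pi.one_apply]

theorem hasDerivAt_fvWeight {s : ℝ} (hs : s ∈ Ioo (0 : ℝ) 1) (q : ℝ) (E : Finset L.Edge)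
    (ξ : L.BoundaryCondition E) (η : E → Bool) :
    HasDerivAt (fun t => fvWeight t q E ξ η)
      (fvWeight s q E ξ η * ((numOpen E η - s * E.card) / (s * (1 - s)))) s := by
  have hs0 : s ≠ 0 := hs.1.ne'
  have hs1 : 1 - s ≠ 0 := (sub_pos.2 hs.2).ne'
  have hpow (r : ℝ) (n : ℕ) (hr : r ≠ 0) : (n : ℝ) * r ^ (n - 1) = n / r * r ^ n := by
    cases n with
    | zero => simp
    | succ n => rw [Nat.add_sub_cancel, pow_succ]; field_simp
  have hderiv := ((hasDerivAt_pow (numOpen E η) s).mul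
    (((hasDerivAt_id s).const_sub 1).pow (numClosed E η))).mul_const (q ^ numClusters E ξ η)
  refine hderiv.congr_deriv ?_
  have hcard : (E.card : ℝ) = numOpen E η + numClosed E η := by
    exact_mod_cast (numOpen_add_numClosed η).symm
  simp only [id_eq, Pi.pow_apply]
  rw [hpow s _ hs0, hpow (1 - s) _ hs1, hcard, fvWeight]
  field_simp
  ring

theorem sum_fvMean_edgeIndicator (E : Finset L.Edge) (ξ : L.BoundaryCondition E) :
    ∑ e ∈ E, fvMean p q E ξ (edgeIndicator e) =
      (∑ η, fvWeight p q E ξ η * numOpen E η) / partitionFunction p q E ξ := by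
  rw [← fvMean_sum, fvMean_eq]
  refine congrArg (· / _) (Finset.sum_congr rfl fun η _ => ?_)
  rw [sum_edgeIndicator_extend, mul_comm]

theorem hasDerivAt_log_partitionFunction {s : ℝ} (hs : s ∈ Ioo (0 : ℝ) 1) (hq : 1 ≤ q)
    (E : Finset L.Edge) (ξ : L.BoundaryCondition E) :
    HasDerivAt (fun t => Real.log (partitionFunction t q E ξ))
      ((∑ e ∈ E, fvMean s q E ξ (edgeIndicator e) - s * E.card) / (s * (1 - s))) s := by
  have hZ := partitionFunction_pos hs hq E ξ
  have hderiv : HasDerivAt (fun t => partitionFunction t q E ξ)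
      (∑ η, fvWeight s q E ξ η * ((numOpen E η - s * E.card) / (s * (1 - s)))) s :=
    HasDerivAt.fun_sum fun η _ => hasDerivAt_fvWeight hs q E ξ η
  have hsum : ∑ η, fvWeight s q E ξ η * ((numOpen E η - s * E.card) / (s * (1 - s))) =
      ((∑ η, fvWeight s q E ξ η * numOpen E η) - s * E.card * partitionFunction s q E ξ) /
        (s * (1 - s)) := by
    rw [partitionFunction, Finset.mul_sum, ← Finset.sum_sub_distrib, Finset.sum_div]
    exact Finset.sum_congr rfl fun η _ => by ring
  refine (hderiv.log hZ.ne').congr_deriv ?_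
  rw [hsum, sum_fvMean_edgeIndicator]
  field_simp

theorem log_partitionFunction_wired_le (hp : p ∈ Ioo (0 : ℝ) 1) (hq : 1 ≤ q) (E : Finset L.Edge) :
    Real.log (partitionFunction p q E (wired E)) ≤ Real.log (partitionFunction p q E ⊥) :=
  Real.log_le_log (partitionFunction_pos hp hq E _)
    (Finset.sum_le_sum fun η _ => fvWeight_antitone hp hq η bot_le)

theorem log_partitionFunction_bot_le (hp : p ∈ Ioo (0 : ℝ) 1) (hq : 1 ≤ q) (E : Finset L.Edge) :
    Real.log (partitionFunction p q E ⊥) ≤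
      (boundary E).ncard * Real.log q + Real.log (partitionFunction p q E (wired E)) := by
  have hle : partitionFunction p q E ⊥ ≤
      q ^ (boundary E).ncard * partitionFunction p q E (wired E) := by
    rw [partitionFunction, partitionFunction, Finset.mul_sum]
    exact Finset.sum_le_sum fun η _ => fvWeight_bot_le hp hq le_rfl η
  rw [← Real.log_pow, ← Real.log_mul (by positivity) (partitionFunction_pos hp hq E _).ne']
  exact Real.log_le_log (partitionFunction_pos hp hq E ⊥) hle

/-- The difference of the probabilities that `e` is open under the wired and the free measure on
the finite subgraph with edge set `E`. -/
noncomputable def wiringEffect (p q : ℝ) (E : Finset L.Edge) (e : L.Edge) : ℝ :=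
  fvMean p q E (wired E) (edgeIndicator e) - fvMean p q E ⊥ (edgeIndicator e)

theorem wiringEffect_nonneg (hp : p ∈ Ioo (0 : ℝ) 1) (hq : 1 ≤ q) (E : Finset L.Edge)
    (e : L.Edge) : 0 ≤ wiringEffect p q E e :=
  sub_nonneg.2 (fvMean_mono hp hp le_rfl hq bot_le (monotone_edgeIndicator e))

theorem hasDerivAt_log_partitionFunction_wired_sub_bot {s : ℝ} (hs : s ∈ Ioo (0 : ℝ) 1)
    (hq : 1 ≤ q) (E : Finset L.Edge) :
    HasDerivAt (fun t => Real.log (partitionFunction t q E (wired E)) -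
      Real.log (partitionFunction t q E ⊥))
      ((∑ e ∈ E, wiringEffect s q E e) / (s * (1 - s))) s := by
  refine ((hasDerivAt_log_partitionFunction hs hq E (wired E)).sub
    (hasDerivAt_log_partitionFunction hs hq E ⊥)).congr_deriv ?_
  simp only [wiringEffect, Finset.sum_sub_distrib]
  ring

/-- The sum of the wiring effects is `s (1 - s)` times the derivative of the logarithm of the ratio
of the two partition functions, which is controlled by the number of boundary vertices: apply the
mean value theorem. -/
theorem exists_sum_wiringEffect_le {p' : ℝ} (hp : p ∈ Ioo (0 : ℝ) 1) (hp' : p' ∈ Ioo (0 : ℝ) 1)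
    (hpp : p < p') (hq : 1 ≤ q) (E : Finset L.Edge) : ∃ s ∈ Ioo p p',
      ∑ e ∈ E, wiringEffect s q E e ≤ (boundary E).ncard * Real.log q / (p' - p) := by
  have hsub : ∀ s ∈ Icc p p', s ∈ Ioo (0 : ℝ) 1 :=
    fun s hs => ⟨hp.1.trans_le hs.1, hs.2.trans_lt hp'.2⟩
  have hderiv := fun s hs => hasDerivAt_log_partitionFunction_wired_sub_bot (hsub s hs) hq E
  obtain ⟨s, hs, hslope⟩ := exists_hasDerivAt_eq_slope _ _ hpp
    (fun s hs => (hderiv s hs).continuousAt.continuousWithinAt)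
    fun s hs => hderiv s (Ioo_subset_Icc_self hs)
  refine ⟨s, hs, ?_⟩
  obtain ⟨hs0, hs1⟩ := hsub s (Ioo_subset_Icc_self hs)
  have hpos : 0 < s * (1 - s) := mul_pos hs0 (sub_pos.2 hs1)
  have hle : s * (1 - s) ≤ 1 := by nlinarith
  have hB : 0 ≤ (boundary E).ncard * Real.log q / (p' - p) :=
    div_nonneg (mul_nonneg (Nat.cast_nonneg _) (Real.log_nonneg hq)) (sub_pos.2 hpp).le
  rw [div_eq_iff hpos.ne'] at hslope
  rw [hslope]
  refine (mul_le_mul_of_nonneg_right ?_ hpos.le).trans (mul_le_of_le_one_right hB hle)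
  refine div_le_div_of_nonneg_right ?_ (sub_pos.2 hpp).le
  linarith [log_partitionFunction_wired_le hp' hq E, log_partitionFunction_bot_le hp hq E]

theorem sum_edgeIndicator_add_one_le {F : Finset L.Edge} {ω ω' : L.Config} (h : ω ≤ ω')
    {e : L.Edge} (he : e ∈ F) (hne : ω e ≠ ω' e) :
    ∑ f ∈ F, edgeIndicator f ω + 1 ≤ ∑ f ∈ F, edgeIndicator f ω' := by
  classical
  obtain ⟨hclosed, hopen⟩ := Bool.lt_iff.1 (lt_of_le_of_ne (h e) hne)
  rw [← Finset.add_sum_erase F _ he, ← Finset.add_sum_erase F (fun f => edgeIndicator f ω') he]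
  have hzero : edgeIndicator e ω = 0 := indicator_of_notMem (by simp [hclosed]) _
  have hone : edgeIndicator e ω' = 1 := indicator_of_mem (by simp [hopen]) _
  have hrest := Finset.sum_le_sum fun f (_ : f ∈ F.erase e) => monotone_edgeIndicator f h
  rw [hzero, hone]
  linarith

theorem monotone_sum_edgeIndicator_sub_indicator {F : Finset L.Edge} {A : Set L.Config}
    (hA : IsLocal F A) :
    Monotone ((fun ω : L.Config => ∑ e ∈ F, edgeIndicator e ω) - A.indicator 1) := by
  classical
  intro ω ω' hω
  rw [Pi.sub_apply, Pi.sub_apply]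
  by_cases hagree : ∀ e ∈ F, ω e = ω' e
  · have hmem : ω ∈ A ↔ ω' ∈ A := ⟨hA _ _ hagree, hA _ _ fun e he => (hagree e he).symm⟩
    have hindicator : A.indicator (1 : L.Config → ℝ) ω = A.indicator 1 ω' := by
      simp only [indicator_apply, hmem, Pi.one_apply]
    rw [hindicator]
    exact sub_le_sub_right (Finset.sum_le_sum fun e _ => monotone_edgeIndicator e hω) _
  · push Not at hagree
    obtain ⟨e, he, hne⟩ := hagree
    have hsum := sum_edgeIndicator_add_one_le hω he hne
    have hnonneg : (0 : ℝ) ≤ A.indicator 1 ω := indicator_nonneg (fun _ _ => zero_le_one) _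
    have hle_one : A.indicator (1 : L.Config → ℝ) ω' ≤ 1 :=
      indicator_le_self' (fun _ _ => zero_le_one) _
    linarith

theorem fvMean_wired_sub_bot_le (hp : p ∈ Ioo (0 : ℝ) 1) (hq : 1 ≤ q) (E : Finset L.Edge)
    {F : Finset L.Edge} {A : Set L.Config} (hA : IsLocal F A) :
    fvMean p q E (wired E) (A.indicator 1) - fvMean p q E ⊥ (A.indicator 1) ≤
      ∑ e ∈ F, wiringEffect p q E e := by
  have hle := fvMean_mono hp hp le_rfl hq (bot_le : ⊥ ≤ wired E)
    (monotone_sum_edgeIndicator_sub_indicator hA)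
  rw [fvMean_sub, fvMean_sub, fvMean_sum, fvMean_sum] at hle
  simp only [wiringEffect, Finset.sum_sub_distrib]
  linarith

/-! ### Comparison with the free measure at a larger edge-weight -/

theorem shift_symm_shift (σ : L.graph ≃g L.graph) (E : Finset L.Edge) :
    shift σ (shift σ.symm E) = E := by
  rw [shift, shift, Finset.map_map]
  have hrefl : σ.symm.mapEdgeSet.toEmbedding.trans σ.mapEdgeSet.toEmbedding = .refl L.Edge :=
    Function.Embedding.ext σ.mapEdgeSet.apply_symm_apply
  rw [hrefl, Finset.map_refl]

theorem sub_real_le_sum_wiringEffect {p' s : ℝ} (hp : p ∈ Ioo (0 : ℝ) 1)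
    (hp' : p' ∈ Ioo (0 : ℝ) 1) (hs : s ∈ Ioo p p') (hq : 1 ≤ q) {φ φ' : Measure L.Config}
    (hφ : IsRandomClusterMeasure p q φ) (hφ' : IsFreeMeasure p' q φ') {E F : Finset L.Edge}
    {A : Set L.Config} (hA : IsLocal F A) (hup : IsUpperSet A) (σ : L.graph ≃g L.graph)
    (hE : shift σ F ⊆ E) :
    φ.real (pull σ ⁻¹' A) - φ'.real A ≤ ∑ f ∈ F, wiringEffect s q E (σ.mapEdgeSet f) := by
  have hs01 : s ∈ Ioo (0 : ℝ) 1 := ⟨hp.1.trans hs.1, hs.2.trans hp'.2⟩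
  have hlocal := hA.preimage_pull σ
  have hup' : IsUpperSet (pull σ ⁻¹' A) := hup.preimage (pull_mono σ)
  have hwired : φ.real (pull σ ⁻¹' A) ≤ fvMean s q E (wired E) ((pull σ ⁻¹' A).indicator 1) :=
    (hφ.real_le_fvMean_wired hp hq (hlocal.mono hE) hup').trans
      (fvMean_mono hp hs01 hs.1.le hq le_rfl (monotone_indicator_one hup'))
  have hfree : fvMean s q E ⊥ ((pull σ ⁻¹' A).indicator 1) ≤ φ'.real A := by
    refine (fvMean_mono hs01 hp' hs.2.le hq le_rfl (monotone_indicator_one hup')).trans ?_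
    rw [← shift_symm_shift σ E]
    exact (fvMean_shift σ _ (A.indicator 1)).trans_le (hφ'.fvMean_le hp' hq hA hup _)
  have heffect := fvMean_wired_sub_bot_le hs01 hq E hlocal
  rw [shift, Finset.sum_map] at heffect
  exact (sub_le_sub hwired hfree).trans heffect

section Box

variable {u v : ℂ}

theorem lattice_injective (h : LinearIndependent ℝ ![u, v]) :
    Function.Injective fun m : ℤ × ℤ => m.1 • u + m.2 • v := by
  obtain ⟨a, b, -, hau, hav, hbu, hbv⟩ := exists_coordinates h
  intro m n heq
  have ha := congrArg a heq
  have hb := congrArg b heq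
  simp only [← Int.cast_smul_eq_zsmul ℝ, map_add, map_smul, hau, hav, hbu, hbv, smul_eq_mul,
    mul_zero, add_zero, zero_add, mul_one, Int.cast_inj] at ha hb
  exact Prod.ext ha hb

theorem sum_boxIndices_le (h : LinearIndependent ℝ ![u, v]) (hu : L.IsPeriod u)
    (hv : L.IsPeriod v) {F₀ F : Finset L.Edge} (hF : F₀ ⊆ F) (N : ℕ) {d : L.Edge → ℝ}
    (hd : ∀ e, 0 ≤ d e) :
    ∑ m ∈ boxIndices N, ∑ f ∈ F₀, d ((hu.lattice hv m.1 m.2).iso.mapEdgeSet f) ≤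
      F₀.card * ∑ e ∈ box hu hv F N, d e := by
  classical
  rw [Finset.sum_comm, ← nsmul_eq_mul]
  refine Finset.sum_le_card_nsmul _ _ _ fun f hf => ?_
  have hinj : Function.Injective fun m : ℤ × ℤ => (hu.lattice hv m.1 m.2).iso.mapEdgeSet f :=
    fun m n hmn => lattice_injective h (IsPeriod.mapEdgeSet_inj _ _ hmn)
  rw [← Finset.sum_image (g := fun m : ℤ × ℤ => (hu.lattice hv m.1 m.2).iso.mapEdgeSet f) (f := d)
    hinj.injOn]
  refine Finset.sum_le_sum_of_subset_of_nonneg ?_ fun e _ _ => hd e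
  rintro e he
  obtain ⟨m, hm, rfl⟩ := Finset.mem_image.1 he
  exact mem_box.2 ⟨m, hm, mapEdgeSet_mem_shift.2 (hF hf)⟩

theorem card_boxIndices (N : ℕ) : (boxIndices N).card = N * N := by
  simp only [boxIndices, Finset.card_product, Int.card_Ico, sub_zero, Int.toNat_natCast]

/-- Average over the translations by the indices of a large box `E`: on the scale of the area of
`E`, the wired and the free measures on `E` differ by a boundary term. -/
theorem le_real_of_isFreeMeasure {p' : ℝ} (hp : p ∈ Ioo (0 : ℝ) 1) (hp' : p' ∈ Ioo (0 : ℝ) 1)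
    (hpp : p < p') (hq : 1 ≤ q) {φ φ' : Measure L.Config} (hφ : IsRandomClusterMeasure p q φ)
    (hφ' : IsFreeMeasure p' q φ') (h : LinearIndependent ℝ ![u, v])
    (hu : L.IsPeriod u) (hv : L.IsPeriod v) {F₀ : Finset L.Edge} {A : Set L.Config}
    (hA : IsLocal F₀ A) (hup : IsUpperSet A) {c : ℝ}
    (hc : ∀ m n : ℤ, c ≤ φ.real (pull (hu.lattice hv m n).iso ⁻¹' A)) : c ≤ φ'.real A := by
  obtain ⟨F, hF, C, hC⟩ := exists_box_boundary_le h hu hv F₀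
  set K : ℝ := F₀.card * (C * Real.log q / (p' - p)) with hK
  have hdiff : ∀ N : ℕ, 0 < N → c - φ'.real A ≤ K / N := by
    intro N hN
    replace hN : (0 : ℝ) < N := Nat.cast_pos.2 hN
    obtain ⟨s, hs, hsum⟩ := exists_sum_wiringEffect_le hp hp' hpp hq (box hu hv F N)
    have hlow : N * N * (c - φ'.real A) ≤ ∑ m ∈ boxIndices N, ∑ f ∈ F₀,
        wiringEffect s q (box hu hv F N) ((hu.lattice hv m.1 m.2).iso.mapEdgeSet f) := by
      have hcard := Finset.card_nsmul_le_sum (boxIndices N) _ (c - φ'.real A) fun m hm =>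
        (sub_le_sub_right (hc m.1 m.2) _).trans (sub_real_le_sum_wiringEffect hp hp' hs hq hφ hφ' hA
          hup (E := box hu hv F N) (hu.lattice hv m.1 m.2).iso fun e he =>
            mem_box.2 ⟨m, hm, Finset.map_subset_map.2 hF he⟩)
      rwa [nsmul_eq_mul, card_boxIndices, Nat.cast_mul] at hcard
    have hboundary : ∑ e ∈ box hu hv F N, wiringEffect s q (box hu hv F N) e ≤
        C * N * Real.log q / (p' - p) := by
      refine hsum.trans (div_le_div_of_nonneg_right ?_ (sub_pos.2 hpp).le)
      exact mul_le_mul_of_nonneg_right (by exact_mod_cast hC N) (Real.log_nonneg hq)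
    have hupper := sum_boxIndices_le h hu hv hF N
      (wiringEffect_nonneg ⟨hp.1.trans hs.1, hs.2.trans hp'.2⟩ hq (box hu hv F N))
    rw [le_div_iff₀ hN]
    refine le_of_mul_le_mul_left ?_ hN
    calc N * ((c - φ'.real A) * N) = N * N * (c - φ'.real A) := by ring
      _ ≤ F₀.card * (C * N * Real.log q / (p' - p)) := (hlow.trans hupper).trans
          (mul_le_mul_of_nonneg_left hboundary (Nat.cast_nonneg _))
      _ = N * K := by rw [hK]; ring
  have hlim := tendsto_const_div_atTop_nhds_zero_nat K
  exact sub_nonpos.1 (ge_of_tendsto hlim ((eventually_gt_atTop 0).mono hdiff))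

end Box

/-! ### Escaping from finite sets -/

/-- The event that the origin is connected to a vertex outside the finite set `s`. -/
def escape (L : PlanarLattice) (s : Finset L.V) : Set L.Config :=
  {ω | ∃ y, y ∉ s ∧ (L.subgraphOf {e | ω e = true}).Reachable L.origin y}

theorem escape_antitone : Antitone L.escape := fun _ _ h _ ⟨y, hy, hr⟩ =>
  ⟨y, fun hys => hy (h hys), hr⟩

theorem isUpperSet_escape (s : Finset L.V) : IsUpperSet (L.escape s) := by
  rintro ω ω' h ⟨y, hy, hr⟩
  exact ⟨y, hy, hr.mono (subgraphOf_mono fun e he => isUpperSet_edge_open e h he)⟩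

/-- The first step of a path leaving `s` is along an edge with an end-point in `s`. -/
theorem exists_reachable_notMem {s : Finset L.V} {ω ω' : L.Config}
    (h : ∀ e : L.Edge, (∃ x ∈ s, x ∈ (e : Sym2 L.V)) → ω e = ω' e) {x y : L.V} (hx : x ∈ s)
    (hy : y ∉ s) (hr : (L.subgraphOf {e | ω e = true}).Reachable x y) :
    ∃ z, z ∉ s ∧ (L.subgraphOf {e | ω' e = true}).Reachable x z := by
  obtain ⟨w⟩ := hr
  induction w with
  | nil => exact absurd hx hy
  | @cons x z y hadj _ ih =>
    obtain ⟨e, he, hxz⟩ := subgraphOf_adj.1 hadj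
    have hagree : ω e = ω' e := h e ⟨x, hx, hxz ▸ Sym2.mem_mk_left _ _⟩
    have hadj' : (L.subgraphOf {e | ω' e = true}).Adj x z :=
      subgraphOf_adj.2 ⟨e, hagree.symm.trans he, hxz⟩
    by_cases hz : z ∈ s
    · obtain ⟨t, ht, hr⟩ := ih hz hy
      exact ⟨t, ht, hadj'.reachable.trans hr⟩
    · exact ⟨z, hz, hadj'.reachable⟩

theorem isLocal_escape {s : Finset L.V} (hs : L.origin ∈ s) :
    ∃ F : Finset L.Edge, IsLocal F (L.escape s) := by
  refine ⟨(finite_edges_of_finite s.finite_toSet).toFinset, fun ω ω' h ⟨y, hy, hr⟩ => ?_⟩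
  exact exists_reachable_notMem (fun e he => h e ((Set.Finite.mem_toFinset _).2 he)) hs hy hr

theorem setOf_connectedToInfinity_eq_iInter :
    {ω : L.Config | ConnectedToInfinity ω L.origin} =
      ⋂ s : Finset L.V, L.escape (insert L.origin s) := by
  ext ω
  rw [mem_iInter]
  constructor
  · intro h s
    obtain ⟨y, hy, hys⟩ := h.exists_notMem_finset (insert L.origin s)
    exact ⟨y, hys, hy⟩
  · intro h hfin
    obtain ⟨y, hy, hr⟩ := h hfin.toFinset
    exact hy (Finset.mem_insert_of_mem (hfin.mem_toFinset.2 hr))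

theorem ofReal_le_connectedToInfinity {φ : Measure L.Config} [IsProbabilityMeasure φ] {c : ℝ}
    (h : ∀ s : Finset L.V, L.origin ∈ s → c ≤ φ.real (L.escape s)) :
    ENNReal.ofReal c ≤ φ {ω | ConnectedToInfinity ω L.origin} := by
  classical
  rw [setOf_connectedToInfinity_eq_iInter, Antitone.measure_iInter]
  · refine le_iInf fun s => ?_
    rw [← ofReal_measureReal (μ := φ)]
    exact ENNReal.ofReal_le_ofReal (h _ (Finset.mem_insert_self _ _))
  · exact fun s t hst => escape_antitone (Finset.insert_subset_insert _ hst)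
  · intro s
    obtain ⟨F, hF⟩ := isLocal_escape (Finset.mem_insert_self L.origin s)
    exact hF.measurableSet.nullMeasurableSet
  · exact ⟨∅, measure_ne_top _ _⟩

theorem mem_escape_of_connectedToInfinity (σ : L.graph ≃g L.graph) {ω : L.Config}
    (h : ConnectedToInfinity ω (σ L.origin)) (s : Finset L.V) : pull σ ω ∈ L.escape s := by
  obtain ⟨y, hy, hys⟩ := h.exists_notMem_finset (s.map σ.toEquiv.toEmbedding)
  obtain ⟨z, rfl⟩ := σ.surjective y
  exact ⟨z, fun hz => hys (Finset.mem_map_of_mem _ hz), (reachable_pull_iff σ).2 hy⟩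

theorem bddBelow_criticalPoint (L : PlanarLattice) (q : ℝ) :
    BddBelow (insert 1 {p : ℝ | p ∈ Ioo (0 : ℝ) 1 ∧ ∃ φ : Measure L.Config,
      IsFreeMeasure p q φ ∧ 0 < φ {ω | ConnectedToInfinity ω L.origin}}) :=
  BddBelow.insert 1 ⟨0, fun _ hx => hx.1.1.le⟩

theorem criticalPoint_le_of_connectedToInfinity (hp : p ∈ Ioo (0 : ℝ) 1) (hq : 1 ≤ q)
    {φ : Measure L.Config} (hφ : IsRandomClusterMeasure p q φ) {u v : ℂ}
    (h : LinearIndependent ℝ ![u, v]) (hu : L.IsPeriod u) (hv : L.IsPeriod v) {c : ℝ} (hc0 : 0 < c)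
    (hc : ∀ m n : ℤ, c ≤ φ.real
      {ω | ConnectedToInfinity ω ((hu.lattice hv m n).iso L.origin)}) :
    L.criticalPoint q ≤ p := by
  have := hφ.isProbabilityMeasure
  refine le_of_forall_gt_imp_ge_of_dense fun p' hpp => ?_
  rcases le_or_gt 1 p' with hp1 | hp1
  · exact (csInf_le (bddBelow_criticalPoint L q) (mem_insert _ _)).trans hp1
  have hp' : p' ∈ Ioo (0 : ℝ) 1 := ⟨hp.1.trans hpp, hp1⟩
  obtain ⟨φ', hφ'⟩ := exists_isFreeMeasure (L := L) hp' hq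
  have := hφ'.isProbabilityMeasure
  have hescape (s : Finset L.V) (hs : L.origin ∈ s) : c ≤ φ'.real (L.escape s) := by
    obtain ⟨F, hF⟩ := isLocal_escape hs
    refine le_real_of_isFreeMeasure hp hp' hpp hq hφ hφ' h hu hv hF (isUpperSet_escape s)
      fun m n => (hc m n).trans (measureReal_mono fun ω hω => ?_)
    exact mem_escape_of_connectedToInfinity _ hω s
  exact csInf_le (bddBelow_criticalPoint L q) (mem_insert_of_mem _
    ⟨hp', φ', hφ', (ENNReal.ofReal_pos.2 hc0).trans_le (ofReal_le_connectedToInfinity hescape)⟩)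

end PlanarLattice

/-! ### Plane topology -/

theorem exists_continuous_lift_addCircle {c : ℝ} {X : Type*} [TopologicalSpace X]
    [SimplyConnectedSpace X] [LocallyPathConnectedSpace X] {g : X → AddCircle c} (hg : Continuous g)
    {x : X} {t : ℝ} (ht : (t : AddCircle c) = g x) :
    ∃ G : X → ℝ, Continuous G ∧ G x = t ∧ ∀ y, (G y : AddCircle c) = g y := by
  obtain ⟨G, ⟨hGx, hG⟩, -⟩ :=
    (AddCircle.isCoveringMap_coe c).existsUnique_continuousMap_lifts ⟨g, hg⟩ x t ht
  exact ⟨G, G.continuous, hGx, congrFun hG⟩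

/-- `G` lifts the function that is `H` modulo `ℤ` on `X₁` and `0` on `X₂`; the lift exists because
the plane is simply connected. -/
theorem exists_continuous_integer_gluing {X₁ X₂ : Set ℂ} (h₁ : IsClosed X₁) (h₂ : IsClosed X₂)
    (hX : X₁ ∪ X₂ = univ) {H : ℂ → ℝ} (hH : Continuous H)
    (hint : ∀ z ∈ X₁ ∩ X₂, ∃ k : ℤ, H z = k) :
    ∃ G : ℂ → ℝ, Continuous G ∧ (∀ z ∈ X₁, ∃ k : ℤ, G z - H z = k) ∧
      ∀ z ∈ X₂, ∃ k : ℤ, G z = k := by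
  classical
  have coe_eq_zero_iff (x : ℝ) : (x : AddCircle (1 : ℝ)) = 0 ↔ ∃ k : ℤ, x = k := by
    rw [AddCircle.coe_eq_zero_iff]
    simp only [zsmul_one, eq_comm]
  set g : ℂ → AddCircle (1 : ℝ) := fun z => if z ∈ X₁ then (H z : AddCircle (1 : ℝ)) else 0
  have g_of_mem : ∀ z ∈ X₁, g z = (H z : AddCircle (1 : ℝ)) := fun z hz => if_pos hz
  have g_eq_zero : ∀ z ∈ X₂, g z = 0 := by
    intro z hz
    by_cases hz₁ : z ∈ X₁
    · rw [g_of_mem z hz₁, coe_eq_zero_iff]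
      exact hint z ⟨hz₁, hz⟩
    · exact if_neg hz₁
  have hg : Continuous g := by
    rw [← continuousOn_univ, ← hX]
    exact ContinuousOn.union_of_isClosed
      (((AddCircle.continuous_mk' 1).comp hH).continuousOn.congr g_of_mem)
      (continuousOn_const.congr g_eq_zero) h₁ h₂
  obtain ⟨t, ht⟩ := QuotientAddGroup.mk_surjective (g 0)
  obtain ⟨G, hG, -, hGg⟩ := exists_continuous_lift_addCircle hg ht
  refine ⟨G, hG, fun z hz => ?_, fun z hz => ?_⟩
  · rw [← coe_eq_zero_iff, AddCircle.coe_sub, hGg, g_of_mem z hz, sub_self]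
  · rw [← coe_eq_zero_iff, hGg, g_eq_zero z hz]

theorem exists_continuous_angle {X : Type*} [TopologicalSpace X] [SimplyConnectedSpace X]
    [LocallyPathConnectedSpace X] {f : X → ℂ} (hf : Continuous f) (hf₀ : ∀ x, f x ≠ 0) (x : X) :
    ∃ Θ : X → ℝ, Continuous Θ ∧ Θ x = Complex.arg (f x) ∧
      (∀ y, Real.cos (Θ y) = (f y).re / ‖f y‖) ∧ ∀ y, Real.sin (Θ y) = (f y).im / ‖f y‖ := by
  have continuous_arg : Continuous fun y => (Complex.arg (f y) : Real.Angle) :=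
    continuous_iff_continuousAt.2 fun y =>
      (Complex.continuousAt_arg_coe_angle (hf₀ y)).comp hf.continuousAt
  obtain ⟨Θ, hΘ, hΘx, hΘarg⟩ := exists_continuous_lift_addCircle continuous_arg rfl (x := x)
  have coe_eq (y : X) : ((Θ y : ℝ) : Real.Angle) = (Complex.arg (f y) : Real.Angle) := hΘarg y
  refine ⟨Θ, hΘ, hΘx, fun y => ?_, fun y => ?_⟩
  · rw [← Complex.cos_arg (hf₀ y), ← Real.Angle.cos_coe, coe_eq, Real.Angle.cos_coe]
  · rw [← Complex.sin_arg, ← Real.Angle.sin_coe, coe_eq, Real.Angle.sin_coe]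

theorem mem_Ioo_zero_pi_of_sin_pos {x : ℝ} (hx : x ∈ Ioc (-Real.pi) Real.pi)
    (hsin : 0 < Real.sin x) : x ∈ Ioo 0 Real.pi := by
  refine ⟨?_, hx.2.lt_of_ne fun h => ?_⟩
  · by_contra! hle
    exact hsin.not_ge (Real.sin_nonpos_of_nonpos_of_neg_pi_le hle hx.1.le)
  · rw [h, Real.sin_pi] at hsin
    exact hsin.false

theorem mem_Ioo_zero_pi_of_forall_sin_pos {X : Type*} [TopologicalSpace X] [PreconnectedSpace X]
    {g : X → ℝ} (hg : Continuous g) (hsin : ∀ x, 0 < Real.sin (g x)) {x₀ : X}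
    (hx₀ : g x₀ ∈ Ioc (-Real.pi) Real.pi) (x : X) : g x ∈ Ioo 0 Real.pi := by
  have mem_x₀ := mem_Ioo_zero_pi_of_sin_pos hx₀ (hsin x₀)
  constructor
  · by_contra! hle
    obtain ⟨y, hy⟩ := mem_range_of_exists_le_of_exists_ge hg ⟨x, hle⟩ ⟨x₀, mem_x₀.1.le⟩
    exact (hsin y).ne' (by rw [hy, Real.sin_zero])
  · by_contra! hle
    obtain ⟨y, hy⟩ := mem_range_of_exists_le_of_exists_ge hg ⟨x₀, mem_x₀.2.le⟩ ⟨x, hle⟩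
    exact (hsin y).ne' (by rw [hy, Real.sin_pi])

/-- The angle of `f` would increase by a quarter turn along each side of the unit square. -/
theorem exists_eq_zero_of_boundary_signs {f : ℝ × ℝ → ℂ} (hf : Continuous f)
    (left : ∀ t, 0 < (f (0, t)).im) (top : ∀ s, (f (s, 1)).re < 0)
    (right : ∀ t, (f (1, t)).im < 0) (bottom : ∀ s, 0 < (f (s, 0)).re) : ∃ z, f z = 0 := by
  by_contra! hf₀
  obtain ⟨Θ, hΘ, hΘ₀, hcos, hsin⟩ := exists_continuous_angle hf hf₀ (0, 0)
  have norm_pos (z) : 0 < ‖f z‖ := norm_pos_iff.2 (hf₀ z)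
  have angle_left (t : ℝ) : Θ (0, t) ∈ Ioo 0 Real.pi := by
    refine mem_Ioo_zero_pi_of_forall_sin_pos (g := fun t => Θ (0, t)) (by fun_prop) (fun t => ?_)
      (x₀ := 0) (hΘ₀ ▸ Complex.arg_mem_Ioc _) t
    rw [hsin]
    exact div_pos (left t) (norm_pos _)
  have angle_top (s : ℝ) : Θ (s, 1) - Real.pi / 2 ∈ Ioo 0 Real.pi := by
    refine mem_Ioo_zero_pi_of_forall_sin_pos (g := fun s => Θ (s, 1) - Real.pi / 2) (by fun_prop)
      (fun s => ?_) (x₀ := 0) ?_ s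
    · rw [Real.sin_sub_pi_div_two, hcos]
      exact neg_pos.2 (div_neg_of_neg_of_pos (top s) (norm_pos _))
    · constructor <;> linarith [(angle_left 1).1, (angle_left 1).2]
  have angle_right (t : ℝ) : Θ (1, t) - Real.pi ∈ Ioo 0 Real.pi := by
    refine mem_Ioo_zero_pi_of_forall_sin_pos (g := fun t => Θ (1, t) - Real.pi) (by fun_prop)
      (fun t => ?_) (x₀ := 1) ?_ t
    · rw [Real.sin_sub_pi, hsin]
      exact neg_pos.2 (div_neg_of_neg_of_pos (right t) (norm_pos _))
    · constructor <;> linarith [(angle_top 1).1, (angle_top 1).2]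
  have angle_bottom (s : ℝ) : Θ (s, 0) - Real.pi - Real.pi / 2 ∈ Ioo 0 Real.pi := by
    refine mem_Ioo_zero_pi_of_forall_sin_pos (g := fun s => Θ (s, 0) - Real.pi - Real.pi / 2)
      (by fun_prop) (fun s => ?_) (x₀ := 1) ?_ s
    · rw [Real.sin_sub_pi_div_two, Real.cos_sub_pi, neg_neg, hcos]
      exact div_pos (bottom s) (norm_pos _)
    · constructor <;> linarith [(angle_right 0).1, (angle_right 0).2]
  linarith [(angle_left 0).2, (angle_bottom 0).1, Real.pi_pos]

/-- Two paths that cross a parallelogram in the two directions meet: otherwise the difference of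
their positions would be a nonvanishing map of the square to which the previous lemma applies. -/
theorem not_disjoint_of_crossing {a b : ℂ →L[ℝ] ℝ} (hab : ∀ z, a z = 0 → b z = 0 → z = 0)
    {A B : Set ℂ} {z w z' w' : ℂ} (hA : JoinedIn A z w) (hB : JoinedIn B z' w')
    (b_lt : ∀ y ∈ B, b y < b z) (lt_b : ∀ y ∈ B, b w < b y)
    (lt_a : ∀ x ∈ A ∩ range hA.somePath, a z' < a x)
    (a_lt : ∀ x ∈ A ∩ range hA.somePath, a x < a w') : ¬Disjoint A B := by
  set P := hA.somePath.extend
  set Q := hB.somePath.extend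
  have mem_A (s : ℝ) : P s ∈ A ∩ range hA.somePath := by
    obtain ⟨t, ht⟩ : P s ∈ range hA.somePath := by
      rw [← Path.extend_range]
      exact mem_range_self s
    exact ⟨ht ▸ hA.somePath_mem t, t, ht⟩
  have mem_B (s : ℝ) : Q s ∈ B := by
    obtain ⟨t, ht⟩ : Q s ∈ range hB.somePath := by
      rw [← Path.extend_range]
      exact mem_range_self s
    exact ht ▸ hB.somePath_mem t
  have P_zero : P 0 = z := Path.extend_zero _
  have P_one : P 1 = w := Path.extend_one _
  have Q_zero : Q 0 = z' := Path.extend_zero _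
  have Q_one : Q 1 = w' := Path.extend_one _
  have hP : Continuous P := Path.continuous_extend _
  have hQ : Continuous Q := Path.continuous_extend _
  obtain ⟨x, hx⟩ := exists_eq_zero_of_boundary_signs
    (f := fun x => ⟨a (P x.1 - Q x.2), b (P x.1 - Q x.2)⟩)
    (Complex.equivRealProdCLM.symm.continuous.comp
      (f := fun x : ℝ × ℝ => (a (P x.1 - Q x.2), b (P x.1 - Q x.2))) (by fun_prop))
    (fun t => by simpa only [P_zero, map_sub, sub_pos] using b_lt _ (mem_B t))
    (fun s => by simpa only [Q_one, map_sub, sub_neg] using a_lt _ (mem_A s))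
    (fun t => by simpa only [P_one, map_sub, sub_neg] using lt_b _ (mem_B t))
    (fun s => by simpa only [Q_zero, map_sub, sub_pos] using lt_a _ (mem_A s))
  obtain ⟨ha, hb⟩ := Complex.ext_iff.1 hx
  have P_eq_Q : P x.1 = Q x.2 := sub_eq_zero.1 (hab _ ha hb)
  exact not_disjoint_iff.2 ⟨P x.1, (mem_A x.1).1, P_eq_Q ▸ mem_B x.2⟩

theorem isPreconnected_setOf_lt_norm {R : ℝ} (hR : 0 ≤ R) : IsPreconnected {z : ℂ | R < ‖z‖} := by
  have eq_image_polar : {z : ℂ | R < ‖z‖} =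
      (fun x : ℝ × ℝ => (x.1 : ℂ) * Complex.exp (x.2 * Complex.I)) '' (Ioi R ×ˢ univ) := by
    ext z
    constructor
    · intro hz
      exact ⟨(‖z‖, Complex.arg z), ⟨hz, mem_univ _⟩, Complex.norm_mul_exp_arg_mul_I z⟩
    · rintro ⟨x, ⟨hx, -⟩, rfl⟩
      rw [mem_ofPred_eq, norm_mul, Complex.norm_exp_ofReal_mul_I, mul_one,
        Complex.norm_of_nonneg (hR.trans_lt hx).le]
      exact hx
  rw [eq_image_polar]
  exact (isPreconnected_Ioi.prod isPreconnected_univ).image _ (by fun_prop)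

theorem eq_of_isPreconnected_of_integer_valued {X : Type*} [TopologicalSpace X] {s : Set X}
    (hs : IsPreconnected s) {f : X → ℝ} (hf : ContinuousOn f s)
    (hint : ∀ x ∈ s, ∃ k : ℤ, f x = k) {x y : X} (hx : x ∈ s) (hy : y ∈ s) : f x = f y := by
  have : DiscreteTopology (range ((↑) : ℤ → ℝ)) :=
    Int.isClosedEmbedding_coe_real.isEmbedding.toHomeomorph.discreteTopology_iff.1 inferInstance
  refine hs.constant_of_mapsTo (isDiscrete_iff_discreteTopology.2 this) hf (fun z hz => ?_) hx hy
  obtain ⟨k, hk⟩ := hint z hz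
  exact ⟨k, hk.symm⟩

namespace PlanarLattice

variable {L : PlanarLattice}

/-! ### The drawing of the lattice -/

theorem exists_endpoints (e : L.Edge) : ∃ x y : L.V, (e : Sym2 L.V) = s(x, y) ∧ x ≠ y ∧
    edgeSegment (e : Sym2 L.V) = segment ℝ (x : ℂ) y := by
  obtain ⟨e, he⟩ := e
  induction e using Sym2.ind with | _ x y => ?_
  exact ⟨x, y, rfl, (L.graph.mem_edgeSet.1 he).ne, rfl⟩

theorem exists_isPeriod (L : PlanarLattice) :
    ∃ u v : ℂ, LinearIndependent ℝ ![u, v] ∧ L.IsPeriod u ∧ L.IsPeriod v := L.periodic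

theorem exists_edge_at (x : L.V) : ∃ e : L.Edge, x ∈ (e : Sym2 L.V) := by
  obtain ⟨u, v, h, hu, -⟩ := L.exists_isPeriod
  have ne_iso : x ≠ hu.iso x := by
    intro heq
    have coe_eq := congrArg Subtype.val heq
    rw [hu.coe_iso, left_eq_add] at coe_eq
    exact h.ne_zero 0 coe_eq
  obtain ⟨w⟩ := L.connected.preconnected x (hu.iso x)
  generalize hu.iso x = y at ne_iso w
  cases w with
  | nil => exact absurd rfl ne_iso
  | cons hadj _ => exact ⟨⟨s(x, _), hadj⟩, Sym2.mem_mk_left _ _⟩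

theorem coe_mem_edgeSegment {e : L.Edge} {x : L.V} (h : x ∈ (e : Sym2 L.V)) :
    (x : ℂ) ∈ edgeSegment (e : Sym2 L.V) := by
  obtain ⟨a, b, hab, -, hs⟩ := exists_endpoints e
  rw [hs]
  rw [hab] at h
  rcases Sym2.mem_iff.1 h with rfl | rfl
  · exact left_mem_segment ℝ _ _
  · exact right_mem_segment ℝ _ _

theorem mem_of_mem_edgeSegment_inter {e f : L.Edge} (hne : e ≠ f) {z : ℂ}
    (he : z ∈ edgeSegment (e : Sym2 L.V)) (hf : z ∈ edgeSegment (f : Sym2 L.V)) :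
    ∃ x : L.V, (x : ℂ) = z ∧ x ∈ (e : Sym2 L.V) ∧ x ∈ (f : Sym2 L.V) :=
  L.planar e e.2 f f.2 (fun h => hne (Subtype.ext h)) z ⟨he, hf⟩

theorem mem_of_coe_mem_edgeSegment {e : L.Edge} {x : L.V}
    (h : (x : ℂ) ∈ edgeSegment (e : Sym2 L.V)) : x ∈ (e : Sym2 L.V) := by
  obtain ⟨f, hf⟩ := exists_edge_at x
  by_cases hne : e = f
  · rwa [hne]
  · obtain ⟨y, hy, hye, -⟩ := mem_of_mem_edgeSegment_inter hne h (coe_mem_edgeSegment hf)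
    rwa [← Subtype.ext hy]

theorem isCompact_edgeSegment (e : L.Edge) : IsCompact (edgeSegment (e : Sym2 L.V)) := by
  obtain ⟨x, y, -, -, hs⟩ := exists_endpoints e
  rw [hs, segment_eq_image]
  exact isCompact_Icc.image (by fun_prop)

theorem isPreconnected_edgeSegment (e : L.Edge) :
    IsPreconnected (edgeSegment (e : Sym2 L.V)) := by
  obtain ⟨x, y, -, -, hs⟩ := exists_endpoints e
  rw [hs]
  exact (convex_segment _ _).isPreconnected

theorem exists_edge_length_le (L : PlanarLattice) : ∃ ℓ : ℝ, ∀ (e : L.Edge),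
    ∀ z ∈ edgeSegment (e : Sym2 L.V), ∀ w ∈ edgeSegment (e : Sym2 L.V), dist z w ≤ ℓ := by
  obtain ⟨u, v, h, hu, hv⟩ := L.exists_isPeriod
  have finite_near := finite_edges_of_finite (finite_vertices_norm_le L (‖u‖ + ‖v‖))
  obtain ⟨ℓ, hℓ⟩ :=
    (finite_near.image fun e : L.Edge => Metric.diam (edgeSegment (e : Sym2 L.V))).bddAbove
  refine ⟨ℓ, fun e => ?_⟩
  obtain ⟨x, y, hxy, -⟩ := exists_endpoints e
  obtain ⟨w, m, n, hw, hx⟩ := exists_vertex_near h hu hv x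
  set τ := hu.lattice hv m n
  obtain ⟨f, rfl⟩ := τ.iso.mapEdgeSet.surjective e
  have w_mem_f : w ∈ (f : Sym2 L.V) := by
    rw [← mem_mapEdgeSet_iff τ.iso, hx, hxy]
    exact Sym2.mem_mk_left _ _
  rw [τ.edgeSegment]
  rintro _ ⟨z, hz, rfl⟩ _ ⟨z', hz', rfl⟩
  rw [dist_add_right]
  exact (Metric.dist_le_diam_of_mem (isCompact_edgeSegment f).isBounded hz hz').trans
    (hℓ (mem_image_of_mem _ ⟨w, hw, w_mem_f⟩))

theorem finite_edges_meeting_ball (L : PlanarLattice) (r : ℝ) :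
    {e : L.Edge | (edgeSegment (e : Sym2 L.V) ∩ Metric.closedBall 0 r).Nonempty}.Finite := by
  obtain ⟨ℓ, hℓ⟩ := L.exists_edge_length_le
  refine (finite_edges_of_finite (finite_vertices_norm_le L (ℓ + r))).subset ?_
  rintro e ⟨z, hz, hzr⟩
  obtain ⟨x, y, hxy, -⟩ := exists_endpoints e
  have hx : x ∈ (e : Sym2 L.V) := hxy ▸ Sym2.mem_mk_left _ _
  refine ⟨x, ?_, hx⟩
  calc ‖(x : ℂ)‖ = dist (x : ℂ) 0 := (dist_zero_right _).symm
    _ ≤ dist (x : ℂ) z + dist z 0 := dist_triangle _ _ _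
    _ ≤ ℓ + r := add_le_add (hℓ e _ (coe_mem_edgeSegment hx) z hz) hzr

theorem locallyFinite_edgeSegment (L : PlanarLattice) :
    LocallyFinite fun e : L.Edge => edgeSegment (e : Sym2 L.V) := by
  refine fun z => ⟨Metric.ball z 1, Metric.ball_mem_nhds z one_pos,
    (L.finite_edges_meeting_ball (1 + dist z 0)).subset ?_⟩
  rintro e ⟨w, hw, hwz⟩
  refine ⟨w, hw, Metric.mem_closedBall.2 ?_⟩
  exact (dist_triangle w z 0).trans (add_le_add_left (Metric.mem_ball.1 hwz).le _)

theorem drawing_eq (L : PlanarLattice) :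
    L.drawing = ⋃ e : L.Edge, edgeSegment (e : Sym2 L.V) := by
  ext z
  simp only [drawing, mem_union, mem_iUnion]
  constructor
  · rintro (hz | ⟨e, he, hz⟩)
    · obtain ⟨e, he⟩ := exists_edge_at (⟨z, hz⟩ : L.V)
      exact ⟨e, coe_mem_edgeSegment he⟩
    · exact ⟨⟨e, he⟩, hz⟩
  · rintro ⟨e, hz⟩
    exact Or.inr ⟨e, e.2, hz⟩

theorem edgeSegment_subset_drawing (e : L.Edge) : edgeSegment (e : Sym2 L.V) ⊆ L.drawing := by
  rw [drawing_eq]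
  exact subset_iUnion (fun e : L.Edge => edgeSegment (e : Sym2 L.V)) e

theorem isClosed_iUnion_edgeSegment (s : Set L.Edge) :
    IsClosed (⋃ e ∈ s, edgeSegment (e : Sym2 L.V)) := by
  rw [biUnion_eq_iUnion]
  exact (L.locallyFinite_edgeSegment.comp_injective Subtype.val_injective).isClosed_iUnion
    fun e => (isCompact_edgeSegment e.1).isClosed

theorem isClosed_drawing (L : PlanarLattice) : IsClosed L.drawing := by
  rw [drawing_eq]
  exact L.locallyFinite_edgeSegment.isClosed_iUnion fun e => (isCompact_edgeSegment e).isClosed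

theorem eventually_mem_segment_iff {x y z : ℂ} (hxy : x ≠ y) (hz : z ∈ openSegment ℝ x y) :
    ∃ ℓ : ℂ →L[ℝ] ℝ, ℓ ≠ 0 ∧ ∀ᶠ w in 𝓝 z, w ∈ segment ℝ x y ↔ ℓ w = ℓ z := by
  have hinv : (y - x)⁻¹ * (y - x) = 1 := inv_mul_cancel₀ (sub_ne_zero.2 hxy.symm)
  set c := (y - x)⁻¹
  have c_mul (t : ℝ) : c * (x + t • (y - x)) = c * x + t := by
    rw [Complex.real_smul]
    linear_combination (t : ℂ) * hinv
  set ℓ : ℂ →L[ℝ] ℝ := Complex.imCLM ∘L ContinuousLinearMap.mul ℝ ℂ c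
  have ℓ_line (t : ℝ) : ℓ (x + t • (y - x)) = ℓ x := by
    change (c * _).im = (c * x).im
    rw [c_mul, Complex.add_im, Complex.ofReal_im, add_zero]
  rw [openSegment_eq_image'] at hz
  obtain ⟨t, ht, rfl⟩ := hz
  refine ⟨ℓ, fun h => ?_, ?_⟩
  · have ℓ_normal : ℓ (Complex.I * (y - x)) = 1 := by
      change (c * (Complex.I * (y - x))).im = 1
      rw [mul_left_comm, hinv, mul_one, Complex.I_im]
    rw [h] at ℓ_normal
    exact zero_ne_one ℓ_normal
  have re_mem : (c * (x + t • (y - x)) - c * x).re ∈ Ioo (0 : ℝ) 1 := by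
    rwa [c_mul, add_sub_cancel_left, Complex.ofReal_re]
  have re_continuous : Continuous fun w => (c * w - c * x).re := by fun_prop
  filter_upwards [re_continuous.continuousAt.preimage_mem_nhds (isOpen_Ioo.mem_nhds re_mem)]
    with w hw
  rw [ℓ_line, segment_eq_image']
  constructor
  · rintro ⟨s, -, rfl⟩
    exact ℓ_line s
  · intro hℓ
    refine ⟨(c * w - c * x).re, Ioo_subset_Icc_self hw, ?_⟩
    have real : (((c * w - c * x).re : ℝ) : ℂ) = c * w - c * x :=
      Complex.ext rfl (by rw [Complex.ofReal_im, Complex.sub_im]; exact (sub_eq_zero.2 hℓ).symm)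
    simp only [Complex.real_smul, real]
    linear_combination (w - x) * hinv

theorem eventually_mem_drawing_iff {e : L.Edge} {x y : L.V} (hxy : (e : Sym2 L.V) = s(x, y))
    {z : ℂ} (hz : z ∈ openSegment ℝ (x : ℂ) y) :
    ∀ᶠ w in 𝓝 z, w ∈ L.drawing ↔ w ∈ edgeSegment (e : Sym2 L.V) := by
  set D : Set ℂ := ⋃ f ∈ {f : L.Edge | f ≠ e}, edgeSegment (f : Sym2 L.V) with hD
  have edgeSegment_eq : edgeSegment (e : Sym2 L.V) = segment ℝ (x : ℂ) y := by rw [hxy]; rfl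
  have x_ne_y : (x : ℂ) ≠ y := fun h =>
    (L.graph.mem_edgeSet.1 (hxy ▸ e.2)).ne (Subtype.ext h)
  have hzD : z ∉ D := by
    simp only [hD, mem_iUnion]
    rintro ⟨f, hf, hzf⟩
    obtain ⟨w, rfl, hwe, -⟩ := mem_of_mem_edgeSegment_inter (Ne.symm hf)
      (edgeSegment_eq ▸ openSegment_subset_segment ℝ _ _ hz) hzf
    rw [hxy] at hwe
    rcases Sym2.mem_iff.1 hwe with rfl | rfl
    · exact x_ne_y (left_mem_openSegment_iff.1 hz)
    · exact x_ne_y (right_mem_openSegment_iff.1 hz)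
  filter_upwards [(isClosed_iUnion_edgeSegment _).isOpen_compl.mem_nhds hzD] with w hw
  refine ⟨fun hwd => ?_, fun h => edgeSegment_subset_drawing e h⟩
  rw [drawing_eq, mem_iUnion] at hwd
  obtain ⟨f, hf⟩ := hwd
  by_cases hfe : f = e
  · rwa [← hfe]
  · exact absurd (mem_biUnion (t := fun f : L.Edge => edgeSegment (f : Sym2 L.V)) hfe hf) hw

/-! ### Faces -/

theorem Face.eq_of_mem {F F' : L.Face} {z : ℂ} (h : z ∈ F.1) (h' : z ∈ F'.1) : F = F' := by
  obtain ⟨F, a, ha, rfl⟩ := F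
  obtain ⟨F', b, hb, rfl⟩ := F'
  exact Subtype.ext ((connectedComponentIn_eq h).trans (connectedComponentIn_eq h').symm)

theorem Face.notMem_drawing {F : L.Face} {z : ℂ} (h : z ∈ F.1) : z ∉ L.drawing := by
  obtain ⟨F, a, ha, rfl⟩ := F
  exact connectedComponentIn_subset _ _ h

theorem Face.isOpen (F : L.Face) : IsOpen F.1 := by
  obtain ⟨F, a, ha, rfl⟩ := F
  exact L.isClosed_drawing.isOpen_compl.connectedComponentIn

theorem Face.isConnected (F : L.Face) : IsConnected F.1 := by
  obtain ⟨F, a, ha, rfl⟩ := F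
  exact isConnected_connectedComponentIn_iff.2 ha

theorem Face.frontier_eq (F : L.Face) : frontier F.1 = closure F.1 \ F.1 := F.isOpen.frontier_eq

theorem Face.subset_of_isPreconnected {F : L.Face} {s : Set ℂ} (hs : IsPreconnected s)
    (hd : ∀ w ∈ s, w ∉ L.drawing) {z : ℂ} (hz : z ∈ s) (hzF : z ∈ F.1) : s ⊆ F.1 := by
  obtain ⟨F, a, ha, rfl⟩ := F
  exact (hs.subset_connectedComponentIn hz hd).trans (connectedComponentIn_eq hzF).ge

theorem exists_face_mem {z : ℂ} (hz : z ∉ L.drawing) : ∃ F : L.Face, z ∈ F.1 :=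
  ⟨⟨connectedComponentIn L.drawingᶜ z, z, hz, rfl⟩, mem_connectedComponentIn hz⟩

theorem mem_closure_inter_setOf_lt {E : Type*} [NormedAddCommGroup E] [NormedSpace ℝ E]
    {ℓ : E →L[ℝ] ℝ} (hℓ : ℓ ≠ 0) {U : Set E} (hU : IsOpen U) {w : E} (hw : w ∈ U) :
    w ∈ closure (U ∩ {x | ℓ w < ℓ x}) := by
  obtain ⟨v, hv⟩ : ∃ v, ℓ v = 1 := LinearMap.surjective (f := ℓ.toLinearMap)
    (fun h => hℓ (ContinuousLinearMap.coe_injective h)) 1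
  have hcont : Continuous fun t : ℝ => w + t • v := by fun_prop
  have htendsto : Tendsto (fun t : ℝ => w + t • v) (𝓝[>] 0) (𝓝 w) := by
    simpa only [zero_smul, add_zero] using (hcont.tendsto 0).mono_left nhdsWithin_le_nhds
  refine mem_closure_of_tendsto htendsto ?_
  filter_upwards [htendsto (hU.mem_nhds hw), self_mem_nhdsWithin] with t htU ht
  refine ⟨htU, ?_⟩
  simpa only [mem_ofPred_eq, map_add, map_smul, hv, smul_eq_mul, mul_one, lt_add_iff_pos_right]
    using mem_Ioi.1 ht

/-- Near a relative interior point of an edge, the drawing is a line; the complement of the line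
in a disc consists of two half-discs, each of which has the edge on its boundary. -/
theorem exists_isOpen_inter_edgeSegment_subset_closure {e : L.Edge} {x y : L.V}
    (hxy : (e : Sym2 L.V) = s(x, y)) {z : ℂ} (hz : z ∈ openSegment ℝ (x : ℂ) y) :
    ∃ U : Set ℂ, IsOpen U ∧ z ∈ U ∧ (∃ F : L.Face, (F.1 ∩ U).Nonempty) ∧
      ∀ F : L.Face, (F.1 ∩ U).Nonempty →
        U ∩ edgeSegment (e : Sym2 L.V) ⊆ closure F.1 := by
  have x_ne_y : (x : ℂ) ≠ y := fun h =>
    (L.graph.mem_edgeSet.1 (hxy ▸ e.2)).ne (Subtype.ext h)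
  obtain ⟨ℓ, hℓ, mem_segment_iff⟩ := eventually_mem_segment_iff x_ne_y hz
  obtain ⟨r, hr, hball⟩ := Metric.eventually_nhds_iff_ball.1
    (mem_segment_iff.and (eventually_mem_drawing_iff hxy hz))
  have mem_drawing_iff : ∀ w ∈ Metric.ball z r, w ∈ L.drawing ↔ ℓ w = ℓ z := fun w hw => by
    rw [(hball w hw).2, hxy]
    exact (hball w hw).1
  have closure_of_half_disc {ℓ' : ℂ →L[ℝ] ℝ} (hℓ' : ℓ' ≠ 0)
      (mem_iff : ∀ w ∈ Metric.ball z r, w ∈ L.drawing ↔ ℓ' w = ℓ' z) {F : L.Face} {t : ℂ}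
      (htF : t ∈ F.1) (ht : t ∈ Metric.ball z r) (hlt : ℓ' z < ℓ' t) :
      Metric.ball z r ∩ edgeSegment (e : Sym2 L.V) ⊆ closure F.1 := by
    rintro w ⟨hw, hwe⟩
    rw [mem_iff w hw |>.1 (edgeSegment_subset_drawing e hwe) |>.symm] at hlt
    refine closure_mono (Face.subset_of_isPreconnected
      (s := Metric.ball z r ∩ {s | ℓ' w < ℓ' s}) ?_ ?_ ⟨ht, hlt⟩ htF)
      (mem_closure_inter_setOf_lt hℓ' Metric.isOpen_ball hw)
    · exact ((convex_ball z r).inter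
        (convex_halfSpace_gt ℓ'.toLinearMap.isLinear _)).isPreconnected
    · rintro s ⟨hs, hlt'⟩ hsd
      rw [mem_ofPred_eq, (mem_iff s hs).1 hsd,
        (mem_iff w hw).1 (edgeSegment_subset_drawing e hwe)] at hlt'
      exact hlt'.false
  refine ⟨Metric.ball z r, Metric.isOpen_ball, Metric.mem_ball_self hr, ?_, ?_⟩
  · obtain ⟨t, ht, hlt⟩ := closure_nonempty_iff.1
      ⟨z, mem_closure_inter_setOf_lt hℓ Metric.isOpen_ball (Metric.mem_ball_self hr)⟩
    obtain ⟨F, hF⟩ := exists_face_mem fun hd => hlt.ne' ((mem_drawing_iff t ht).1 hd)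
    exact ⟨F, t, hF, ht⟩
  · rintro F ⟨t, htF, ht⟩
    rcases lt_or_gt_of_ne fun h => Face.notMem_drawing htF ((mem_drawing_iff t ht).2 h)
      with hlt | hlt
    · exact closure_of_half_disc (neg_ne_zero.2 hℓ)
        (fun w hw => (mem_drawing_iff w hw).trans neg_inj.symm) htF ht (neg_lt_neg hlt)
    · exact closure_of_half_disc hℓ mem_drawing_iff htF ht hlt

theorem edgeSegment_subset_frontier {e : L.Edge} {x y : L.V} (hxy : (e : Sym2 L.V) = s(x, y))
    {z : ℂ} (hz : z ∈ openSegment ℝ (x : ℂ) y) {F : L.Face} (hF : z ∈ closure F.1) :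
    edgeSegment (e : Sym2 L.V) ⊆ frontier F.1 := by
  have edgeSegment_eq : edgeSegment (e : Sym2 L.V) = segment ℝ (x : ℂ) y := by rw [hxy]; rfl
  -- The part of the open edge in `closure F` is closed in the open edge, and it is also open.
  set W : Set ℂ := ⋃₀ {U | IsOpen U ∧ U ∩ edgeSegment (e : Sym2 L.V) ⊆ closure F.1}
  have mem_W : ∀ w ∈ openSegment ℝ (x : ℂ) y, w ∈ closure F.1 → w ∈ W := by
    intro w hw hwF
    obtain ⟨U, hU, hwU, -, hclosure⟩ := exists_isOpen_inter_edgeSegment_subset_closure hxy hw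
    obtain ⟨t, htU, htF⟩ := mem_closure_iff.1 hwF U hU hwU
    exact ⟨U, ⟨hU, hclosure F ⟨t, htF, htU⟩⟩, hwU⟩
  have W_subset : W ∩ edgeSegment (e : Sym2 L.V) ⊆ closure F.1 := by
    rintro w ⟨⟨U, ⟨-, hU⟩, hwU⟩, hwe⟩
    exact hU ⟨hwU, hwe⟩
  have openSegment_subset : openSegment ℝ (x : ℂ) y ⊆ edgeSegment (e : Sym2 L.V) :=
    edgeSegment_eq ▸ openSegment_subset_segment ℝ _ _
  have openSegment_subset_closure : openSegment ℝ (x : ℂ) y ⊆ closure F.1 := by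
    rcases isPreconnected_iff_subset_of_disjoint.1
      (convex_openSegment (x : ℂ) y).isPreconnected W (closure F.1)ᶜ
      (isOpen_sUnion fun U hU => hU.1) isClosed_closure.isOpen_compl
      (fun w hw => or_iff_not_imp_right.2 fun h => mem_W w hw (not_not.1 h))
      (eq_empty_of_forall_notMem fun w hw =>
        hw.2.2 (W_subset ⟨hw.2.1, openSegment_subset hw.1⟩)) with h | h
    · exact fun w hw => W_subset ⟨h hw, openSegment_subset hw⟩
    · exact absurd hF (h hz)
  rw [Face.frontier_eq]
  intro w hw
  refine ⟨?_, fun h => Face.notMem_drawing h (edgeSegment_subset_drawing e hw)⟩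
  rw [edgeSegment_eq, ← closure_openSegment] at hw
  exact closure_minimal openSegment_subset_closure isClosed_closure hw

theorem exists_adjacent_face (e : L.Edge) :
    ∃ F : L.Face, edgeSegment (e : Sym2 L.V) ⊆ frontier F.1 := by
  obtain ⟨x, y, hxy, -, hs⟩ := exists_endpoints e
  have hz := midpoint_mem_openSegment (𝕜 := ℝ) (x : ℂ) y
  obtain ⟨U, -, hzU, ⟨F, hF⟩, hclosure⟩ := exists_isOpen_inter_edgeSegment_subset_closure hxy hz
  exact ⟨F, edgeSegment_subset_frontier hxy hz
    (hclosure F hF ⟨hzU, hs ▸ openSegment_subset_segment ℝ _ _ hz⟩)⟩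

/-- The part of the plane covered by a set of faces, with its boundary. -/
def region (S : Set L.Face) : Set ℂ := closure (⋃ F ∈ S, F.1)

theorem exists_face_of_mem_region {S : Set L.Face} {e : L.Edge} {x y : L.V}
    (hxy : (e : Sym2 L.V) = s(x, y)) {z : ℂ} (hz : z ∈ openSegment ℝ (x : ℂ) y)
    (hS : z ∈ region S) : ∃ F ∈ S, edgeSegment (e : Sym2 L.V) ⊆ frontier F.1 := by
  obtain ⟨U, hU, hzU, -, hclosure⟩ := exists_isOpen_inter_edgeSegment_subset_closure hxy hz
  obtain ⟨t, htU, htS⟩ := mem_closure_iff.1 hS U hU hzU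
  obtain ⟨F, hF, htF⟩ := mem_iUnion₂.1 htS
  refine ⟨F, hF, edgeSegment_subset_frontier hxy hz (hclosure F ⟨t, htF, htU⟩ ⟨hzU, ?_⟩)⟩
  rw [hxy]
  exact openSegment_subset_segment ℝ _ _ hz

theorem edgeSegment_subset_region {S : Set L.Face} {e : L.Edge} {F : L.Face} (hF : F ∈ S)
    (h : edgeSegment (e : Sym2 L.V) ⊆ frontier F.1) : edgeSegment (e : Sym2 L.V) ⊆ region S :=
  h.trans (frontier_subset_closure.trans
    (closure_mono (subset_biUnion_of_mem (u := fun F : L.Face => F.1) hF)))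

theorem region_union_region_compl (S : Set L.Face) : region S ∪ region Sᶜ = univ := by
  have union_eq : region S ∪ region Sᶜ = closure (⋃ F : L.Face, F.1) := by
    rw [region, region, ← closure_union, ← biUnion_union, union_compl_self, biUnion_univ]
  rw [union_eq, eq_univ_iff_forall]
  intro z
  by_cases hz : z ∈ L.drawing
  · rw [drawing_eq, mem_iUnion] at hz
    obtain ⟨e, he⟩ := hz
    obtain ⟨F, hF⟩ := exists_adjacent_face e
    exact closure_mono (subset_iUnion (fun F : L.Face => F.1) F) (frontier_subset_closure (hF he))
  · exact subset_closure (mem_iUnion.2 (exists_face_mem hz))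

theorem mem_drawing_of_mem_region_inter {S : Set L.Face} {z : ℂ}
    (hz : z ∈ region S ∩ region Sᶜ) : z ∈ L.drawing := by
  by_contra hzd
  obtain ⟨F, hzF⟩ := exists_face_mem hzd
  have mem_of_mem_region {T : Set L.Face} (hT : z ∈ region T) : F ∈ T := by
    obtain ⟨t, htF, htT⟩ := mem_closure_iff.1 hT _ F.isOpen hzF
    obtain ⟨F', hF', htF'⟩ := mem_iUnion₂.1 htT
    rwa [Face.eq_of_mem htF htF']
  exact mem_of_mem_region hz.2 (mem_of_mem_region hz.1)

/-! ### The faces are bounded -/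

theorem joinedIn_drawing (x y : L.V) : JoinedIn L.drawing (x : ℂ) y := by
  obtain ⟨w⟩ := L.connected.preconnected x y
  induction w with
  | nil => exact JoinedIn.refl (Or.inl (Subtype.prop _))
  | cons hadj _ ih =>
    exact (JoinedIn.of_segment_subset (edgeSegment_subset_drawing ⟨s(_, _), hadj⟩)).trans ih

theorem IsPeriod.add_mem_drawing {w : ℂ} (hw : L.IsPeriod w) {z : ℂ} (hz : z ∈ L.drawing) :
    z + w ∈ L.drawing := by
  rw [drawing_eq, mem_iUnion] at hz
  obtain ⟨e, he⟩ := hz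
  apply edgeSegment_subset_drawing (hw.iso.mapEdgeSet e)
  rw [hw.edgeSegment]
  exact mem_image_of_mem _ he

theorem map_zsmul_add_zsmul {E : Type*} [NormedAddCommGroup E] [NormedSpace ℝ E] (b : E →L[ℝ] ℝ)
    (u v : E) (k n : ℤ) : b (k • u + n • v) = k * b u + n * b v := by
  rw [map_add, map_zsmul, map_zsmul, zsmul_eq_mul, zsmul_eq_mul]

/-- A path in the lattice from the origin to its translate by `u`, repeated periodically, gives
paths in the direction `u` that stay in strips of bounded width. -/
theorem exists_joinedIn_strip {u v : ℂ} (hu : L.IsPeriod u) (hv : L.IsPeriod v) {b : ℂ →L[ℝ] ℝ}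
    (hbu : b u = 0) (hbv : b v = 1) : ∃ M : ℝ, ∀ (n k : ℤ) (N : ℕ),
      JoinedIn (L.drawing ∩ {z | |b z - n| ≤ M}) (k • u + n • v) ((k + N) • u + n • v) := by
  have joined : JoinedIn L.drawing 0 u := by
    have origin_add : (hu.iso L.origin : ℂ) = u := (hu.coe_iso _).trans (zero_add u)
    rw [← origin_add]
    exact joinedIn_drawing L.origin _
  set γ := joined.somePath
  obtain ⟨M, hM⟩ := (isCompact_range (f := fun t => |b (γ t)|) (by fun_prop)).bddAbove
  have joined_succ (n k : ℤ) : JoinedIn (L.drawing ∩ {z | |b z - n| ≤ M}) (k • u + n • v)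
      ((k + 1) • u + n • v) := by
    refine ⟨(γ.map (f := fun z => z + (k • u + n • v)) (by fun_prop)).cast (zero_add _).symm
      (by rw [add_smul, one_smul]; ring), fun t => ?_⟩
    change γ t + (k • u + n • v) ∈ _
    refine ⟨(hu.lattice hv k n).add_mem_drawing (joined.somePath_mem t), ?_⟩
    rw [mem_ofPred_eq, map_add, map_zsmul_add_zsmul, hbu, hbv, mul_zero, mul_one, zero_add,
      add_sub_cancel_right]
    exact hM (mem_range_self t)
  refine ⟨M, fun n k N => ?_⟩
  induction N with
  | zero =>
    rw [Nat.cast_zero, add_zero]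
    exact JoinedIn.refl (joined_succ n k).source_mem
  | succ N ih =>
    rw [Nat.cast_succ, ← add_assoc]
    exact ih.trans (joined_succ n (k + N))

theorem exists_face_coordinate_le {u v : ℂ} (hu : L.IsPeriod u) (hv : L.IsPeriod v)
    {a b : ℂ →L[ℝ] ℝ} (hab : ∀ z, a z = 0 → b z = 0 → z = 0) (hau : a u = 1) (hav : a v = 0)
    (hbu : b u = 0) (hbv : b v = 1) :
    ∃ K : ℝ, ∀ F : L.Face, ∀ z ∈ F.1, ∀ w ∈ F.1, b z - b w ≤ K := by
  obtain ⟨M, hM⟩ := exists_joinedIn_strip hu hv hbu hbv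
  refine ⟨2 * M + 1, fun F z hz w hw => ?_⟩
  by_contra! hlt
  -- A path in `F` from `z` to `w` would cross the path in the drawing that runs between them.
  have hF : JoinedIn F.1 z w :=
    (F.isOpen.isConnected_iff_isPathConnected.1 F.isConnected).joinedIn z hz w hw
  obtain ⟨A, hA⟩ := (isCompact_range (f := fun t => |a (hF.somePath t)|) (by fun_prop)).bddAbove
  obtain ⟨N, hN⟩ := exists_nat_gt A
  have abs_a_lt : ∀ s ∈ F.1 ∩ range hF.somePath, |a s| < N := by
    rintro _ ⟨-, t, rfl⟩
    exact (hA (mem_range_self t)).trans_lt hN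
  obtain ⟨n, hn⟩ : ∃ n : ℤ, n = ⌊b w + M⌋ + 1 := ⟨_, rfl⟩
  have lt_n : b w + M < n := by
    rw [hn, Int.cast_add, Int.cast_one]
    exact Int.lt_floor_add_one _
  have n_le : (n : ℝ) ≤ b w + M + 1 := by
    rw [hn, Int.cast_add, Int.cast_one]
    linarith only [Int.floor_le (b w + M)]
  have a_endpoint (k : ℤ) : a (k • u + n • v) = k := by
    rw [map_zsmul_add_zsmul, hau, hav, mul_one, mul_zero, add_zero]
  have abs_b_sub_le : ∀ y ∈ L.drawing ∩ {y | |b y - n| ≤ M}, |b y - n| ≤ M := fun y hy => hy.2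
  refine not_disjoint_of_crossing hab hF (hM n (-N) (2 * N)) (fun y hy => ?_) (fun y hy => ?_)
    (fun s hs => ?_) (fun s hs => ?_) ?_
  · linarith only [(abs_le.1 (abs_b_sub_le y hy)).2, n_le, hlt]
  · linarith only [(abs_le.1 (abs_b_sub_le y hy)).1, lt_n]
  · rw [a_endpoint]
    exact_mod_cast (abs_lt.1 (abs_a_lt s hs)).1
  · rw [a_endpoint]
    push_cast
    linarith only [(abs_lt.1 (abs_a_lt s hs)).2]
  · exact Set.disjoint_left.2 fun y hy hy' => Face.notMem_drawing hy hy'.1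

theorem exists_face_dist_le (L : PlanarLattice) :
    ∃ D : ℝ, ∀ F : L.Face, ∀ z ∈ closure F.1, ∀ w ∈ closure F.1, dist z w ≤ D := by
  obtain ⟨u, v, h, hu, hv⟩ := L.exists_isPeriod
  obtain ⟨a, b, hab, hau, hav, hbu, hbv⟩ := exists_coordinates h
  have eq_zero : ∀ z, a z = 0 → b z = 0 → z = 0 := fun z ha hb => by
    rw [hab z, ha, hb, zero_smul, zero_smul, add_zero]
  obtain ⟨K, hK⟩ := exists_face_coordinate_le hu hv eq_zero hau hav hbu hbv
  obtain ⟨K', hK'⟩ :=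
    exists_face_coordinate_le hv hu (fun z hb ha => eq_zero z ha hb) hbv hbu hav hau
  set r := K' * ‖u‖ + K * ‖v‖
  have abs_map_sub_le {ℓ : ℂ →L[ℝ] ℝ} {c : ℝ} {F : L.Face}
      (hc : ∀ z ∈ F.1, ∀ w ∈ F.1, ℓ z - ℓ w ≤ c) {z w : ℂ} (hz : z ∈ F.1) (hw : w ∈ F.1) :
      |ℓ (z - w)| ≤ c := by
    rw [map_sub, abs_sub_le_iff]
    exact ⟨hc z hz w hw, hc w hw z hz⟩
  have dist_le (F : L.Face) : F.1 ×ˢ F.1 ⊆ {x : ℂ × ℂ | dist x.1 x.2 ≤ r} := by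
    rintro ⟨z, w⟩ ⟨hz, hw⟩
    change dist z w ≤ r
    rw [dist_eq_norm, hab (z - w)]
    refine (norm_add_le _ _).trans (add_le_add ?_ ?_) <;> rw [norm_smul, Real.norm_eq_abs]
    · exact mul_le_mul_of_nonneg_right (abs_map_sub_le (hK' F) hz hw) (norm_nonneg _)
    · exact mul_le_mul_of_nonneg_right (abs_map_sub_le (hK F) hz hw) (norm_nonneg _)
  refine ⟨r, fun F z hz w hw => ?_⟩
  have closure_subset := closure_minimal (dist_le F) (isClosed_le (by fun_prop) continuous_const)
  rw [closure_prod_eq] at closure_subset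
  exact closure_subset (mk_mem_prod hz hw)

/-! ### Finite clusters are surrounded by dual paths -/

/-- The edge `e` joins the set of vertices `C` to its complement. -/
def IsCut (C : Set L.V) (e : L.Edge) : Prop := ∃ x y, (e : Sym2 L.V) = s(x, y) ∧ x ∈ C ∧ y ∉ C

theorem not_isCut_iff {C : Set L.V} {e : L.Edge} : ¬IsCut C e ↔
    (∀ x ∈ (e : Sym2 L.V), x ∈ C) ∨ ∀ x ∈ (e : Sym2 L.V), x ∈ Cᶜ := by
  obtain ⟨x, y, hxy, -⟩ := exists_endpoints e
  simp only [IsCut, hxy, Sym2.mem_iff, Sym2.eq_iff, forall_eq_or_imp, forall_eq, mem_compl_iff]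
  grind

theorem locallyFinite_vertices (L : PlanarLattice) :
    LocallyFinite fun x : L.V => ({(x : ℂ)} : Set ℂ) := by
  refine fun z => ⟨Metric.ball z 1, Metric.ball_mem_nhds z one_pos,
    (finite_vertices_norm_le L (1 + ‖z‖)).subset ?_⟩
  rintro x ⟨_, rfl, hx⟩
  calc ‖(x : ℂ)‖ = ‖(x : ℂ) - z + z‖ := by rw [sub_add_cancel]
    _ ≤ ‖(x : ℂ) - z‖ + ‖z‖ := norm_add_le _ _
    _ ≤ 1 + ‖z‖ := add_le_add_left (mem_ball_iff_norm.1 hx).le _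

/-- The drawing of the subgraph induced by a set of vertices. -/
def inducedDrawing (s : Set L.V) : Set ℂ :=
  (⋃ x ∈ s, {(x : ℂ)}) ∪ ⋃ e ∈ {e : L.Edge | ∀ x ∈ (e : Sym2 L.V), x ∈ s},
    edgeSegment (e : Sym2 L.V)

theorem isClosed_inducedDrawing (s : Set L.V) : IsClosed (inducedDrawing s) := by
  refine IsClosed.union ?_ (isClosed_iUnion_edgeSegment _)
  rw [biUnion_eq_iUnion]
  exact (L.locallyFinite_vertices.comp_injective Subtype.val_injective).isClosed_iUnion
    fun _ => isClosed_singleton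

theorem isCompact_inducedDrawing {s : Set L.V} (hs : s.Finite) : IsCompact (inducedDrawing s) := by
  refine (hs.isCompact_biUnion fun _ _ => isCompact_singleton).union
    (Set.Finite.isCompact_biUnion ?_ fun e _ => isCompact_edgeSegment e)
  refine (finite_edges_of_finite hs).subset fun e he => ?_
  obtain ⟨x, y, hxy, -⟩ := exists_endpoints e
  have hx : x ∈ (e : Sym2 L.V) := hxy ▸ Sym2.mem_mk_left _ _
  exact ⟨x, he x hx, hx⟩

theorem coe_mem_inducedDrawing {s : Set L.V} {x : L.V} (hx : x ∈ s) :
    (x : ℂ) ∈ inducedDrawing s := Or.inl (mem_biUnion hx (mem_singleton _))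

theorem edgeSegment_subset_inducedDrawing {s : Set L.V} {e : L.Edge}
    (he : ∀ x ∈ (e : Sym2 L.V), x ∈ s) : edgeSegment (e : Sym2 L.V) ⊆ inducedDrawing s :=
  fun _ hz => Or.inr (mem_biUnion (t := fun e : L.Edge => edgeSegment (e : Sym2 L.V)) he hz)

theorem disjoint_inducedDrawing {s t : Set L.V} (hst : Disjoint s t) :
    Disjoint (inducedDrawing s) (inducedDrawing t) := by
  rw [Set.disjoint_left]
  intro z hz hz'
  simp only [inducedDrawing, mem_union, mem_iUnion, mem_singleton_iff] at hz hz'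
  obtain ⟨x, hxs, hxt⟩ : ∃ x : L.V, x ∈ s ∧ x ∈ t := by
    rcases hz with ⟨x, hx, rfl⟩ | ⟨e, he, hze⟩ <;> rcases hz' with ⟨y, hy, hzy⟩ | ⟨f, hf, hzf⟩
    · exact ⟨x, hx, Subtype.ext hzy ▸ hy⟩
    · exact ⟨x, hx, hf x (mem_of_coe_mem_edgeSegment hzf)⟩
    · exact ⟨y, he y (mem_of_coe_mem_edgeSegment (hzy ▸ hze)), hy⟩
    · obtain ⟨x, hxe, hxf⟩ : ∃ x, x ∈ (e : Sym2 L.V) ∧ x ∈ (f : Sym2 L.V) := by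
        by_cases hef : e = f
        · obtain ⟨x, y, hxy, -⟩ := exists_endpoints e
          have hx : x ∈ (e : Sym2 L.V) := hxy ▸ Sym2.mem_mk_left _ _
          exact ⟨x, hx, hef ▸ hx⟩
        · obtain ⟨x, -, hx⟩ := mem_of_mem_edgeSegment_inter hef hze hzf
          exact ⟨x, hx⟩
      exact ⟨x, he x hxe, hf x hxf⟩
  exact Set.disjoint_left.1 hst hxs hxt

theorem exists_continuous_cutoff {C : Set L.V} (hC : C.Finite) : ∃ (R : ℝ) (H : ℂ → ℝ),
    0 ≤ R ∧ Continuous H ∧ EqOn H 1 (inducedDrawing C) ∧ EqOn H 0 (inducedDrawing Cᶜ) ∧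
      ∀ z, R < ‖z‖ → H z = 0 := by
  obtain ⟨R, hR⟩ := (isCompact_inducedDrawing hC).isBounded.subset_closedBall 0
  have disjoint_far : Disjoint {z : ℂ | max R 0 + 1 ≤ ‖z‖} (inducedDrawing C) := by
    refine Set.disjoint_left.2 fun z hz hzC => ?_
    have norm_le : ‖z‖ ≤ R := mem_closedBall_zero_iff.1 (hR hzC)
    linarith only [mem_ofPred_eq ▸ hz, norm_le, le_max_left R 0]
  obtain ⟨H, hH0, hH1, -⟩ := exists_continuous_zero_one_of_isClosed
    ((isClosed_inducedDrawing Cᶜ).union (isClosed_le continuous_const continuous_norm))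
    (isClosed_inducedDrawing C)
    (Set.disjoint_union_left.2 ⟨disjoint_inducedDrawing disjoint_compl_left, disjoint_far⟩)
  exact ⟨max R 0 + 1, H, by positivity, H.continuous, hH1,
    fun z hz => hH0 (Or.inl hz), fun z hz => hH0 (Or.inr hz.le)⟩

section Separation

variable {C : Set L.V} {S : Set L.Face} {H : ℂ → ℝ}

theorem exists_eq_intCast_of_not_isCut (hH1 : EqOn H 1 (inducedDrawing C))
    (hH0 : EqOn H 0 (inducedDrawing Cᶜ)) {e : L.Edge} (he : ¬IsCut C e) {z : ℂ}
    (hz : z ∈ edgeSegment (e : Sym2 L.V)) : ∃ k : ℤ, H z = k := by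
  rcases not_isCut_iff.1 he with hin | hout
  · exact ⟨1, (hH1 (edgeSegment_subset_inducedDrawing hin hz)).trans Int.cast_one.symm⟩
  · exact ⟨0, (hH0 (edgeSegment_subset_inducedDrawing hout hz)).trans Int.cast_zero.symm⟩

theorem exists_eq_intCast_of_mem_region_inter
    (hS : ∀ e, IsCut C e → ∀ F ∈ S, ∀ F' : L.Face, edgeSegment (e : Sym2 L.V) ⊆ frontier F.1 →
      edgeSegment (e : Sym2 L.V) ⊆ frontier F'.1 → F' ∈ S)
    (hH1 : EqOn H 1 (inducedDrawing C)) (hH0 : EqOn H 0 (inducedDrawing Cᶜ)) {z : ℂ}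
    (hz : z ∈ region S ∩ region Sᶜ) : ∃ k : ℤ, H z = k := by
  have hzd := mem_drawing_of_mem_region_inter hz
  rw [drawing_eq, mem_iUnion] at hzd
  obtain ⟨e, hze⟩ := hzd
  by_cases hcut : IsCut C e
  · obtain ⟨x, y, hxy, hx, hy⟩ := id hcut
    have mem_segment : z ∈ segment ℝ (x : ℂ) y := by rwa [hxy] at hze
    rw [← insert_endpoints_openSegment] at mem_segment
    rcases mem_segment with rfl | rfl | hzo
    · exact ⟨1, (hH1 (coe_mem_inducedDrawing hx)).trans Int.cast_one.symm⟩
    · exact ⟨0, (hH0 (coe_mem_inducedDrawing (s := Cᶜ) hy)).trans Int.cast_zero.symm⟩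
    · obtain ⟨F, hF, heF⟩ := exists_face_of_mem_region hxy hzo hz.1
      obtain ⟨F', hF', heF'⟩ := exists_face_of_mem_region hxy hzo hz.2
      exact absurd (hS e hcut F hF F' heF heF') hF'
  · exact exists_eq_intCast_of_not_isCut hH1 hH0 hcut hze

theorem eq_of_reachable_of_integer_valued {P : Set L.Edge} {g : ℂ → ℝ} (hg : Continuous g)
    (hint : ∀ e ∈ P, ∀ z ∈ edgeSegment (e : Sym2 L.V), ∃ k : ℤ, g z = k) {x y : L.V}
    (hxy : (L.subgraphOf P).Reachable x y) : g x = g y := by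
  obtain ⟨w⟩ := hxy
  induction w with
  | nil => rfl
  | @cons x y z hadj _ ih =>
    obtain ⟨e, he, hxy⟩ := subgraphOf_adj.1 hadj
    refine Eq.trans ?_ ih
    exact eq_of_isPreconnected_of_integer_valued (isPreconnected_edgeSegment e) hg.continuousOn
      (hint e he) (coe_mem_edgeSegment (hxy ▸ Sym2.mem_mk_left _ _))
      (coe_mem_edgeSegment (hxy ▸ Sym2.mem_mk_right _ _))

theorem exists_continuous_integer_gluing_region (hH : Continuous H)
    (hint : ∀ z ∈ region S ∩ region Sᶜ, ∃ k : ℤ, H z = k) :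
    ∃ G : ℂ → ℝ, Continuous G ∧ (∀ z ∈ region S, ∃ k : ℤ, G z - H z = k) ∧
      (∀ z ∈ region Sᶜ, ∃ k : ℤ, G z = k) ∧ ∀ z, (∃ k : ℤ, H z = k) → ∃ k : ℤ, G z = k := by
  have hunion := region_union_region_compl S
  obtain ⟨G, hG, hG_sub_H, hG_int⟩ :=
    exists_continuous_integer_gluing isClosed_closure isClosed_closure hunion hH hint
  refine ⟨G, hG, hG_sub_H, hG_int, ?_⟩
  rintro z ⟨k, hk⟩
  rcases eq_univ_iff_forall.1 hunion z with hz | hz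
  · obtain ⟨l, hl⟩ := hG_sub_H z hz
    exact ⟨l + k, by rw [Int.cast_add, ← hl, ← hk, sub_add_cancel]⟩
  · exact hG_int z hz

/-- The cut-off `H` falls from `1` to `0` along every path from `C` to infinity. If `P` left `C`
only inside the region of `S` and `Q` only outside of it, then the function `G` that differs from
`H` by integers on the region of `S` and is an integer outside would fall by `1` along `P` and be
constant along `Q`; but `G` is constant far away, where the two paths end. -/
theorem exists_isCut_subset_frontier (hC : C.Finite)
    (hS : ∀ e, IsCut C e → ∀ F ∈ S, ∀ F' : L.Face, edgeSegment (e : Sym2 L.V) ⊆ frontier F.1 →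
      edgeSegment (e : Sym2 L.V) ⊆ frontier F'.1 → F' ∈ S)
    {o : L.V} (ho : o ∈ C) {P Q : Set L.Edge}
    (hP : ∀ r : ℝ, ∃ y : L.V, r < ‖(y : ℂ)‖ ∧ (L.subgraphOf P).Reachable o y)
    (hQ : ∀ r : ℝ, ∃ y : L.V, r < ‖(y : ℂ)‖ ∧ (L.subgraphOf Q).Reachable o y)
    (hPS : ∀ e ∈ P, IsCut C e → ∃ F ∈ S, edgeSegment (e : Sym2 L.V) ⊆ frontier F.1) :
    ∃ f ∈ Q, IsCut C f ∧ ∃ F ∈ S, edgeSegment (f : Sym2 L.V) ⊆ frontier F.1 := by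
  by_contra! hQS
  obtain ⟨R, H, hR, hH, hH1, hH0, H_far⟩ := exists_continuous_cutoff hC
  obtain ⟨G, hG, hG_sub_H, hG_int, G_int_of_H_int⟩ := exists_continuous_integer_gluing_region hH
    fun z => exists_eq_intCast_of_mem_region_inter hS hH1 hH0
  have int_along_P : ∀ e ∈ P, ∀ z ∈ edgeSegment (e : Sym2 L.V), ∃ k : ℤ, G z - H z = k := by
    intro e he z hz
    by_cases hcut : IsCut C e
    · obtain ⟨F, hFS, hF⟩ := hPS e he hcut
      exact hG_sub_H z (edgeSegment_subset_region hFS hF hz)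
    · obtain ⟨k, hk⟩ := exists_eq_intCast_of_not_isCut hH1 hH0 hcut hz
      obtain ⟨l, hl⟩ := G_int_of_H_int z ⟨k, hk⟩
      exact ⟨l - k, by rw [Int.cast_sub, ← hl, ← hk]⟩
  have int_along_Q : ∀ e ∈ Q, ∀ z ∈ edgeSegment (e : Sym2 L.V), ∃ k : ℤ, G z = k := by
    intro e he z hz
    by_cases hcut : IsCut C e
    · obtain ⟨F, hF⟩ := exists_adjacent_face e
      exact hG_int z (edgeSegment_subset_region (S := Sᶜ) (fun hFS => hQS e he hcut F hFS hF) hF hz)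
    · exact G_int_of_H_int z (exists_eq_intCast_of_not_isCut hH1 hH0 hcut hz)
  obtain ⟨y, hy, hoy⟩ := hP R
  obtain ⟨y', hy', hoy'⟩ := hQ R
  have G_far : G y = G y' := eq_of_isPreconnected_of_integer_valued
    (isPreconnected_setOf_lt_norm hR) hG.continuousOn
    (fun z hz => G_int_of_H_int z ⟨0, (H_far z hz).trans Int.cast_zero.symm⟩) hy hy'
  have along_P : G o - H o = G y - H y :=
    eq_of_reachable_of_integer_valued (hG.sub hH) int_along_P hoy
  have along_Q : G o = G y' := eq_of_reachable_of_integer_valued hG int_along_Q hoy'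
  have H_o : H o = 1 := hH1 (coe_mem_inducedDrawing ho)
  linarith only [G_far, along_P, along_Q, H_o, H_far y hy]

end Separation

theorem exists_dualConnected_of_finite {ω : L.Config} {C : Set L.V} (hC : C.Finite) {o : L.V}
    (ho : o ∈ C) (hclosed : ∀ e, IsCut C e → ω e = false) {P Q : Set L.Edge}
    (hP : ∀ r : ℝ, ∃ y : L.V, r < ‖(y : ℂ)‖ ∧ (L.subgraphOf P).Reachable o y)
    (hQ : ∀ r : ℝ, ∃ y : L.V, r < ‖(y : ℂ)‖ ∧ (L.subgraphOf Q).Reachable o y) :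
    ∃ e ∈ P, ∃ f ∈ Q, IsCut C e ∧ IsCut C f ∧ ∃ F F' : L.Face,
      edgeSegment (e : Sym2 L.V) ⊆ frontier F.1 ∧ edgeSegment (f : Sym2 L.V) ⊆ frontier F'.1 ∧
        DualConnected ω F F' := by
  set S : Set L.Face := {F' | ∃ e ∈ P, IsCut C e ∧ ∃ F : L.Face,
    edgeSegment (e : Sym2 L.V) ⊆ frontier F.1 ∧ DualConnected ω F F'}
  have cross_mem : ∀ e, IsCut C e → ∀ F ∈ S, ∀ F' : L.Face,
      edgeSegment (e : Sym2 L.V) ⊆ frontier F.1 → edgeSegment (e : Sym2 L.V) ⊆ frontier F'.1 →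
        F' ∈ S := by
    rintro f hf F ⟨e, he, hcut, F₀, hF₀, hconn⟩ F' hF hF'
    exact ⟨e, he, hcut, F₀, hF₀, hconn.tail ⟨f, hclosed f hf, hF, hF'⟩⟩
  have P_adjacent : ∀ e ∈ P, IsCut C e → ∃ F ∈ S, edgeSegment (e : Sym2 L.V) ⊆ frontier F.1 := by
    intro e he hcut
    obtain ⟨F, hF⟩ := exists_adjacent_face e
    exact ⟨F, ⟨e, he, hcut, F, hF, Relation.ReflTransGen.refl⟩, hF⟩
  obtain ⟨f, hf, hfcut, F', ⟨e, he, hcut, F, hF, hconn⟩, hF'⟩ :=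
    exists_isCut_subset_frontier hC cross_mem ho hP hQ P_adjacent
  exact ⟨e, he, f, hf, hcut, hfcut, F, F', hF, hF', hconn⟩

/-! ### Opening a segment of edges makes an infinite cluster likely -/

theorem DualConnected.anti {ω ω' : L.Config} (h : ω ≤ ω') {F F' : L.Face}
    (hc : DualConnected ω' F F') : DualConnected ω F F' := by
  refine Relation.ReflTransGen.mono ?_ F F' hc
  rintro F₁ F₂ ⟨e, he, hj⟩
  exact ⟨e, eq_bot_mono (h e) he, hj⟩

theorem le_openAll (F : Finset L.Edge) (ω : L.Config) : ω ≤ openAll F ω := by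
  intro e
  by_cases he : e ∈ F
  · rw [openAll_apply_mem he]
    exact le_top
  · rw [openAll_apply_notMem he]

theorem eq_false_of_isCut_setOf_reachable {ω : L.Config} {x : L.V} {e : L.Edge}
    (he : IsCut {y | (L.subgraphOf {e | ω e = true}).Reachable x y} e) : ω e = false := by
  obtain ⟨y, z, hyz, hy, hz⟩ := he
  by_contra hopen
  exact hz (SimpleGraph.Reachable.trans hy
    (subgraphOf_adj.2 ⟨e, Bool.eq_true_of_not_eq_false hopen, hyz⟩).reachable)

theorem exists_finset_reachable (x y : L.V) :
    ∃ W : Finset L.Edge, (L.subgraphOf (W : Set L.Edge)).Reachable x y := by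
  have reachable_univ : (L.subgraphOf univ).Reachable x y :=
    (L.connected.preconnected x y).mono fun a b hab =>
      subgraphOf_adj.2 ⟨⟨s(a, b), hab⟩, mem_univ _, rfl⟩
  obtain ⟨W, -, hW⟩ := exists_finset_of_reachable reachable_univ
  exact ⟨W, hW⟩

/-- The translates of a finite set of edges by the multiples `k • u` with `k` in `s`. -/
def translates {u : ℂ} (hu : L.IsPeriod u) (W : Finset L.Edge) (s : Set ℤ) : Set L.Edge :=
  {f | ∃ k ∈ s, ∃ e ∈ W, f = (hu.zsmul k).iso.mapEdgeSet e}

/-- A choice of a face next to the translate of the edge `e` by `w + k • u`. -/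
noncomputable def translatedFace {u w : ℂ} (hu : L.IsPeriod u) (hw : L.IsPeriod w) (k : ℤ)
    (e : L.Edge) : L.Face :=
  (exists_adjacent_face (hw.iso.mapEdgeSet ((hu.zsmul k).iso.mapEdgeSet e))).choose

section Translates

variable {u w : ℂ} (hu : L.IsPeriod u) (hw : L.IsPeriod w) {W : Finset L.Edge}

theorem translates_mono {s t : Set ℤ} (h : s ⊆ t) : translates hu W s ⊆ translates hu W t := by
  rintro f ⟨k, hk, hf⟩
  exact ⟨k, h hk, hf⟩

theorem finite_translates {s : Set ℤ} (hs : s.Finite) : (translates hu W s).Finite := by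
  refine (Set.Finite.image2 (fun k e => (hu.zsmul k).iso.mapEdgeSet e) hs W.finite_toSet).subset ?_
  rintro f ⟨k, hk, e, he, rfl⟩
  exact ⟨k, hk, e, he, rfl⟩

theorem edgeSegment_subset_frontier_translatedFace (k : ℤ) (e : L.Edge) :
    edgeSegment (hw.iso.mapEdgeSet ((hu.zsmul k).iso.mapEdgeSet e) : Sym2 L.V) ⊆
      frontier (translatedFace hu hw k e).1 :=
  (exists_adjacent_face _).choose_spec

theorem reachable_translates
    (hW : (L.subgraphOf (W : Set L.Edge)).Reachable L.origin (hu.iso L.origin)) {m n : ℤ}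
    (hmn : m ≤ n) : (L.subgraphOf (translates hu W (Ico m n))).Reachable
      ((hu.zsmul m).iso L.origin) ((hu.zsmul n).iso L.origin) := by
  induction n, hmn using Int.leInduction with
  | base => exact SimpleGraph.Reachable.refl _
  | succ n hmn ih =>
    refine (ih.mono (subgraphOf_mono (translates_mono hu (Ico_subset_Ico_right (by omega))))).trans
      ?_
    have iso_succ : (hu.zsmul n).iso (hu.iso L.origin) = (hu.zsmul (n + 1)).iso L.origin := by
      apply Subtype.ext
      simp only [IsPeriod.coe_iso, add_smul, one_smul]
      ring
    rw [← iso_succ]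
    refine (subgraphOf_reachable_image (hu.zsmul n).iso hW).mono (subgraphOf_mono ?_)
    rintro _ ⟨e, he, rfl⟩
    exact ⟨n, ⟨hmn, by omega⟩, e, he, rfl⟩

theorem coe_iso_iso_zsmul_origin (k : ℤ) :
    ((hw.iso ((hu.zsmul k).iso L.origin) : L.V) : ℂ) = k • u + w := by
  rw [IsPeriod.coe_iso, IsPeriod.coe_iso]
  exact congrArg (· + w) (zero_add _)

theorem exists_lt_norm_iso_iso_zsmul_origin (hu0 : u ≠ 0) (r : ℝ) : ∃ n : ℕ, ∀ k : ℤ,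
    (n : ℤ) ≤ |k| → r < ‖((hw.iso ((hu.zsmul k).iso L.origin) : L.V) : ℂ)‖ := by
  have norm_u_pos : 0 < ‖u‖ := norm_pos_iff.2 hu0
  obtain ⟨n, hn⟩ := exists_nat_gt ((r + ‖w‖) / ‖u‖)
  refine ⟨n, fun k hk => ?_⟩
  rw [div_lt_iff₀ norm_u_pos] at hn
  have n_le : (n : ℝ) ≤ |(k : ℝ)| := by exact_mod_cast hk
  rw [coe_iso_iso_zsmul_origin hu hw]
  calc r < n * ‖u‖ - ‖w‖ := lt_sub_iff_add_lt.2 hn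
    _ ≤ |(k : ℝ)| * ‖u‖ - ‖w‖ :=
      sub_le_sub_right (mul_le_mul_of_nonneg_right n_le norm_u_pos.le) _
    _ = ‖k • u‖ - ‖w‖ := by rw [← Int.cast_smul_eq_zsmul ℝ, norm_smul, Real.norm_eq_abs]
    _ ≤ ‖k • u + w‖ := norm_sub_le_norm_add _ _

theorem exists_lt_norm_reachable_image_translates (hu0 : u ≠ 0) {s : Set ℤ}
    (hs : ∀ n : ℕ, ∃ k : ℤ, (n : ℤ) ≤ |k| ∧ (L.subgraphOf (translates hu W s)).Reachable
      ((hu.zsmul 0).iso L.origin) ((hu.zsmul k).iso L.origin)) (r : ℝ) :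
    ∃ y : L.V, r < ‖(y : ℂ)‖ ∧
      (L.subgraphOf (hw.iso.mapEdgeSet '' translates hu W s)).Reachable (hw.iso L.origin) y := by
  have origin_eq : hw.iso ((hu.zsmul 0).iso L.origin) = hw.iso L.origin := Subtype.ext (by
    rw [coe_iso_iso_zsmul_origin hu hw, zero_smul, IsPeriod.coe_iso]
    rfl)
  obtain ⟨n, hn⟩ := exists_lt_norm_iso_iso_zsmul_origin hu hw hu0 r
  obtain ⟨k, hk, hreach⟩ := hs n
  exact ⟨_, hn k hk, origin_eq ▸ subgraphOf_reachable_image hw.iso hreach⟩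

theorem notMem_of_openAll_shift_eq_false {E : Finset L.Edge} {s : Set ℤ}
    (hE : (E : Set L.Edge) = translates hu W s) {ω : L.Config} {k : ℤ} {e : L.Edge} (he : e ∈ W)
    (hclosed : openAll (shift hw.iso E) ω
      (hw.iso.mapEdgeSet ((hu.zsmul k).iso.mapEdgeSet e)) = false) : k ∉ s := by
  intro hk
  have mem_E : (hu.zsmul k).iso.mapEdgeSet e ∈ (E : Set L.Edge) := hE ▸ ⟨k, hk, e, he, rfl⟩
  rw [openAll_apply_mem (mapEdgeSet_mem_shift.2 (Finset.mem_coe.1 mem_E))] at hclosed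
  exact Bool.false_ne_true hclosed.symm

/-- The line of translates of `W` through `w` is split at `w` into two paths to infinity; a finite
cluster of `w` is left by both, and they leave it beyond the edges that have been opened. -/
theorem exists_dualConnected_translatedFace (hu0 : u ≠ 0)
    (hW : (L.subgraphOf (W : Set L.Edge)).Reachable L.origin (hu.iso L.origin)) {N : ℕ}
    {E : Finset L.Edge} (hE : (E : Set L.Edge) = translates hu W (Ico (-N : ℤ) N)) {ω : L.Config}
    (hfin : ¬ConnectedToInfinity (openAll (shift hw.iso E) ω) (hw.iso L.origin)) :
    ∃ k l : ℤ, (N : ℤ) ≤ k ∧ l < -N ∧ ∃ e ∈ W, ∃ f ∈ W,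
      DualConnected ω (translatedFace hu hw k e) (translatedFace hu hw l f) := by
  obtain ⟨_, ⟨_, ⟨k, hk, e, he, rfl⟩, rfl⟩, _, ⟨_, ⟨l, hl, f, hf, rfl⟩, rfl⟩, hcut_e, hcut_f,
      F, F', hF, hF', hconn⟩ :=
    exists_dualConnected_of_finite (Set.not_infinite.1 hfin) (SimpleGraph.Reachable.refl _)
      (fun _ => eq_false_of_isCut_setOf_reachable)
      (exists_lt_norm_reachable_image_translates hu hw hu0 (s := Ici 0) fun n =>
        ⟨n, (Nat.abs_cast n).ge, (reachable_translates hu hW n.cast_nonneg).mono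
          (subgraphOf_mono (translates_mono hu fun _ h => h.1))⟩)
      (exists_lt_norm_reachable_image_translates hu hw hu0 (s := Iio 0) fun n =>
        ⟨-n, (abs_neg (n : ℤ)).symm ▸ (Nat.abs_cast n).ge,
          ((reachable_translates hu hW (neg_nonpos.2 n.cast_nonneg)).mono
            (subgraphOf_mono (translates_mono hu fun _ h => h.2))).symm⟩)
  have closed_e := eq_false_of_isCut_setOf_reachable hcut_e
  have closed_f := eq_false_of_isCut_setOf_reachable hcut_f
  have hk_notMem := notMem_of_openAll_shift_eq_false hu hw hE he closed_e
  have hl_notMem := notMem_of_openAll_shift_eq_false hu hw hE hf closed_f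
  rw [mem_Ico] at hk_notMem hl_notMem
  rw [mem_Ici] at hk
  rw [mem_Iio] at hl
  refine ⟨k, l, by omega, by omega, e, he, f, hf, ?_⟩
  refine (Relation.ReflTransGen.single ⟨_, eq_bot_mono (le_openAll _ ω _) closed_e,
    edgeSegment_subset_frontier_translatedFace hu hw k e, hF⟩).trans
    ((hconn.anti (le_openAll _ ω)).trans (Relation.ReflTransGen.single ⟨_,
      eq_bot_mono (le_openAll _ ω _) closed_f, hF',
      edgeSegment_subset_frontier_translatedFace hu hw l f⟩))

end Translates

theorem exists_dist_translatedFace_ge (D : L.DualPlacement) {u : ℂ} (hu : L.IsPeriod u)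
    (W : Finset L.Edge) : ∃ B : ℝ, ∀ (w : ℂ) (hw : L.IsPeriod w), ∀ e ∈ W, ∀ f ∈ W, ∀ k l : ℤ,
      |(k - l : ℝ)| * ‖u‖ - B ≤
        dist (D.pos (translatedFace hu hw k e)) (D.pos (translatedFace hu hw l f)) := by
  obtain ⟨R, hR⟩ := L.exists_face_dist_le
  obtain ⟨B, hB⟩ :=
    (W.finite_toSet.isCompact_biUnion fun e _ => isCompact_edgeSegment e).isBounded.exists_norm_le
  refine ⟨2 * (R + B), fun w hw e he f hf k l => ?_⟩
  have dist_le : ∀ g ∈ W, ∀ m : ℤ,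
      dist (D.pos (translatedFace hu hw m g)) (m • u + w) ≤ R + B := by
    intro g hg m
    obtain ⟨x, y, hxy, -⟩ := exists_endpoints g
    have hx : (x : ℂ) ∈ edgeSegment (g : Sym2 L.V) :=
      coe_mem_edgeSegment (hxy ▸ Sym2.mem_mk_left _ _)
    have translate_mem : (x : ℂ) + m • u + w ∈
        edgeSegment (hw.iso.mapEdgeSet ((hu.zsmul m).iso.mapEdgeSet g) : Sym2 L.V) := by
      rw [hw.edgeSegment, (hu.zsmul m).edgeSegment]
      exact ⟨_, ⟨x, hx, rfl⟩, rfl⟩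
    refine (dist_triangle _ ((x : ℂ) + m • u + w) _).trans (add_le_add ?_ ?_)
    · exact hR _ _ (subset_closure (D.pos_mem _)) _ (frontier_subset_closure
        (edgeSegment_subset_frontier_translatedFace hu hw m g translate_mem))
    · rw [add_assoc, dist_eq_norm, add_sub_cancel_right]
      exact hB x (mem_biUnion (t := fun e : L.Edge => edgeSegment (e : Sym2 L.V)) hg hx)
  have dist_centers : dist (k • u + w) (l • u + w) = |(k - l : ℝ)| * ‖u‖ := by
    rw [dist_add_right, dist_eq_norm, ← sub_smul, ← Int.cast_smul_eq_zsmul ℝ, norm_smul,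
      Real.norm_eq_abs, Int.cast_sub]
  have triangle := dist_triangle4 (k • u + w) (D.pos (translatedFace hu hw k e))
    (D.pos (translatedFace hu hw l f)) (l • u + w)
  rw [dist_centers, dist_comm (k • u + w)] at triangle
  linarith only [triangle, dist_le e he k, dist_le f hf l]

theorem measure_iUnion_iUnion_biUnion_biUnion_le {Ω ι κ : Type*} [MeasurableSpace Ω]
    (μ : Measure Ω) (s : Finset ι) (t : Finset κ) (A : ℕ → ℕ → ι → κ → Set Ω)
    (a : ℕ → ℕ → ENNReal) (hA : ∀ i j, ∀ x ∈ s, ∀ y ∈ t, μ (A i j x y) ≤ a i j) :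
    μ (⋃ i, ⋃ j, ⋃ x ∈ s, ⋃ y ∈ t, A i j x y) ≤ ∑' i, ∑' j, s.card * (t.card * a i j) := by
  refine (measure_iUnion_le _).trans (ENNReal.tsum_le_tsum fun i => ?_)
  refine (measure_iUnion_le _).trans (ENNReal.tsum_le_tsum fun j => ?_)
  calc μ (⋃ x ∈ s, ⋃ y ∈ t, A i j x y) ≤ ∑ x ∈ s, ∑ y ∈ t, μ (A i j x y) :=
        (measure_biUnion_finset_le _ _).trans
          (Finset.sum_le_sum fun x _ => measure_biUnion_finset_le _ _)
    _ ≤ ∑ _ ∈ s, ∑ _ ∈ t, a i j :=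
        Finset.sum_le_sum fun x hx => Finset.sum_le_sum fun y hy => hA i j x hx y hy
    _ = s.card * (t.card * a i j) := by simp only [Finset.sum_const, nsmul_eq_mul]

theorem exists_tsum_tsum_mul_pow_le {K r ε : ENNReal} (hK : K ≠ ⊤) (hr : r < 1) (hε : 0 < ε) :
    ∃ N : ℕ, ∑' (i : ℕ) (j : ℕ), K * r ^ (2 * N + i + j) ≤ ε := by
  have inv_ne_top : (1 - r)⁻¹ ≠ ⊤ := ENNReal.inv_ne_top.2 (tsub_pos_of_lt hr).ne'
  have hlim : Tendsto (fun N : ℕ => K * ((1 - r)⁻¹ * (1 - r)⁻¹) * (r ^ 2) ^ N) atTop (𝓝 0) := by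
    rw [← mul_zero (K * ((1 - r)⁻¹ * (1 - r)⁻¹))]
    exact ENNReal.Tendsto.const_mul
      (ENNReal.tendsto_pow_atTop_nhds_zero_of_lt_one (pow_lt_one₀ zero_le hr two_ne_zero))
      (Or.inr (ENNReal.mul_ne_top hK (ENNReal.mul_ne_top inv_ne_top inv_ne_top)))
  obtain ⟨N, hN⟩ := (hlim.eventually_le_const hε).exists
  refine ⟨N, le_of_eq_of_le ?_ hN⟩
  simp only [pow_add, pow_mul, ENNReal.tsum_mul_left, ENNReal.tsum_mul_right,
    ENNReal.tsum_geometric]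
  ring

theorem measure_dualConnected_le_mul_pow (D : L.DualPlacement) {φ : Measure L.Config}
    [IsFiniteMeasure φ] {c : ℝ} (hc : 0 ≤ c) {F F' : L.Face}
    (hdecay : φ.real {ω | DualConnected ω F F'} ≤ Real.exp (-c * dist (D.pos F) (D.pos F')))
    {n : ℕ} {r B : ℝ} (hdist : n * r - B ≤ dist (D.pos F) (D.pos F')) :
    φ {ω | DualConnected ω F F'} ≤
      ENNReal.ofReal (Real.exp (c * B)) * ENNReal.ofReal (Real.exp (-c * r)) ^ n := by
  rw [← ENNReal.ofReal_pow (Real.exp_pos _).le, ← ENNReal.ofReal_mul (Real.exp_pos _).le,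
    ← ofReal_measureReal (μ := φ)]
  refine ENNReal.ofReal_le_ofReal (hdecay.trans ?_)
  rw [← Real.exp_nat_mul, ← Real.exp_add, Real.exp_le_exp]
  linarith only [mul_le_mul_of_nonneg_left hdist hc]

theorem exists_measure_finite_cluster_le (D : L.DualPlacement) {φ : Measure L.Config}
    [IsProbabilityMeasure φ] {c : ℝ} (hc : 0 < c) (hdecay : ∀ F F' : L.Face,
      φ.real {ω | DualConnected ω F F'} ≤ Real.exp (-c * dist (D.pos F) (D.pos F'))) {u : ℂ}
    (hu : L.IsPeriod u) (hu0 : u ≠ 0) {ε : ENNReal} (hε : 0 < ε) :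
    ∃ E : Finset L.Edge, ∀ (w : ℂ) (hw : L.IsPeriod w),
      φ {ω | ¬ConnectedToInfinity (openAll (shift hw.iso E) ω) (hw.iso L.origin)} ≤ ε := by
  obtain ⟨W, hW⟩ := exists_finset_reachable L.origin (hu.iso L.origin)
  obtain ⟨B, hB⟩ := exists_dist_translatedFace_ge D hu W
  set ρ : ℝ := Real.exp (-c * ‖u‖)
  set a : ENNReal := ENNReal.ofReal (Real.exp (c * B))
  have hρ : ENNReal.ofReal ρ < 1 := by
    rw [ENNReal.ofReal_lt_one, Real.exp_lt_one_iff, neg_mul, neg_lt_zero]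
    exact mul_pos hc (norm_pos_iff.2 hu0)
  have hK : (W.card * (W.card * a) : ENNReal) ≠ ⊤ := ENNReal.mul_ne_top (ENNReal.natCast_ne_top _)
    (ENNReal.mul_ne_top (ENNReal.natCast_ne_top _) ENNReal.ofReal_ne_top)
  obtain ⟨N, hN⟩ := exists_tsum_tsum_mul_pow_le hK hρ hε
  have hfin := finite_translates hu (W := W) (Set.finite_Ico (-N : ℤ) N)
  refine ⟨hfin.toFinset, fun w hw => ?_⟩
  set A : ℕ → ℕ → L.Edge → L.Edge → Set L.Config := fun i j e f => {ω | DualConnected ω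
    (translatedFace hu hw (N + i) e) (translatedFace hu hw (-(N + 1 + j)) f)}
  have subset_iUnion : {ω | ¬ConnectedToInfinity (openAll (shift hw.iso hfin.toFinset) ω)
      (hw.iso L.origin)} ⊆ ⋃ i, ⋃ j, ⋃ e ∈ W, ⋃ f ∈ W, A i j e f := by
    intro ω hω
    obtain ⟨k, l, hk, hl, e, he, f, hf, h⟩ :=
      exists_dualConnected_translatedFace hu hw hu0 hW hfin.coe_toFinset hω
    obtain ⟨i, rfl⟩ : ∃ i : ℕ, k = N + i := ⟨(k - N).toNat, by omega⟩
    obtain ⟨j, rfl⟩ : ∃ j : ℕ, l = -(N + 1 + j) := ⟨(-l - N - 1).toNat, by omega⟩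
    simp only [mem_iUnion]
    exact ⟨i, j, e, he, f, hf, h⟩
  have measure_le : ∀ i j, ∀ e ∈ W, ∀ f ∈ W,
      φ (A i j e f) ≤ a * ENNReal.ofReal ρ ^ (2 * N + i + j) := by
    intro i j e he f hf
    refine measure_dualConnected_le_mul_pow D hc.le (hdecay _ _) ?_
    have dist_ge := hB w hw e he f hf (N + i) (-(N + 1 + j))
    push_cast at dist_ge ⊢
    rw [abs_of_nonneg (by linarith)] at dist_ge
    linarith [norm_nonneg u]
  calc φ _ ≤ φ (⋃ i, ⋃ j, ⋃ e ∈ W, ⋃ f ∈ W, A i j e f) := measure_mono subset_iUnion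
    _ ≤ ∑' (i : ℕ) (j : ℕ), W.card * (W.card * (a * ENNReal.ofReal ρ ^ (2 * N + i + j))) :=
        measure_iUnion_iUnion_biUnion_biUnion_le φ W W A _ measure_le
    _ ≤ ε := by simpa only [mul_assoc] using hN

theorem exists_pos_le_connectedToInfinity {p q : ℝ} (hp : p ∈ Ioo (0 : ℝ) 1) (hq : 1 ≤ q)
    (D : L.DualPlacement) {φ : Measure L.Config} (hφ : IsRandomClusterMeasure p q φ) {c : ℝ}
    (hc : 0 < c) (hdecay : ∀ F F' : L.Face,
      φ.real {ω | DualConnected ω F F'} ≤ Real.exp (-c * dist (D.pos F) (D.pos F'))) :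
    ∃ δ : ℝ, 0 < δ ∧ ∀ (w : ℂ) (hw : L.IsPeriod w),
      δ ≤ φ.real {ω | ConnectedToInfinity ω (hw.iso L.origin)} := by
  have := hφ.isProbabilityMeasure
  obtain ⟨u, v, h, hu, -⟩ := L.exists_isPeriod
  obtain ⟨E, hE⟩ := exists_measure_finite_cluster_le D hc hdecay hu (h.ne_zero 0)
    (ε := ENNReal.ofReal (1 / 2)) (ENNReal.ofReal_pos.2 one_half_pos)
  have hcost := openingCost_pos hp.1 (one_pos.trans_le hq) E.card
  refine ⟨1 / 2 / openingCost p q E.card, by positivity, fun w hw => ?_⟩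
  set A : Set L.Config := {ω | ConnectedToInfinity ω (hw.iso L.origin)}
  have compl_le : φ.real (openAll (shift hw.iso E) ⁻¹' A)ᶜ ≤ 1 / 2 :=
    ENNReal.toReal_le_of_le_ofReal one_half_pos.le (hE w hw)
  rw [probReal_compl_eq_one_sub
    ((continuous_openAll _).measurable (measurableSet_connectedToInfinity _))] at compl_le
  have finite_energy := hφ.preimage_openAll_le hp hq (shift hw.iso E) A
  rw [show (shift hw.iso E).card = E.card from Finset.card_map _] at finite_energy
  have finite_energy_real : φ.real (openAll (shift hw.iso E) ⁻¹' A) ≤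
      openingCost p q E.card * φ.real A := by
    refine (ENNReal.toReal_mono (by finiteness) finite_energy).trans_eq ?_
    rw [ENNReal.toReal_mul, ENNReal.toReal_ofReal hcost.le]
    rfl
  rw [div_le_iff₀' hcost]
  linarith only [compl_le, finite_energy_real]

end PlanarLattice

theorem proposition5p3 (L : PlanarLattice) (D : L.DualPlacement) (q : ℝ) (hq : 1 ≤ q)
    (p : ℝ) (hp : p ∈ Set.Ioo (0 : ℝ) 1)
    (φ : MeasureTheory.Measure L.Config) (hφ : PlanarLattice.IsRandomClusterMeasure p q φ)
    (hdecay : ∃ c : ℝ, 0 < c ∧ ∀ u v : L.Face,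
      φ.real {ω | PlanarLattice.DualConnected ω u v} ≤ Real.exp (-c * dist (D.pos u) (D.pos v))) :
    0 < φ {ω | PlanarLattice.ConnectedToInfinity ω L.origin} ∧ L.criticalPoint q ≤ p := by
  have := hφ.isProbabilityMeasure
  obtain ⟨c, hc, hdecay⟩ := hdecay
  obtain ⟨δ, hδ, hδφ⟩ := PlanarLattice.exists_pos_le_connectedToInfinity hp hq D hφ hc hdecay
  obtain ⟨u, v, h, hu, hv⟩ := L.exists_isPeriod
  refine ⟨?_, PlanarLattice.criticalPoint_le_of_connectedToInfinity hp hq hφ h hu hv hδ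
    fun m n => hδφ _ _⟩
  have percolation_at_origin := hδφ 0 PlanarLattice.IsPeriod.zero
  have iso_zero_origin : (PlanarLattice.IsPeriod.zero (L := L)).iso L.origin = L.origin :=
    Subtype.ext (by rw [PlanarLattice.IsPeriod.coe_iso, add_zero])
  rw [iso_zero_origin] at percolation_at_origin
  exact (ENNReal.toReal_pos_iff.1 (hδ.trans_le percolation_at_origin)).1
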